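/- Fix integers $K,p\ge 0$, vectors $h=(h_0,\dots,h_K)$, $\alpha=(\alpha_0,\dots,\alpha_K)\in\mathbb{R}^{K+1}$, and $P_X>0$, $\sigma>0$. Consider the Gaussian ISI channel $$y_t=\sum_{i=0}^K h_i x_{t-i}+w_t,\qquad t=1,\dots,n,$$ with $x_t=0$ for $t\le 0$ and $w_t$ i.i.d. $\mathcal N(0,\sigma^2)$, independent of the input. A code of length $n$ is a family of $M$ codewords $x_1,\dots,x_M\in\mathbb{R}^n$, used equiprobably, satisfying $\frac1M\sum_{i=1}^M\sum_{t=1}^n x_{i,t}^2\le nP_X$. The decoder chooses the message $i$ maximising $$\log V(y|x_i)=-\tfrac n2\log(2\pi\sigma^2)-\tfrac1{2\sigma^2}\sum_{t=1}^n\Big(y_t-\sum_{k=0}^K\alpha_k x_{i,t-k}\Big)^2,$$ and ties count as errors. A rate $R$ (in nats) is achievable if for every $\delta>0$ there are codes $(\mathfrak C_n)_{n\ge1}$ with $M\ge e^{n(R-\delta)}$ whose average error probability tends to $0$; the mismatch capacity $C^{\mathrm{Mis}}_{\mathrm{ISI}}$ is the supremum of the achievable rates. Let $\mathcal P\subset\mathbb{R}^p$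 be the set of $\varphi=(\varphi_1,\dots,\varphi_p)$ such that all roots of $z^p-\sum_{i=1}^p\varphi_i z^{p-i}$ lie strictly inside the unit circle. Put $A(\nu)=\sum_{k=0}^K\alpha_k e^{-jk\nu}$, $H(\nu)=\sum_{k=0}^K h_k e^{-jk\nu}$, $\Phi(\nu)=\sum_{k=1}^p\varphi_k e^{-jk\nu}$, $$\eta^2=P_X\Big[\tfrac1{2\pi}\int_0^{2\pi}\frac{d\nu}{|1-\Phi(\nu)|^2}\Big]^{-1},\quad S_X(\nu)=\frac{\eta^2}{|1-\Phi(\nu)|^2},\quad S_Y(\nu)=|H(\nu)|^2S_X(\nu)+\sigma^2,$$ $$f_\omega(\nu)=\tfrac\omega2|A(\nu)|^2+\tfrac1{2\eta^2}\big[1+|\Phi(\nu)|^2-2\,\mathrm{Re}\,\Phi(\nu)\big],$$ and let $(\gamma_m)_{m\in\mathbb Z}$ be the solution of $\gamma_{-m}=\gamma_m$, $\gamma_m=\sum_{k=1}^p\varphi_k\gamma_{m-k}+\eta^2\delta_m$ for $m\ge 0$. Define $$J(\omega)=-\tfrac1{4\pi}\int_0^{2\pi}\log f_\omega(\nu)\,d\nu+\tfrac{\omega^2}{8\pi}\int_0^{2\pi}\frac{S_Y(\nu)|A(\nu)|^2}{f_\omega(\nu)}\,d\nu-\omega\Big[\sum_{l,i=0}^K\alpha_l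 h_i\gamma_{l-i}-\Big(\tfrac12\|\alpha\|_2^2\gamma_0+\sum_{l=1}^K\sum_{k=0}^{K-l}\alpha_k\alpha_{k+l}\gamma_l\Big)\Big]$$ and $\bar I_1(\alpha,\varphi)=\tfrac12\log(2\eta^2)-\inf_{\omega>0}J(\omega)$. Then $$C^{\mathrm{Mis}}_{\mathrm{ISI}}\ \ge\ \sup_{\varphi\in\mathcal P}\bar I_1(\alpha,\varphi).$$ Moreover, for every $\varphi\in\mathcal P$: the equations for $\gamma$ have exactly one solution; $J$ is convex and bounded below on $(0,\infty)$; and $\bar I_1(\alpha,\varphi)$ is the exact threshold of the following ensemble. Draw $M=\lceil e^{nR}\rceil$ codewords independently, each distributed as $X_t=\sum_{i=1}^p\varphi_iX_{t-i}+\eta Z_t$ for $1\le t\le n$, with $X_t=0$ for $t<1$ and $Z_t$ i.i.d. $\mathcal N(0,1)$. This ensemble satisfies $\sum_{t=1}^n\mathbb E X_t^2\le nP_X$, its average error probability tends to $0$ as $n\to\infty$ for every $R<\bar I_1(\alpha,\varphi)$, and it does not tend to $0$ for any $R>\bar I_1(\alpha,\varphi)$. -/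

import Mathlib

open MeasureTheory ProbabilityTheory Filter Topology Set
open scoped ENNReal

noncomputable section

namespace ISI

/-! ### Channel, decoding metric, codes, mismatch capacity

Time instants `1, …, n` are indexed by `Fin n` (so `t : Fin n` is time `t + 1`). -/

/-- A finite sequence, continued by zero to all integer indices. -/
def zeroExt {n : ℕ} (x : Fin n → ℝ) (t : ℤ) : ℝ :=
  if ht : 0 ≤ t ∧ t < n then x ⟨t.toNat, by omega⟩ else 0

/-- The filtered block `t ↦ ∑_{i=0}^K a_i x_{t-i}`, with `x` equal to zero before the block. -/
def filt {K n : ℕ} (a : Fin (K + 1) → ℝ) (x : Fin n → ℝ) (t : Fin n) : ℝ :=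
  ∑ i : Fin (K + 1), a i * zeroExt x ((t : ℤ) - (i : ℤ))

/-- The law of `n` samples of white Gaussian noise of variance `σ²`. -/
def noise (n : ℕ) (σ : ℝ) : Measure (Fin n → ℝ) :=
  Measure.pi fun _ => gaussianReal 0 (σ ^ 2).toNNReal

/-- The channel output `y_t = ∑ h_i x_{t-i} + w_t`. -/
def output {K n : ℕ} (h : Fin (K + 1) → ℝ) (x w : Fin n → ℝ) : Fin n → ℝ :=
  fun t => filt h x t + w t

/-- The decoding metric `log V(y|x)`: the log-likelihood of the Gaussian ISI channel with
coefficients `α`. -/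
def logMetric {K n : ℕ} (α : Fin (K + 1) → ℝ) (σ : ℝ) (y x : Fin n → ℝ) : ℝ :=
  -((n : ℝ) / 2) * Real.log (2 * Real.pi * σ ^ 2)
    - 1 / (2 * σ ^ 2) * ∑ t : Fin n, (y t - filt α x t) ^ 2

/-- The noise realisations for which message `i` is decoded erroneously: some other codeword has
a metric at least as large as that of the transmitted one (a tie counts as an error). -/
def errorEvent {K n M : ℕ} (h α : Fin (K + 1) → ℝ) (σ : ℝ) (x : Fin M → Fin n → ℝ)
    (i : Fin M) : Set (Fin n → ℝ) :=
  {w | ∃ j, j ≠ i ∧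
    logMetric α σ (output h (x i) w) (x i) ≤ logMetric α σ (output h (x i) w) (x j)}

/-- Error probability of a code with equiprobable messages. -/
def errorProb {K n M : ℕ} (h α : Fin (K + 1) → ℝ) (σ : ℝ) (x : Fin M → Fin n → ℝ) : ℝ≥0∞ :=
  (M : ℝ≥0∞)⁻¹ * ∑ i : Fin M, noise n σ (errorEvent h α σ x i)

/-- The average power constraint `∑_t 𝔼 X_t² ≤ n P`, for `X` a uniformly chosen codeword. -/
def PowerConstraint {n M : ℕ} (P : ℝ) (x : Fin M → Fin n → ℝ) : Prop :=
  ∑ t : Fin n, (1 / (M : ℝ)) * ∑ i : Fin M, x i t ^ 2 ≤ n * P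

/-- `R` (in nats per channel use) is achievable with the mismatched decoder. -/
def Achievable {K : ℕ} (h α : Fin (K + 1) → ℝ) (P σ R : ℝ) : Prop :=
  ∀ δ : ℝ, 0 < δ → ∃ (M : ℕ → ℕ) (code : (n : ℕ) → Fin (M n) → Fin n → ℝ),
    (∀ n : ℕ, 1 ≤ n → Real.exp (n * (R - δ)) ≤ M n ∧ PowerConstraint P (code n)) ∧
    Tendsto (fun n => errorProb h α σ (code n)) atTop (𝓝 0)

/-- The mismatch capacity: the supremum of all achievable rates. -/
def mismatchCapacity {K : ℕ} (h α : Fin (K + 1) → ℝ) (P σ : ℝ) : EReal :=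
  sSup ((fun R : ℝ => (R : EReal)) '' {R | Achievable h α P σ R})

/-! ### Autoregressive spectra and the rate expression

The vector `φ = (φ_1, …, φ_p)` is indexed by `Fin p`, so `φ k` is the coefficient `φ_{k+1}`. -/

/-- All roots of `z^p - ∑_{i=1}^p φ_i z^{p-i}` lie strictly inside the unit circle. -/
def stable (p : ℕ) : Set (Fin p → ℝ) :=
  {φ | ∀ z : ℂ, z ^ p - ∑ i : Fin p, (φ i : ℂ) * z ^ (p - ((i : ℕ) + 1)) = 0 → ‖z‖ < 1}

/-- The Fourier transform `∑_{k=0}^K a_k e^{-jkν}`. -/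
def fourierTaps {K : ℕ} (a : Fin (K + 1) → ℝ) (ν : ℝ) : ℂ :=
  ∑ k : Fin (K + 1), (a k : ℂ) * Complex.exp (-Complex.I * ((k : ℕ) : ℂ) * ν)

/-- The Fourier transform `Φ(ν) = ∑_{k=1}^p φ_k e^{-jkν}`. -/
def fourierAR {p : ℕ} (φ : Fin p → ℝ) (ν : ℝ) : ℂ :=
  ∑ k : Fin p, (φ k : ℂ) * Complex.exp (-Complex.I * (((k : ℕ) + 1 : ℕ) : ℂ) * ν)

/-- The innovation variance `η²`. -/
def innovVar {p : ℕ} (P : ℝ) (φ : Fin p → ℝ) : ℝ :=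
  P * (1 / (2 * Real.pi) * ∫ ν in (0 : ℝ)..2 * Real.pi, 1 / ‖1 - fourierAR φ ν‖ ^ 2)⁻¹

/-- The Yule–Walker equations `γ_m = ∑_{k=1}^p φ_k γ_{m-k} + η² δ_m` for `m ≥ 0`, with
`γ_{-m} = γ_m`. -/
def IsYuleWalker {p : ℕ} (P : ℝ) (φ : Fin p → ℝ) (γ : ℤ → ℝ) : Prop :=
  (∀ m : ℤ, γ (-m) = γ m) ∧
  ∀ m : ℤ, 0 ≤ m →
    γ m = ∑ k : Fin p, φ k * γ (m - ((k : ℤ) + 1)) + if m = 0 then innovVar P φ else 0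

/-- The solution `γ` of the Yule–Walker equations (existence and uniqueness for stable `φ` is part
of the theorem). -/
def autocov {p : ℕ} (P : ℝ) (φ : Fin p → ℝ) : ℤ → ℝ :=
  Classical.epsilon (IsYuleWalker P φ)

/-- The input spectrum. -/
def SX {p : ℕ} (P : ℝ) (φ : Fin p → ℝ) (ν : ℝ) : ℝ :=
  innovVar P φ / ‖1 - fourierAR φ ν‖ ^ 2

/-- The output spectrum. -/
def SY {K p : ℕ} (h : Fin (K + 1) → ℝ) (P σ : ℝ) (φ : Fin p → ℝ) (ν : ℝ) : ℝ :=
  ‖fourierTaps h ν‖ ^ 2 * SX P φ ν + σ ^ 2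

/-- The function `f_ω(ν)`. -/
def fOmega {K p : ℕ} (α : Fin (K + 1) → ℝ) (P : ℝ) (φ : Fin p → ℝ) (ω ν : ℝ) : ℝ :=
  ω / 2 * ‖fourierTaps α ν‖ ^ 2
    + 1 / (2 * innovVar P φ) * (1 + ‖fourierAR φ ν‖ ^ 2 - 2 * (fourierAR φ ν).re)

/-- The coefficient of `-ω`:
`∑_{l,i} α_l h_i γ_{l-i} - (½‖α‖² γ_0 + ∑_{l=1}^K ∑_{k=0}^{K-l} α_k α_{k+l} γ_l)`. -/
def corrTerm {K p : ℕ} (h α : Fin (K + 1) → ℝ) (P : ℝ) (φ : Fin p → ℝ) : ℝ :=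
  ∑ l : Fin (K + 1), ∑ i : Fin (K + 1), α l * h i * autocov P φ ((l : ℤ) - (i : ℤ))
    - (1 / 2 * (∑ l : Fin (K + 1), α l ^ 2) * autocov P φ 0
      + ∑ l ∈ Finset.Icc 1 K, ∑ k ∈ Finset.range (K - l + 1),
          zeroExt α (k : ℤ) * zeroExt α ((k : ℤ) + (l : ℤ)) * autocov P φ (l : ℤ))

/-- The function of `ω` minimised in the rate expression. -/
def objective {K p : ℕ} (h α : Fin (K + 1) → ℝ) (P σ : ℝ) (φ : Fin p → ℝ) (ω : ℝ) : ℝ :=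
  -(1 / (4 * Real.pi)) * (∫ ν in (0 : ℝ)..2 * Real.pi, Real.log (fOmega α P φ ω ν))
    + ω ^ 2 / (8 * Real.pi) * (∫ ν in (0 : ℝ)..2 * Real.pi,
        SY h P σ φ ν * ‖fourierTaps α ν‖ ^ 2 / fOmega α P φ ω ν)
    - ω * corrTerm h α P φ

/-- The rate `Ī₁(α, φ)`. The minimum over the open half-line `ω > 0` is an infimum: when the rate
is zero it is approached only as `ω → 0`. -/
def rate {K p : ℕ} (h α : Fin (K + 1) → ℝ) (P σ : ℝ) (φ : Fin p → ℝ) : ℝ :=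
  1 / 2 * Real.log (2 * innovVar P φ) - sInf (objective h α P σ φ '' Ioi 0)

/-! ### The autoregressive random codebook -/

/-- `X_t = ∑_{i=1}^p φ_i X_{t-i} + η z_t` for `t ≥ 0`, started from `X_t = 0` for `t < 0`. -/
def arSeq {p : ℕ} (φ : Fin p → ℝ) (η : ℝ) (z : ℕ → ℝ) (t : ℕ) : ℝ :=
  ∑ i : Fin p, (if (i : ℕ) + 1 ≤ t then φ i * arSeq φ η z (t - ((i : ℕ) + 1)) else 0) + η * z t
termination_by t
decreasing_by omega

/-- The codeword of length `n` driven by the innovations `z`. -/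
def arWord {p n : ℕ} (P : ℝ) (φ : Fin p → ℝ) (z : Fin n → ℝ) : Fin n → ℝ :=
  fun t => arSeq φ (Real.sqrt (innovVar P φ)) (fun s => zeroExt z (s : ℤ)) t

/-- Ensemble average of the error probability when `M = ⌈e^{nR}⌉` codewords are drawn
independently from the autoregressive Gaussian ensemble. -/
def avgErrorProb {K p : ℕ} (h α : Fin (K + 1) → ℝ) (P σ : ℝ) (φ : Fin p → ℝ) (R : ℝ)
    (n : ℕ) : ℝ≥0∞ :=
  ∫⁻ z : Fin ⌈Real.exp (n * R)⌉₊ → Fin n → ℝ,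
    errorProb h α σ (fun i => arWord P φ (z i)) ∂(Measure.pi fun _ => noise n 1)

end ISI

end

set_option linter.unusedSectionVars false

noncomputable section

namespace ISI

open Matrix
open scoped Matrix.Norms.L2Operator ComplexConjugate ComplexOrder

/-! A codeword is a linear image of Gaussian innovations `z`. The filtered codeword is therefore `B
z` and the channel output is `y = C z + σ w`, with `B = filtMat α P φ n` and `C = filtMat h P φ n`.
The metric decreases in `|y - B z'|²`, so given `(z, w)` an independent competitor `z'` does at
least as well as the true word with probability `q = P(|y - B z'|² ≤ T)`, where `T = |y - B z|²`.
Competitors are conditionally independent, hence the ensemble error is the mean of `1 - (1 - q)^(M -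
1)` (`avgErrorProb_eq`), and the threshold is the exponential decay rate of `q` at typical `(z, w)`.

The Laplace transform of the distance is an explicit Gaussian integral (`lintegral_tilt`), and
Chernoff's bound reads `q ≤ exp(ωT/2 - ½ log det(1 + ω Bᵀ B) - (ω/2) yᵀ(1 + ω B Bᵀ)⁻¹ y)`. The
quadratic forms concentrate around their traces by Chebyshev's inequality. Normalised traces and
log-determinants converge to averages of symbols, in the manner of Szegő, because the matrices
differ from circulants by a squared Hilbert–Schmidt error `o(n)` (`HasSymbol`,
`HasSymbol.log_det_tendsto`). Stability of `φ` enters here as a bound, uniform in `n`, on the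
inverse whitening filter. The resulting exponent is `rateFn β κ σ ω` (`pairErr_upper`).

For the converse, the law of the competitor is tilted as in Cramér's theorem. Under the tilted law
the distance concentrates at `n * slopeFn β κ σ ω`. If this is below the typical value `n * trueDist
β κ σ` of `T`, then `q` is at least the Chernoff value up to a loss with exponent `ω/2 * (trueDist -
slopeFn)` (`pairErr_lower`). Since `½ (slopeFn - trueDist)` is a supergradient of the concave
function `rateFn`, a choice of `ω` near the optimum makes this loss arbitrarily small
(`exists_tilt`). Such an `ω` exists unless `α = 0`, a case where every pair of codewords ties.

The two bounds meet at the stated rate because `objective` equals `½ log(2η²) - rateFn`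
(`objective_eq`). This uses that the Yule–Walker solution consists of the Fourier coefficients of
`SX` and that `log |1 - Φ|²` averages to zero. Finally, an ensemble of slightly smaller power `Q <
P` contains, by Markov's inequality, a code that satisfies the power constraint and has small error
(`exists_code`), and continuity in `Q` recovers the rate at `P`. -/

/-! ### Averages over a period and Riemann sums -/

/-- The average `(2π)⁻¹ ∫₀^{2π} f`. -/
def avg {E : Type*} [NormedAddCommGroup E] [NormedSpace ℝ E] (f : ℝ → E) : E :=
  (1 / (2 * Real.pi)) • ∫ ν in (0 : ℝ)..2 * Real.pi, f ν

/-- The `j`-th node of the uniform partition of `[0, 2π]` into `n` parts. -/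
def node (n : ℕ) (j : ℕ) : ℝ := 2 * Real.pi * j / n

theorem node_mem {n j : ℕ} (hj : j ≤ n) : node n j ∈ Icc (0 : ℝ) (2 * Real.pi) := by
  unfold node
  refine ⟨by positivity, ?_⟩
  have hj' : (j : ℝ) ≤ n := by exact_mod_cast hj
  exact div_le_of_le_mul₀ (by positivity) (by positivity) (by gcongr)

theorem riemann_sum_tendsto {E : Type*} [NormedAddCommGroup E] [NormedSpace ℝ E] [CompleteSpace E]
    {s : ℝ → E} (hs : Continuous s) :
    Tendsto (fun n : ℕ => (1 / (n : ℝ)) • ∑ j : Fin n, s (node n j)) atTop (𝓝 (avg s)) := by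
  rw [Metric.tendsto_atTop]
  intro ε hε
  have huc := isCompact_Icc.uniformContinuousOn_of_continuous (s := Icc (0 : ℝ) (2 * Real.pi))
    hs.continuousOn
  rw [Metric.uniformContinuousOn_iff] at huc
  obtain ⟨δ, hδ, hd⟩ := huc (ε / 2) (by positivity)
  obtain ⟨N, hN⟩ := exists_nat_gt (2 * Real.pi / δ)
  refine ⟨N + 1, fun n hn => ?_⟩
  have hn0 : (0 : ℝ) < n := by exact_mod_cast (by omega : 0 < n)
  have hstep : 2 * Real.pi / n < δ := by
    rw [div_lt_iff₀ hδ] at hN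
    rw [div_lt_iff₀ hn0]
    have : (N : ℝ) ≤ n := by exact_mod_cast (by omega : N ≤ n)
    nlinarith
  have hnode : ∀ k : ℕ, node n (k + 1) - node n k = 2 * Real.pi / n := by
    intro k; unfold node; push_cast; field_simp; ring
  have hsum : ∑ k ∈ Finset.range n, ∫ ν in node n k..node n (k + 1), s ν
      = ∫ ν in (0 : ℝ)..2 * Real.pi, s ν := by
    rw [intervalIntegral.sum_integral_adjacent_intervals
      (fun k _ => hs.intervalIntegrable _ _)]
    congr 1 <;> simp [node, hn0.ne']
  have hterm : ∀ k ∈ Finset.range n,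
      ‖(2 * Real.pi / n) • s (node n k) - ∫ ν in node n k..node n (k + 1), s ν‖
        ≤ ε / 2 * (2 * Real.pi / n) := by
    intro k hk
    have hk' : k < n := Finset.mem_range.1 hk
    have hle : node n k ≤ node n (k + 1) := by
      have := hnode k
      have h2 : 0 < 2 * Real.pi / n := by positivity
      linarith
    have : (2 * Real.pi / n) • s (node n k)
        = ∫ ν in node n k..node n (k + 1), s (node n k) := by
      rw [intervalIntegral.integral_const, hnode]
    rw [this, ← intervalIntegral.integral_sub (by simp) (hs.intervalIntegrable _ _)]
    refine (intervalIntegral.norm_integral_le_of_norm_le_const (C := ε / 2) ?_).trans ?_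
    · intro x hx
      rw [uIoc_of_le hle] at hx
      have hm1 := node_mem hk'.le
      have hm2 := node_mem (n := n) (j := k + 1) hk'
      rw [← dist_eq_norm]
      refine (hd _ hm1 _ ⟨hm1.1.trans hx.1.le, hx.2.trans hm2.2⟩ ?_).le
      have := hnode k
      rw [dist_comm, Real.dist_eq, abs_of_nonneg (by linarith [hx.1])]
      linarith [hx.2]
    · rw [hnode, abs_of_nonneg (by positivity)]
  have key : (1 / (n : ℝ)) • ∑ j : Fin n, s (node n j) - avg s
      = (1 / (2 * Real.pi)) • ∑ k ∈ Finset.range n,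
        ((2 * Real.pi / n) • s (node n k) - ∫ ν in node n k..node n (k + 1), s ν) := by
    rw [Finset.sum_sub_distrib, hsum, ← Finset.smul_sum, smul_sub, smul_smul, avg,
      Fin.sum_univ_eq_sum_range (fun k => s (node n k))]
    congr 2
    field_simp
  rw [dist_eq_norm, key, norm_smul]
  have hb := (norm_sum_le_of_le _ hterm)
  rw [Finset.sum_const, Finset.card_range, nsmul_eq_mul] at hb
  calc _ ≤ ‖1 / (2 * Real.pi)‖ * (n * (ε / 2 * (2 * Real.pi / n))) := by gcongr
    _ = ε / 2 := by
      rw [Real.norm_of_nonneg (by positivity)]; field_simp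
    _ < ε := by linarith

/-! ### The Hilbert–Schmidt sum of squares -/

/-- The sum of the squared absolute values of the entries. -/
def hs {m n : Type*} [Fintype m] [Fintype n] {𝕜 : Type*} [RCLike 𝕜] (M : Matrix m n 𝕜) : ℝ :=
  ∑ i, ∑ j, ‖M i j‖ ^ 2

section hs
variable {m n l : Type*} [Fintype m] [Fintype n] [Fintype l] {𝕜 : Type*} [RCLike 𝕜]

theorem hs_nonneg (M : Matrix m n 𝕜) : 0 ≤ hs M := by unfold hs; positivity

theorem hs_add_le (M N : Matrix m n 𝕜) : hs (M + N) ≤ 2 * hs M + 2 * hs N := by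
  unfold hs
  simp only [Finset.mul_sum, ← Finset.sum_add_distrib]
  gcongr with i _ j _
  have := norm_add_le (M i j) (N i j)
  have h0 := norm_nonneg (M i j + N i j)
  rw [Matrix.add_apply]
  nlinarith [sq_nonneg (‖M i j‖ - ‖N i j‖)]

theorem hs_smul (c : 𝕜) (M : Matrix m n 𝕜) : hs (c • M) = ‖c‖ ^ 2 * hs M := by
  unfold hs
  simp only [Finset.mul_sum, Matrix.smul_apply, norm_smul, mul_pow]

theorem hs_conjTranspose (M : Matrix m n 𝕜) : hs Mᴴ = hs M := by
  unfold hs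
  rw [Finset.sum_comm]
  simp [Matrix.conjTranspose_apply]

variable [DecidableEq m] [DecidableEq n] [DecidableEq l]

theorem sum_norm_sq_mulVec_le (M : Matrix m n 𝕜) (v : n → 𝕜) :
    ∑ i, ‖(M *ᵥ v) i‖ ^ 2 ≤ ‖M‖ ^ 2 * ∑ j, ‖v j‖ ^ 2 := by
  have h := Matrix.l2_opNorm_mulVec M (WithLp.toLp 2 v)
  have h2 := pow_le_pow_left₀ (norm_nonneg _) h 2
  rw [mul_pow, EuclideanSpace.norm_sq_eq, EuclideanSpace.norm_sq_eq] at h2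
  simpa using h2

/-- Apply the operator norm bound to each column of `N`. -/
theorem hs_mul_le (M : Matrix m n 𝕜) (N : Matrix n l 𝕜) : hs (M * N) ≤ ‖M‖ ^ 2 * hs N := by
  unfold hs
  rw [Finset.sum_comm, Finset.sum_comm (f := fun i j => ‖N i j‖ ^ 2), Finset.mul_sum]
  refine Finset.sum_le_sum fun j _ => ?_
  exact sum_norm_sq_mulVec_le M (fun i => N i j)

theorem hs_mul_le' (M : Matrix m n 𝕜) (N : Matrix n l 𝕜) : hs (M * N) ≤ ‖N‖ ^ 2 * hs M := by
  rw [← hs_conjTranspose, Matrix.conjTranspose_mul, ← hs_conjTranspose M,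
    ← Matrix.l2_opNorm_conjTranspose N]
  exact hs_mul_le _ _

theorem hs_one : hs (1 : Matrix n n 𝕜) = Fintype.card n := by
  unfold hs
  simp [Matrix.one_apply, apply_ite norm]

theorem hs_le_opNorm (M : Matrix n n 𝕜) : hs M ≤ ‖M‖ ^ 2 * Fintype.card n := by
  simpa [hs_one] using hs_mul_le M (1 : Matrix n n 𝕜)

/-- Cauchy–Schwarz on the diagonal. This is why a squared Hilbert–Schmidt error `o(n)` is invisible
in traces divided by `n`. -/
theorem norm_trace_sq_le (M : Matrix n n 𝕜) : ‖M.trace‖ ^ 2 ≤ Fintype.card n * hs M := by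
  have h1 : ‖M.trace‖ ≤ ∑ i, ‖M i i‖ := norm_sum_le _ _
  have h2 := sq_sum_le_card_mul_sum_sq (s := Finset.univ) (f := fun i => ‖M i i‖)
  calc ‖M.trace‖ ^ 2 ≤ (∑ i, ‖M i i‖) ^ 2 := by gcongr
    _ ≤ _ := h2
    _ ≤ _ := by
      rw [Finset.card_univ]
      unfold hs
      gcongr with i _
      exact Finset.single_le_sum (f := fun j => ‖M i j‖ ^ 2) (fun _ _ => by positivity)
        (Finset.mem_univ i)

end hs

/-! ### Circulant matrices -/

/-- The unitary discrete Fourier matrix. -/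
def dftMat (n : ℕ) : Matrix (Fin n) (Fin n) ℂ :=
  Matrix.of fun j k => Complex.exp (2 * Real.pi * Complex.I / n) ^ ((j : ℕ) * (k : ℕ)) / √(n : ℝ)

/-- The circulant matrix with eigenvalues `s (2πj/n)`. -/
def circ (n : ℕ) (s : ℝ → ℂ) : Matrix (Fin n) (Fin n) ℂ :=
  dftMat n * Matrix.diagonal (fun j : Fin n => s (node n j)) * (dftMat n)ᴴ

theorem sum_root_zpow {n : ℕ} (hn : n ≠ 0) (m : ℤ) :
    ∑ k : Fin n, Complex.exp (2 * Real.pi * Complex.I / n) ^ ((k : ℤ) * m)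
      = if (n : ℤ) ∣ m then (n : ℂ) else 0 := by
  have hζ := Complex.isPrimitiveRoot_exp n hn
  set ζ := Complex.exp (2 * Real.pi * Complex.I / n)
  have h1 : ∑ k : Fin n, ζ ^ ((k : ℤ) * m) = ∑ k ∈ Finset.range n, (ζ ^ m) ^ k := by
    rw [← Fin.sum_univ_eq_sum_range]
    refine Finset.sum_congr rfl fun k _ => ?_
    rw [mul_comm, _root_.zpow_mul, zpow_natCast]
  rw [h1]
  split_ifs with h
  · rw [(hζ.zpow_eq_one_iff_dvd m).2 h]; simp
  · have hne : ζ ^ m ≠ 1 := fun h' => h ((hζ.zpow_eq_one_iff_dvd m).1 h')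
    have := geom_sum_eq hne n
    rw [this, ← zpow_natCast, ← _root_.zpow_mul, mul_comm, _root_.zpow_mul, zpow_natCast, hζ.pow_eq_one]
    simp

/-- Orthogonality of roots of unity. The case `m = 0` is unitarity of the Fourier matrix; the case
`m = 1` is the cyclic shift, to which the nilpotent shift is compared. -/
theorem circ_exp_apply {n : ℕ} (m : ℕ) (i j : Fin n) :
    circ n (fun ν => Complex.exp (-Complex.I * ν) ^ m) i j
      = if (n : ℤ) ∣ (i : ℤ) - j - m then 1 else 0 := by
  have hn : n ≠ 0 := by rintro rfl; exact i.elim0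
  have hsq : ((√(n : ℝ) : ℝ) : ℂ) * ((√(n : ℝ) : ℝ) : ℂ) = n := by
    rw [← Complex.ofReal_mul, Real.mul_self_sqrt (by positivity)]; simp
  have hn' : (n : ℂ) ≠ 0 := by exact_mod_cast hn
  have hterm : ∀ k : Fin n, dftMat n i k * Complex.exp (-Complex.I * (node n k : ℝ)) ^ m
      * (starRingEnd ℂ) (dftMat n j k)
      = Complex.exp (2 * Real.pi * Complex.I / n) ^ ((k : ℤ) * ((i : ℤ) - j - m)) / n := by
    intro k
    simp only [dftMat, Matrix.of_apply, map_div₀, map_pow, Complex.conj_ofReal]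
    rw [← Complex.exp_conj]
    have e1 : (starRingEnd ℂ) (2 * (Real.pi : ℂ) * Complex.I / n)
        = -(2 * Real.pi * Complex.I / n) := by
      simp only [map_div₀, map_mul, Complex.conj_ofReal, Complex.conj_I, map_natCast, map_ofNat]
      ring
    have e2 : -Complex.I * ((node n k : ℝ) : ℂ) = (k : ℤ) * -(2 * Real.pi * Complex.I / n) := by
      unfold node; push_cast; field_simp
    rw [e1, e2, Complex.exp_int_mul, Complex.exp_neg]
    set ζ := Complex.exp (2 * Real.pi * Complex.I / n)
    have hζ0 : ζ ≠ 0 := Complex.exp_ne_zero _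
    have : ζ ^ ((k : ℤ) * ((i : ℤ) - j - m))
        = ζ ^ ((i : ℕ) * (k : ℕ)) * (ζ⁻¹ ^ (k : ℤ)) ^ m * ζ⁻¹ ^ ((j : ℕ) * (k : ℕ)) := by
      rw [inv_pow, _root_.inv_zpow, inv_pow, ← zpow_natCast, ← zpow_natCast, ← zpow_natCast,
        ← _root_.zpow_mul, ← _root_.zpow_neg, ← _root_.zpow_neg, ← zpow_add₀ hζ0, ← zpow_add₀ hζ0]
      congr 1
      push_cast; ring
    rw [this, ← hsq]
    ring
  unfold circ
  rw [Matrix.mul_apply]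
  simp only [Matrix.mul_diagonal, Matrix.conjTranspose_apply, RCLike.star_def]
  rw [Finset.sum_congr rfl (fun k _ => hterm k), ← Finset.sum_div, sum_root_zpow hn]
  split_ifs <;> simp [hn']

theorem dftMat_mul_conjTranspose (n : ℕ) : dftMat n * (dftMat n)ᴴ = 1 := by
  have h : dftMat n * (dftMat n)ᴴ = circ n (fun ν => Complex.exp (-Complex.I * ν) ^ 0) := by
    simp [circ]
  rw [h]
  ext i j
  rw [circ_exp_apply, Matrix.one_apply]
  have : (n : ℤ) ∣ (i : ℤ) - j - (0 : ℕ) ↔ i = j := by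
    constructor
    · intro h
      have hi := i.2
      have hj := j.2
      have := Int.eq_zero_of_abs_lt_dvd h (by rw [abs_lt]; constructor <;> push_cast <;> omega)
      exact Fin.ext (by push_cast at this; omega)
    · rintro rfl; simp
  simp only [this]

theorem conjTranspose_mul_dftMat (n : ℕ) : (dftMat n)ᴴ * dftMat n = 1 :=
  mul_eq_one_comm.1 (dftMat_mul_conjTranspose n)

theorem dftMat_mem_unitary (n : ℕ) : dftMat n ∈ unitary (Matrix (Fin n) (Fin n) ℂ) :=
  ⟨conjTranspose_mul_dftMat n, dftMat_mul_conjTranspose n⟩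

theorem circ_mul (n : ℕ) (s t : ℝ → ℂ) : circ n s * circ n t = circ n (fun ν => s ν * t ν) := by
  unfold circ
  calc _ = dftMat n * Matrix.diagonal (fun j : Fin n => s (node n j)) * ((dftMat n)ᴴ * dftMat n)
        * Matrix.diagonal (fun j : Fin n => t (node n j)) * (dftMat n)ᴴ := by
        simp only [Matrix.mul_assoc]
    _ = _ := by
      rw [conjTranspose_mul_dftMat, Matrix.mul_one, Matrix.mul_assoc (dftMat n),
        Matrix.diagonal_mul_diagonal]

theorem circ_add (n : ℕ) (s t : ℝ → ℂ) : circ n (fun ν => s ν + t ν) = circ n s + circ n t := by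
  unfold circ
  rw [← Matrix.add_mul, ← Matrix.mul_add, Matrix.diagonal_add]

theorem circ_const_mul (n : ℕ) (c : ℂ) (s : ℝ → ℂ) :
    circ n (fun ν => c * s ν) = c • circ n s := by
  unfold circ
  rw [← Matrix.smul_mul, ← Matrix.mul_smul, ← Matrix.diagonal_smul]
  rfl

theorem circ_one (n : ℕ) : circ n (fun _ => 1) = 1 := by
  simp [circ, dftMat_mul_conjTranspose]

theorem circ_conj (n : ℕ) (s : ℝ → ℂ) : (circ n s)ᴴ = circ n (fun ν => conj (s ν)) := by
  unfold circ
  simp only [Matrix.conjTranspose_mul, Matrix.conjTranspose_conjTranspose,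
    Matrix.diagonal_conjTranspose, Matrix.mul_assoc]
  rfl

theorem trace_circ (n : ℕ) (s : ℝ → ℂ) : (circ n s).trace = ∑ j : Fin n, s (node n j) := by
  unfold circ
  rw [Matrix.trace_mul_comm, ← Matrix.mul_assoc, conjTranspose_mul_dftMat, Matrix.one_mul,
    Matrix.trace_diagonal]

/-- Unitary conjugation reduces the norm to that of the diagonal of values of `s` at the nodes, all
of which lie in one compact period. -/
theorem norm_circ_le {s : ℝ → ℂ} (hs : Continuous s) : ∃ C, ∀ n, ‖circ n s‖ ≤ C := by
  obtain ⟨C, hC⟩ := isCompact_Icc.exists_bound_of_continuousOn (s := Icc (0 : ℝ) (2 * Real.pi))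
    hs.continuousOn
  refine ⟨max C 0, fun n => ?_⟩
  have h1 := CStarRing.norm_coe_unitary_mul ⟨dftMat n, dftMat_mem_unitary n⟩
    (Matrix.diagonal (fun j : Fin n => s (node n j)) * (dftMat n)ᴴ)
  have h2 := CStarRing.norm_mul_coe_unitary (Matrix.diagonal (fun j : Fin n => s (node n j)))
    (star ⟨dftMat n, dftMat_mem_unitary n⟩ : unitary (Matrix (Fin n) (Fin n) ℂ))
  have h3 : ‖circ n s‖ = ‖(Matrix.diagonal (fun j : Fin n => s (node n j)))‖ := by
    rw [← h2, circ, Matrix.mul_assoc]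
    exact h1
  rw [h3, Matrix.l2_opNorm_diagonal, pi_norm_le_iff_of_nonneg (le_max_right _ _)]
  exact fun j => (hC _ (node_mem j.2.le)).trans (le_max_left _ _)

/-! ### Matrix sequences with a symbol -/

/-- The bounded matrix sequence `M` is asymptotically circulant with symbol `s`: the normalised
Hilbert–Schmidt distance to the circulant matrices with symbol `s` tends to zero. -/
structure HasSymbol (M : ∀ n, Matrix (Fin n) (Fin n) ℂ) (s : ℝ → ℂ) : Prop where
  bdd : ∃ C, ∀ n, ‖M n‖ ≤ C
  cont : Continuous s
  lim : Tendsto (fun n : ℕ => hs (M n - circ n s) / n) atTop (𝓝 0)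

namespace HasSymbol
variable {M N : ∀ n, Matrix (Fin n) (Fin n) ℂ} {s t : ℝ → ℂ}

theorem of_hs_le {f : ℕ → ℝ} (hb : ∃ C, ∀ n, ‖M n‖ ≤ C) (hc : Continuous s)
    (hf : Tendsto f atTop (𝓝 0)) (h : ∀ n, hs (M n - circ n s) / n ≤ f n) : HasSymbol M s :=
  ⟨hb, hc, squeeze_zero (fun _ => div_nonneg (hs_nonneg _) (Nat.cast_nonneg _)) h hf⟩

theorem circ (hc : Continuous s) : HasSymbol (fun n => ISI.circ n s) s :=
  of_hs_le (norm_circ_le hc) hc tendsto_const_nhds fun n => by simp [hs]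

theorem one : HasSymbol (fun _ => 1) (fun _ => 1) := by
  simpa only [circ_one] using HasSymbol.circ (s := fun _ => 1) continuous_const

theorem congr_symbol (hM : HasSymbol M s) (h : ∀ ν, s ν = t ν) : HasSymbol M t :=
  (funext h : s = t) ▸ hM

theorem add (hM : HasSymbol M s) (hN : HasSymbol N t) :
    HasSymbol (fun n => M n + N n) (fun ν => s ν + t ν) := by
  obtain ⟨C, hC⟩ := hM.bdd
  obtain ⟨D, hD⟩ := hN.bdd
  refine of_hs_le (f := fun n : ℕ => 2 * (hs (M n - ISI.circ n s) / n)
      + 2 * (hs (N n - ISI.circ n t) / n))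
    ⟨C + D, fun n => norm_add_le_of_le (hC n) (hD n)⟩ (hM.cont.add hN.cont) ?_ fun n => ?_
  · simpa using (hM.lim.const_mul 2).add (hN.lim.const_mul 2)
  · rw [circ_add, add_sub_add_comm]
    calc _ ≤ (2 * hs (M n - ISI.circ n s) + 2 * hs (N n - ISI.circ n t)) / n := by
          gcongr; exact hs_add_le _ _
      _ = _ := by ring

theorem const_smul (c : ℂ) (hM : HasSymbol M s) :
    HasSymbol (fun n => c • M n) (fun ν => c * s ν) := by
  obtain ⟨C, hC⟩ := hM.bdd
  refine of_hs_le (f := fun n : ℕ => ‖c‖ ^ 2 * (hs (M n - ISI.circ n s) / n))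
    ⟨‖c‖ * C, fun n => by rw [norm_smul]; gcongr; exact hC n⟩ (hM.cont.const_mul c) ?_
    fun n => ?_
  · simpa using hM.lim.const_mul (‖c‖ ^ 2)
  · rw [circ_const_mul, ← smul_sub, hs_smul, mul_div_assoc]

/-- Split the difference of products as `(M - circ s) N + circ s (N - circ t)`: each summand is one
small Hilbert–Schmidt factor times one factor bounded in operator norm. -/
theorem mul (hM : HasSymbol M s) (hN : HasSymbol N t) :
    HasSymbol (fun n => M n * N n) (fun ν => s ν * t ν) := by
  obtain ⟨C, hC⟩ := hM.bdd
  obtain ⟨D, hD⟩ := hN.bdd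
  obtain ⟨S, hS⟩ := norm_circ_le hM.cont
  refine of_hs_le (f := fun n : ℕ => 2 * D ^ 2 * (hs (M n - ISI.circ n s) / n)
      + 2 * S ^ 2 * (hs (N n - ISI.circ n t) / n))
    ⟨C * D, fun n => (norm_mul_le _ _).trans ?_⟩ (hM.cont.mul hN.cont) ?_ fun n => ?_
  · exact mul_le_mul (hC n) (hD n) (norm_nonneg _) ((norm_nonneg _).trans (hC n))
  · simpa using (hM.lim.const_mul (2 * D ^ 2)).add (hN.lim.const_mul (2 * S ^ 2))
  · have e : M n * N n - ISI.circ n (fun ν => s ν * t ν)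
        = (M n - ISI.circ n s) * N n + ISI.circ n s * (N n - ISI.circ n t) := by
      rw [← circ_mul]; noncomm_ring
    rw [e]
    calc _ ≤ (2 * (D ^ 2 * hs (M n - ISI.circ n s)) + 2 * (S ^ 2 * hs (N n - ISI.circ n t))) / n := by
          gcongr
          refine (hs_add_le _ _).trans ?_
          gcongr
          · refine (hs_mul_le' _ _).trans ?_
            gcongr
            · exact hs_nonneg _
            · exact hD n
          · refine (hs_mul_le _ _).trans ?_
            gcongr
            · exact hs_nonneg _
            · exact hS n
      _ = _ := by ring

theorem conjTranspose (hM : HasSymbol M s) :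
    HasSymbol (fun n => (M n)ᴴ) (fun ν => conj (s ν)) := by
  obtain ⟨C, hC⟩ := hM.bdd
  refine of_hs_le ⟨C, fun n => by rw [Matrix.l2_opNorm_conjTranspose]; exact hC n⟩
    (Complex.continuous_conj.comp hM.cont) hM.lim fun n => ?_
  rw [← circ_conj, ← Matrix.conjTranspose_sub, hs_conjTranspose]

theorem pow (hM : HasSymbol M s) (k : ℕ) : HasSymbol (fun n => M n ^ k) (fun ν => s ν ^ k) := by
  induction k with
  | zero => simpa using one
  | succ k ih => simpa only [pow_succ] using ih.mul hM

theorem sum {ι : Type*} (T : Finset ι) {M : ι → ∀ n, Matrix (Fin n) (Fin n) ℂ} {s : ι → ℝ → ℂ}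
    (h : ∀ i ∈ T, HasSymbol (M i) (s i)) :
    HasSymbol (fun n => ∑ i ∈ T, M i n) (fun ν => ∑ i ∈ T, s i ν) := by
  classical
  induction T using Finset.induction_on with
  | empty => simpa using (one.const_smul 0)
  | insert a T ha ih =>
    simp only [Finset.sum_insert ha]
    exact (h a (by simp)).add (ih fun i hi => h i (by simp [hi]))

/-- The resolvent identity `N - circ s⁻¹ = -N (M - circ s) circ s⁻¹` transfers smallness. A bound on
the inverses uniform in `n` must be supplied separately. -/
theorem inv (hM : HasSymbol M s) (h0 : ∀ ν, s ν ≠ 0) (hb : ∃ C, ∀ n, ‖N n‖ ≤ C)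
    (h : ∀ n, N n * M n = 1) : HasSymbol N (fun ν => (s ν)⁻¹) := by
  obtain ⟨C, hC⟩ := hb
  have hci : Continuous fun ν => (s ν)⁻¹ := hM.cont.inv₀ h0
  obtain ⟨S, hS⟩ := norm_circ_le hci
  refine of_hs_le (f := fun n : ℕ => C ^ 2 * S ^ 2 * (hs (M n - ISI.circ n s) / n)) ⟨C, hC⟩ hci
    ?_ fun n => ?_
  · simpa using hM.lim.const_mul (C ^ 2 * S ^ 2)
  · have hi : ISI.circ n s * ISI.circ n (fun ν => (s ν)⁻¹) = 1 := by
      rw [circ_mul]; simp only [mul_inv_cancel₀ (h0 _)]; exact circ_one n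
    have e : N n - ISI.circ n (fun ν => (s ν)⁻¹)
        = (-1 : ℂ) • (N n * ((M n - ISI.circ n s) * ISI.circ n (fun ν => (s ν)⁻¹))) := by
      rw [Matrix.sub_mul, hi, Matrix.mul_sub, ← Matrix.mul_assoc, h]; simp
    rw [e, hs_smul]
    calc _ ≤ (1 * (C ^ 2 * (S ^ 2 * hs (M n - ISI.circ n s)))) / n := by
          rw [norm_neg, norm_one, one_pow]
          gcongr
          · refine (hs_mul_le _ _).trans ?_
            have h1 := hs_nonneg ((M n - ISI.circ n s) * ISI.circ n (fun ν => (s ν)⁻¹))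
            gcongr
            · exact hC n
            · refine (hs_mul_le' _ _).trans ?_
              gcongr
              · exact hs_nonneg _
              · exact hS n
      _ = _ := by ring

theorem trace_tendsto (hM : HasSymbol M s) :
    Tendsto (fun n : ℕ => (1 / (n : ℝ)) • (M n).trace) atTop (𝓝 (avg s)) := by
  have h1 := riemann_sum_tendsto hM.cont
  have h2 : Tendsto (fun n : ℕ => (1 / (n : ℝ)) • (M n - ISI.circ n s).trace) atTop (𝓝 0) := by
    rw [tendsto_zero_iff_norm_tendsto_zero]
    have h3 : Tendsto (fun n : ℕ => √(hs (M n - ISI.circ n s) / n)) atTop (𝓝 0) := by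
      have := (Real.continuous_sqrt.tendsto 0).comp hM.lim
      rwa [Real.sqrt_zero] at this
    refine squeeze_zero (fun _ => norm_nonneg _) (fun n => ?_) h3
    refine Real.le_sqrt_of_sq_le ?_
    rw [norm_smul, mul_pow]
    rcases Nat.eq_zero_or_pos n with rfl | hn
    · simp
    have hn' : (0 : ℝ) < n := by exact_mod_cast hn
    have := norm_trace_sq_le (M n - ISI.circ n s)
    rw [Fintype.card_fin] at this
    rw [Real.norm_of_nonneg (by positivity)]
    calc _ ≤ (1 / (n : ℝ)) ^ 2 * (n * hs (M n - ISI.circ n s)) := by gcongr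
      _ = _ := by field_simp
  have h4 := h1.add h2
  rw [add_zero] at h4
  refine h4.congr fun n => ?_
  rw [Matrix.trace_sub, trace_circ, smul_sub]
  abel

end HasSymbol

/-! ### Asymptotics of determinants -/

/-- Sum `log x ≤ x - 1` over the eigenvalues. This single inequality, applied to a matrix and to its
inverse, yields both halves of the determinant asymptotics. -/
theorem log_det_le_trace {ι : Type*} [Fintype ι] [DecidableEq ι] {A : Matrix ι ι ℂ}
    (hA : A.PosDef) : Real.log A.det.re ≤ A.trace.re - Fintype.card ι := by
  have h1 : A.det.re = ∏ i, hA.1.eigenvalues i := by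
    rw [hA.1.det_eq_prod_eigenvalues, ← RCLike.ofReal_prod]; exact Complex.ofReal_re _
  have h2 : A.trace.re = ∑ i, hA.1.eigenvalues i := by
    rw [hA.1.trace_eq_sum_eigenvalues, ← RCLike.ofReal_sum]; simp
  rw [h1, h2, Real.log_prod fun i _ => (hA.eigenvalues_pos i).ne']
  have : ∑ i, Real.log (hA.1.eigenvalues i) ≤ ∑ i, (hA.1.eigenvalues i - 1) :=
    Finset.sum_le_sum fun i _ => Real.log_le_sub_one_of_pos (hA.eigenvalues_pos i)
  simpa using this

theorem det_re_pos {ι : Type*} [Fintype ι] [DecidableEq ι] {A : Matrix ι ι ℂ}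
    (hA : A.PosDef) : 0 < A.det.re ∧ A.det.im = 0 := by
  have := hA.det_pos
  rw [Complex.lt_def] at this
  exact ⟨by simpa using this.1, by simpa using this.2.symm⟩

/-- Comparison of the determinant of a positive definite matrix with that of a circulant one. -/
theorem log_det_add_sum_log_le {n : ℕ} {A : Matrix (Fin n) (Fin n) ℂ} (hA : A.PosDef)
    {r : ℝ → ℝ} (hr : ∀ ν, 0 < r ν) :
    Real.log A.det.re + ∑ j : Fin n, Real.log (r (node n j))
      ≤ (A * circ n (fun ν => (r ν : ℂ))).trace.re - n := by
  -- A square root of the diagonal symbol gives `T` with `T Tᴴ = circ r`. The congruence `Tᴴ A T`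
  -- stays positive definite, its determinant is `det A` times the product of the `r`-values, and
  -- its trace is that of `A circ r`.
  set D : Matrix (Fin n) (Fin n) ℂ := Matrix.diagonal fun j => ((√(r (node n j)) : ℝ) : ℂ) with hD
  have hDH : Dᴴ = D := by
    rw [hD, Matrix.diagonal_conjTranspose]
    congr 1
    ext j
    simp
  have hDD : D * D = Matrix.diagonal fun j : Fin n => ((r (node n j) : ℝ) : ℂ) := by
    rw [hD, Matrix.diagonal_mul_diagonal]
    congr 1
    ext j
    rw [← Complex.ofReal_mul, Real.mul_self_sqrt (hr _).le]
  set T := dftMat n * D with hT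
  have hTT : T * Tᴴ = circ n (fun ν => (r ν : ℂ)) := by
    rw [hT, Matrix.conjTranspose_mul, hDH, circ, ← hDD]
    simp only [Matrix.mul_assoc]
  have hdet : (T * Tᴴ).det = ((∏ j : Fin n, r (node n j) : ℝ) : ℂ) := by
    rw [hTT, circ, Matrix.det_mul, Matrix.det_mul, mul_right_comm, ← Matrix.det_mul,
      dftMat_mul_conjTranspose, Matrix.det_one, one_mul, Matrix.det_diagonal]
    push_cast; rfl
  have hprod : 0 < ∏ j : Fin n, r (node n j) := Finset.prod_pos fun j _ => hr _
  have hTdet : T.det ≠ 0 := by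
    intro h0
    rw [Matrix.det_mul, h0, zero_mul] at hdet
    exact hprod.ne (by exact_mod_cast hdet)
  have hP : (Tᴴ * A * T).PosDef := hA.conjTranspose_mul_mul_same
    (Matrix.mulVec_injective_iff_isUnit.2 ((Matrix.isUnit_iff_isUnit_det _).2 hTdet.isUnit))
  have h := log_det_le_trace hP
  have e1 : (Tᴴ * A * T).det = A.det * ((∏ j : Fin n, r (node n j) : ℝ) : ℂ) := by
    rw [← hdet, Matrix.det_mul (Tᴴ * A), Matrix.det_mul Tᴴ, Matrix.det_mul T Tᴴ]; ring
  have e2 : (Tᴴ * A * T).trace = (A * circ n (fun ν => (r ν : ℂ))).trace := by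
    rw [← hTT, Matrix.mul_assoc, Matrix.trace_mul_comm, Matrix.mul_assoc]
  rw [e1, e2, Complex.re_mul_ofReal, Fintype.card_fin,
    Real.log_mul (det_re_pos hA).1.ne' hprod.ne', Real.log_prod fun j _ => (hr _).ne'] at h
  exact h

/-- The normalised log-determinants of positive definite matrices converge to the average of the
logarithm of the symbol. -/
theorem HasSymbol.log_det_tendsto {M : ∀ n, Matrix (Fin n) (Fin n) ℂ} {r : ℝ → ℝ}
    (hM : HasSymbol M (fun ν => (r ν : ℂ))) (hr : ∀ ν, 0 < r ν) (hp : ∀ n, (M n).PosDef)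
    (hb : ∃ C, ∀ n, ‖(M n)⁻¹‖ ≤ C) :
    Tendsto (fun n : ℕ => (1 / (n : ℝ)) * Real.log (M n).det.re) atTop
      (𝓝 (avg fun ν => Real.log (r ν))) := by
  have hrc : Continuous r := by
    have := Complex.continuous_re.comp hM.cont
    simpa [Function.comp_def] using this
  have hr0 : ∀ ν, (r ν : ℂ) ≠ 0 := fun ν => by exact_mod_cast (hr ν).ne'
  have hu : ∀ n, IsUnit (M n).det := fun n => by
    rw [isUnit_iff_ne_zero]
    intro h
    have := (det_re_pos (hp n)).1
    simp [h] at this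
  have hinv : HasSymbol (fun n => (M n)⁻¹) (fun ν => (r ν : ℂ)⁻¹) :=
    hM.inv hr0 hb fun n => Matrix.nonsing_inv_mul _ (hu n)
  have havg1 : avg (fun _ : ℝ => (1 : ℂ)) = 1 := by
    unfold avg
    simp only [intervalIntegral.integral_const, sub_zero, smul_smul]
    rw [one_div, inv_mul_cancel₀ (by positivity), one_smul]
  have hri : Continuous fun ν => (r ν)⁻¹ := hrc.inv₀ fun ν => (hr ν).ne'
  -- Upper half: compare `M n` with the circulant of symbol `1 / r`. The product has symbol `1`, so
  -- its normalised trace minus `1` vanishes in the limit.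
  have up : Tendsto (fun n : ℕ => ((1 / (n : ℝ)) •
      (M n * ISI.circ n (fun ν => (((r ν)⁻¹ : ℝ) : ℂ))).trace).re - 1) atTop (𝓝 0) := by
    have h := (hM.mul (HasSymbol.circ (Complex.continuous_ofReal.comp hri))).trace_tendsto
    have e : (fun ν => (r ν : ℂ) * (Complex.ofReal ∘ fun ν => (r ν)⁻¹) ν) = fun _ => (1 : ℂ) := by
      ext ν; simp [hr0 ν]
    rw [e, havg1] at h
    have h2 := ((Complex.continuous_re.tendsto _).comp h).sub_const 1
    rw [Complex.one_re, sub_self] at h2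
    exact h2
  -- Lower half: the same comparison for the inverse of `M n` with the circulant of symbol `r`.
  have lo : Tendsto (fun n : ℕ => -(((1 / (n : ℝ)) •
      ((M n)⁻¹ * ISI.circ n (fun ν => (r ν : ℂ))).trace).re - 1)) atTop (𝓝 0) := by
    have h := (hinv.mul (HasSymbol.circ hM.cont)).trace_tendsto
    have e : (fun ν => (r ν : ℂ)⁻¹ * r ν) = fun _ => (1 : ℂ) := by
      ext ν; simp [hr0 ν]
    rw [e, havg1] at h
    have h2 := (((Complex.continuous_re.tendsto _).comp h).sub_const 1).neg
    rw [Complex.one_re, sub_self, neg_zero] at h2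
    exact h2
  have hlog : Tendsto (fun n : ℕ => (1 / (n : ℝ)) • ∑ j : Fin n, Real.log (r (node n j))) atTop
      (𝓝 (avg fun ν => Real.log (r ν))) :=
    riemann_sum_tendsto (hrc.log fun ν => (hr ν).ne')
  have hdiff : Tendsto (fun n : ℕ => (1 / (n : ℝ)) * Real.log (M n).det.re
      - (1 / (n : ℝ)) • ∑ j : Fin n, Real.log (r (node n j))) atTop (𝓝 0) := by
    refine tendsto_of_tendsto_of_tendsto_of_le_of_le' lo up ?_ ?_
    · filter_upwards [eventually_gt_atTop 0] with n hn
      have hn' : (0 : ℝ) < n := by exact_mod_cast hn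
      have h := log_det_add_sum_log_le (hp n).inv hr
      rw [Matrix.det_nonsing_inv] at h
      have e : Real.log (Ring.inverse (M n).det).re = -Real.log (M n).det.re := by
        rw [← Real.log_inv, Ring.inverse_eq_inv']
        congr 1
        have him := (det_re_pos (hp n)).2
        rw [Complex.inv_re, Complex.normSq_apply, him]
        have := (det_re_pos (hp n)).1
        field_simp
        ring
      rw [e] at h
      rw [Complex.smul_re, smul_eq_mul, smul_eq_mul]
      have := mul_le_mul_of_nonneg_left h (one_div_pos.2 hn').le
      rw [mul_sub, mul_add, one_div_mul_cancel hn'.ne'] at this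
      linarith
    · filter_upwards [eventually_gt_atTop 0] with n hn
      have hn' : (0 : ℝ) < n := by exact_mod_cast hn
      have h := log_det_add_sum_log_le (hp n) (r := fun ν => (r ν)⁻¹) fun ν => inv_pos.2 (hr ν)
      simp only [Real.log_inv, Finset.sum_neg_distrib] at h
      rw [Complex.smul_re, smul_eq_mul, smul_eq_mul]
      have := mul_le_mul_of_nonneg_left h (one_div_pos.2 hn').le
      rw [mul_sub, mul_add, one_div_mul_cancel hn'.ne'] at this
      linarith
  simpa using hdiff.add hlog

/-! ### Shift matrices and filters -/

/-- The nilpotent shift matrix. -/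
def shiftMat (R : Type*) [Semiring R] (n : ℕ) : Matrix (Fin n) (Fin n) R :=
  Matrix.of fun i j => if (i : ℕ) = j + 1 then 1 else 0

theorem shiftMat_pow_apply {R : Type*} [Semiring R] {n : ℕ} (k : ℕ) (i j : Fin n) :
    (shiftMat R n ^ k) i j = if (i : ℕ) = j + k then 1 else 0 := by
  induction k generalizing i j with
  | zero => simp [Matrix.one_apply, Fin.ext_iff]
  | succ k ih =>
    rw [pow_succ, Matrix.mul_apply]
    have e : ∀ l : Fin n, (shiftMat R n ^ k) i l * shiftMat R n l j
        = if (l : ℕ) = j + 1 then (if (i : ℕ) = l + k then 1 else 0) else 0 := by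
      intro l
      rw [ih, shiftMat, Matrix.of_apply, mul_ite, mul_one, mul_zero]
    simp only [e]
    by_cases h : (j : ℕ) + 1 < n
    · rw [Finset.sum_eq_single ⟨j + 1, h⟩]
      · by_cases h2 : (i : ℕ) = j + (k + 1)
        · have h3 : (i : ℕ) = j + 1 + k := by omega
          simp [h2, ← h3]
        · have h3 : ¬ (i : ℕ) = j + 1 + k := by omega
          simp [h2, h3]
      · intro l _ hl
        have : (l : ℕ) ≠ j + 1 := fun h' => hl (Fin.ext h')
        simp [this]
      · simp
    · rw [if_neg (by omega)]
      refine Finset.sum_eq_zero fun l _ => ?_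
      have : (l : ℕ) ≠ j + 1 := by omega
      simp [this]

theorem shiftMat_pow_mulVec {n : ℕ} (k : ℕ) (x : Fin n → ℝ) (t : Fin n) :
    (shiftMat ℝ n ^ k *ᵥ x) t = zeroExt x ((t : ℤ) - k) := by
  simp only [Matrix.mulVec, dotProduct, shiftMat_pow_apply, ite_mul, one_mul, zero_mul]
  unfold zeroExt
  split_ifs with h
  · rw [Finset.sum_eq_single (⟨((t : ℤ) - k).toNat, by omega⟩ : Fin n)]
    · rw [if_pos]; simp only []; omega
    · intro l _ hl
      rw [if_neg]
      intro h'
      exact hl (Fin.ext (by simp only []; omega))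
    · simp
  · refine Finset.sum_eq_zero fun l _ => ?_
    rw [if_neg]
    have := t.2
    omega

/-- The lower triangular Toeplitz matrix of the filter with coefficients `a`. -/
def tapMat {K : ℕ} (a : Fin (K + 1) → ℝ) (n : ℕ) : Matrix (Fin n) (Fin n) ℝ :=
  ∑ k : Fin (K + 1), a k • shiftMat ℝ n ^ (k : ℕ)

theorem filt_eq_mulVec {K n : ℕ} (a : Fin (K + 1) → ℝ) (x : Fin n → ℝ) :
    filt a x = tapMat a n *ᵥ x := by
  ext t
  simp only [filt, tapMat, Matrix.sum_mulVec, Finset.sum_apply, Matrix.smul_mulVec, Pi.smul_apply,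
    shiftMat_pow_mulVec, smul_eq_mul]

/-- The whitening filter `x_t - ∑ φ_k x_{t-k}` of the autoregression. -/
def arMat {p : ℕ} (φ : Fin p → ℝ) (n : ℕ) : Matrix (Fin n) (Fin n) ℝ :=
  1 - ∑ k : Fin p, φ k • shiftMat ℝ n ^ ((k : ℕ) + 1)

theorem arMat_mulVec {p n : ℕ} (φ : Fin p → ℝ) (x : Fin n → ℝ) (t : Fin n) :
    (arMat φ n *ᵥ x) t = x t - ∑ k : Fin p, φ k * zeroExt x ((t : ℤ) - ((k : ℤ) + 1)) := by
  simp only [arMat, Matrix.sub_mulVec, Matrix.one_mulVec, Matrix.sum_mulVec, Pi.sub_apply,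
    Finset.sum_apply, Matrix.smul_mulVec, Pi.smul_apply, shiftMat_pow_mulVec, smul_eq_mul]
  push_cast
  rfl

/-- The filter is strictly causal apart from its leading coefficient `1`, so the matrix is unit
lower triangular. Besides invertibility, this yields the vanishing of the average of `log |1 - Φ|²`.
-/
theorem det_arMat {p : ℕ} (φ : Fin p → ℝ) (n : ℕ) : (arMat φ n).det = 1 := by
  have happ : ∀ i j : Fin n, i ≤ j → arMat φ n i j = (1 : Matrix (Fin n) (Fin n) ℝ) i j := by
    intro i j hij
    simp only [arMat, Matrix.sub_apply, Matrix.sum_apply, Matrix.smul_apply, shiftMat_pow_apply,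
      smul_eq_mul]
    rw [Finset.sum_eq_zero, sub_zero]
    intro k _
    rw [if_neg (by have : (i : ℕ) ≤ j := hij; omega), mul_zero]
  rw [Matrix.det_of_isLowerTriangular]
  · exact Finset.prod_eq_one fun i _ => by rw [happ i i le_rfl, Matrix.one_apply_eq]
  · intro i j hij
    have hij' : i < j := hij
    rw [happ i j hij'.le, Matrix.one_apply_ne hij'.ne]

theorem arMat_inv_mul {p : ℕ} (φ : Fin p → ℝ) (n : ℕ) : (arMat φ n)⁻¹ * arMat φ n = 1 :=
  Matrix.nonsing_inv_mul _ (by simp [det_arMat])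

theorem arMat_mulVec_arWord {p n : ℕ} (P : ℝ) (φ : Fin p → ℝ) (z : Fin n → ℝ) :
    arMat φ n *ᵥ arWord P φ z = Real.sqrt (innovVar P φ) • z := by
  ext t
  rw [arMat_mulVec]
  conv_lhs => enter [1]; rw [arWord, arSeq]
  have h1 : zeroExt z ((t : ℕ) : ℤ) = z t := by
    unfold zeroExt
    rw [dif_pos (by have := t.2; omega)]
    congr 1
  have h2 : ∀ i : Fin p, (if (i : ℕ) + 1 ≤ t then φ i * arSeq φ (Real.sqrt (innovVar P φ))
      (fun s => zeroExt z (s : ℤ)) (t - ((i : ℕ) + 1)) else 0)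
      = φ i * zeroExt (arWord P φ z) ((t : ℤ) - ((i : ℤ) + 1)) := by
    intro i
    unfold zeroExt
    have := t.2
    split_ifs with h3 h4 h4
    · simp only [arWord]
      congr 2
      omega
    · omega
    · omega
    · simp
  simp only [h1, h2, Pi.smul_apply, smul_eq_mul]
  ring

theorem arWord_eq {p n : ℕ} (P : ℝ) (φ : Fin p → ℝ) (z : Fin n → ℝ) :
    arWord P φ z = (Real.sqrt (innovVar P φ) • (arMat φ n)⁻¹) *ᵥ z := by
  have h := congrArg (fun v => (arMat φ n)⁻¹ *ᵥ v) (arMat_mulVec_arWord P φ z)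
  simp only [Matrix.mulVec_mulVec, arMat_inv_mul, Matrix.one_mulVec, Matrix.mulVec_smul] at h
  rw [h, Matrix.smul_mulVec]

/-! ### Complexification and symbols -/

/-- A real matrix seen as a complex matrix. -/
def cplx {ι : Type*} [Fintype ι] [DecidableEq ι] : Matrix ι ι ℝ →+* Matrix ι ι ℂ :=
  Complex.ofRealHom.mapMatrix

section cplx
variable {ι : Type*} [Fintype ι] [DecidableEq ι]

theorem cplx_apply (M : Matrix ι ι ℝ) (i j : ι) : cplx M i j = (M i j : ℂ) := rfl

theorem cplx_smul (c : ℝ) (M : Matrix ι ι ℝ) : cplx (c • M) = (c : ℂ) • cplx M := by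
  ext i j; simp [cplx_apply]

theorem cplx_transpose (M : Matrix ι ι ℝ) : cplx Mᵀ = (cplx M)ᴴ := by
  ext i j; simp [cplx_apply, Matrix.conjTranspose_apply]

theorem cplx_trace (M : Matrix ι ι ℝ) : (cplx M).trace = (M.trace : ℂ) := by
  simp [Matrix.trace, cplx_apply]

theorem cplx_det (M : Matrix ι ι ℝ) : (cplx M).det = (M.det : ℂ) := by
  unfold cplx
  rw [← RingHom.map_det]
  rfl

theorem hs_cplx (M : Matrix ι ι ℝ) : hs (cplx M) = hs M := by
  simp [hs, cplx_apply]

theorem cplx_inv (M : Matrix ι ι ℝ) (h : IsUnit M.det) : cplx M⁻¹ = (cplx M)⁻¹ := by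
  refine (Matrix.inv_eq_left_inv ?_).symm
  rw [← map_mul, Matrix.nonsing_inv_mul _ h, map_one]

end cplx

theorem cplx_shiftMat (n : ℕ) : cplx (shiftMat ℝ n) = shiftMat ℂ n := by
  ext i j
  simp [cplx_apply, shiftMat, apply_ite Complex.ofReal]

/-- The Gram matrix `Sᴴ S` is a diagonal projection. -/
theorem norm_shiftMat_le (n : ℕ) : ‖shiftMat ℂ n‖ ≤ 1 := by
  have h : (shiftMat ℂ n)ᴴ * shiftMat ℂ n
      = Matrix.diagonal fun j : Fin n => if (j : ℕ) + 1 < n then (1 : ℂ) else 0 := by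
    ext i j
    rw [Matrix.mul_apply, Matrix.diagonal_apply]
    simp only [Matrix.conjTranspose_apply, shiftMat, Matrix.of_apply, apply_ite star, star_one,
      star_zero, ite_mul, one_mul, zero_mul]
    by_cases h : (i : ℕ) + 1 < n
    · rw [Finset.sum_eq_single ⟨i + 1, h⟩]
      · by_cases hij : i = j
        · subst hij; simp [h]
        · have : ¬ (i : ℕ) = j := fun h' => hij (Fin.ext h')
          simp [hij, this]
      · intro l _ hl
        have : (l : ℕ) ≠ i + 1 := fun h' => hl (Fin.ext h')
        simp [this]
      · simp
    · rw [Finset.sum_eq_zero]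
      · split_ifs <;> simp_all
      · intro l _
        have : (l : ℕ) ≠ i + 1 := by omega
        simp [this]
  have h2 : ‖shiftMat ℂ n‖ * ‖shiftMat ℂ n‖ ≤ 1 := by
    rw [← Matrix.l2_opNorm_conjTranspose_mul_self, h, Matrix.l2_opNorm_diagonal,
      pi_norm_le_iff_of_nonneg zero_le_one]
    intro j
    split_ifs <;> simp
  nlinarith [norm_nonneg (shiftMat ℂ n)]

/-- The nilpotent shift lacks only the corner entry of the cyclic shift, an error of at most `1` in
squared Hilbert–Schmidt norm. All other symbols follow from this one by the algebra of `HasSymbol`.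
-/
theorem hasSymbol_shiftMat :
    HasSymbol (fun n => shiftMat ℂ n) (fun ν => Complex.exp (-Complex.I * ν)) := by
  refine HasSymbol.of_hs_le (f := fun n : ℕ => 1 / (n : ℝ)) ⟨1, norm_shiftMat_le⟩ (by fun_prop)
    tendsto_one_div_atTop_nhds_zero_nat fun n => ?_
  gcongr
  have hle : ∀ i j : Fin n, ‖(shiftMat ℂ n - circ n fun ν => Complex.exp (-Complex.I * ν)) i j‖ ^ 2
      ≤ if (i : ℕ) = 0 then (if (j : ℕ) + 1 = n then (1 : ℝ) else 0) else 0 := by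
    intro i j
    have hc := circ_exp_apply 1 i j
    simp only [pow_one] at hc
    rw [Matrix.sub_apply, hc, shiftMat, Matrix.of_apply]
    have hi := i.2
    have hj := j.2
    by_cases h1 : (i : ℕ) = j + 1
    · have h2 : (n : ℤ) ∣ (i : ℤ) - j - (1 : ℕ) := by rw [h1]; simp
      rw [if_pos h1, if_pos h2, sub_self, norm_zero]
      split_ifs <;> norm_num
    · rw [if_neg h1]
      by_cases h2 : (n : ℤ) ∣ (i : ℤ) - j - (1 : ℕ)
      · have h3 : (n : ℤ) ∣ (i : ℤ) - j - 1 + n := by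
          push_cast at h2; exact dvd_add h2 dvd_rfl
        have h5 : (i : ℤ) ≤ j := by
          by_contra h5
          have := Int.eq_zero_of_abs_lt_dvd h2 (by rw [abs_lt]; constructor <;> push_cast <;> omega)
          push_cast at this
          omega
        have h4 := Int.eq_zero_of_abs_lt_dvd h3 (by rw [abs_lt]; constructor <;> omega)
        rw [if_pos h2, if_pos (by omega), if_pos (by omega)]
        simp
      · rw [if_neg h2, sub_self, norm_zero]
        split_ifs <;> norm_num
  calc hs (shiftMat ℂ n - circ n fun ν => Complex.exp (-Complex.I * ν))
      ≤ ∑ i : Fin n, ∑ j : Fin n,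
        if (i : ℕ) = 0 then (if (j : ℕ) + 1 = n then (1 : ℝ) else 0) else 0 :=
      Finset.sum_le_sum fun i _ => Finset.sum_le_sum fun j _ => hle i j
    _ ≤ 1 := by
      rcases n with _ | n
      · simp
      · rw [Finset.sum_eq_single 0, Finset.sum_eq_single (Fin.last n)]
        · simp
        · intro j _ hj
          have : (j : ℕ) ≠ n := fun h => hj (Fin.ext h)
          simp [this]
        · simp
        · intro i _ hi
          have : (i : ℕ) ≠ 0 := fun h => hi (Fin.ext h)
          simp [this]
        · simp

theorem exp_neg_I_pow (k : ℕ) (ν : ℝ) :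
    Complex.exp (-Complex.I * ν) ^ k = Complex.exp (-Complex.I * (k : ℂ) * ν) := by
  rw [← Complex.exp_nat_mul]
  congr 1
  ring

theorem hasSymbol_tapMat {K : ℕ} (a : Fin (K + 1) → ℝ) :
    HasSymbol (fun n => cplx (tapMat a n)) (fourierTaps a) := by
  have h := HasSymbol.sum Finset.univ (fun (k : Fin (K + 1)) _ =>
    (hasSymbol_shiftMat.pow k).const_smul (a k : ℂ))
  have e : (fun n => cplx (tapMat a n))
      = fun n => ∑ k : Fin (K + 1), (a k : ℂ) • shiftMat ℂ n ^ (k : ℕ) := by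
    ext1 n
    simp only [tapMat, map_sum, cplx_smul, map_pow, cplx_shiftMat]
  rw [e]
  exact h.congr_symbol fun ν => by simp only [exp_neg_I_pow]; rfl

theorem cplx_arMat {p : ℕ} (φ : Fin p → ℝ) (n : ℕ) : cplx (arMat φ n)
    = 1 + (-1 : ℂ) • ∑ k : Fin p, (φ k : ℂ) • shiftMat ℂ n ^ ((k : ℕ) + 1) := by
  simp only [arMat, map_sub, map_one, map_sum, cplx_smul, map_pow, cplx_shiftMat]
  rw [neg_smul, one_smul, sub_eq_add_neg]

theorem hasSymbol_arMat {p : ℕ} (φ : Fin p → ℝ) :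
    HasSymbol (fun n => cplx (arMat φ n)) (fun ν => 1 - fourierAR φ ν) := by
  have h := HasSymbol.one.add ((HasSymbol.sum Finset.univ (fun (k : Fin p) _ =>
    (hasSymbol_shiftMat.pow ((k : ℕ) + 1)).const_smul (φ k : ℂ))).const_smul (-1))
  simp only [cplx_arMat]
  refine h.congr_symbol fun ν => ?_
  simp only [exp_neg_I_pow, fourierAR]
  ring

/-! ### Stable autoregressions -/

/-- The polynomial `1 - ∑ φ_k X^k`. -/
def arPoly {p : ℕ} (φ : Fin p → ℝ) : Polynomial ℂ :=
  1 - ∑ k : Fin p, Polynomial.C (φ k : ℂ) * Polynomial.X ^ ((k : ℕ) + 1)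

theorem arPoly_eval {p : ℕ} (φ : Fin p → ℝ) (z : ℂ) :
    (arPoly φ).eval z = 1 - ∑ k : Fin p, (φ k : ℂ) * z ^ ((k : ℕ) + 1) := by
  simp [arPoly, Polynomial.eval_finsetSum]

/-- The substitution `z ↦ 1 / z` exchanges this polynomial with the characteristic polynomial, so
roots inside the open disc become roots outside the closed one. -/
theorem arPoly_eval_ne_zero {p : ℕ} {φ : Fin p → ℝ} (hφ : φ ∈ stable p) {z : ℂ} (hz : ‖z‖ ≤ 1) :
    (arPoly φ).eval z ≠ 0 := by
  intro h0
  have hz0 : z ≠ 0 := by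
    rintro rfl
    simp [arPoly_eval] at h0
  have h1 : (z⁻¹) ^ p - ∑ i : Fin p, (φ i : ℂ) * (z⁻¹) ^ (p - ((i : ℕ) + 1)) = 0 := by
    have e : (z⁻¹) ^ p - ∑ i : Fin p, (φ i : ℂ) * (z⁻¹) ^ (p - ((i : ℕ) + 1))
        = (z⁻¹) ^ p * (arPoly φ).eval z := by
      rw [arPoly_eval, mul_sub, mul_one, Finset.mul_sum]
      congr 1
      refine Finset.sum_congr rfl fun i _ => ?_
      have e : (z⁻¹) ^ p = (z⁻¹) ^ (p - ((i : ℕ) + 1)) * (z⁻¹) ^ ((i : ℕ) + 1) := by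
        rw [← pow_add]; congr 1; have := i.2; omega
      rw [e, inv_pow z ((i : ℕ) + 1)]
      field_simp
    rw [e, h0, mul_zero]
  have h2 := hφ _ h1
  rw [norm_inv] at h2
  have h3 : 0 < ‖z‖ := norm_pos_iff.2 hz0
  have := (one_le_inv₀ h3).2 hz
  linarith

theorem arPoly_eval_exp {p : ℕ} (φ : Fin p → ℝ) (ν : ℝ) :
    (arPoly φ).eval (Complex.exp (-Complex.I * ν)) = 1 - fourierAR φ ν := by
  rw [arPoly_eval]
  simp only [exp_neg_I_pow, fourierAR]

theorem one_sub_fourierAR_ne_zero {p : ℕ} {φ : Fin p → ℝ} (hφ : φ ∈ stable p) (ν : ℝ) :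
    1 - fourierAR φ ν ≠ 0 := by
  rw [← arPoly_eval_exp]
  refine arPoly_eval_ne_zero hφ (le_of_eq ?_)
  rw [Complex.norm_exp]
  simp

/-- Each factor is `-s (1 - S / s)` with `‖S / s‖ ≤ 1 / ‖s‖ < 1`, and is inverted by a Neumann
series whose norm bound does not depend on the dimension `n`. -/
theorem exists_left_inv_prod (m : Multiset ℂ) (hm : ∀ s ∈ m, 1 < ‖s‖) :
    ∃ C, ∀ n, ∃ N : Matrix (Fin n) (Fin n) ℂ, ‖N‖ ≤ C ∧
      N * Polynomial.aeval (shiftMat ℂ n)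
        (m.map fun s => Polynomial.X - Polynomial.C s).prod = 1 := by
  induction m using Multiset.induction_on with
  | empty =>
    refine ⟨1, fun n => ⟨1, ?_, by simp⟩⟩
    -- In dimension zero the identity has norm `0`, so the normalisation of the operator norm
    -- applies only to positive dimensions.
    rcases n with _ | n
    · rw [Subsingleton.elim (1 : Matrix (Fin 0) (Fin 0) ℂ) 0]; simp
    · exact CStarRing.norm_one.le
  | cons s m ih =>
    obtain ⟨C, hC⟩ := ih fun t ht => hm t (by simp [ht])
    have hs1 : 1 < ‖s‖ := hm s (by simp)
    have hs0 : s ≠ 0 := by rintro rfl; simp at hs1; linarith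
    refine ⟨C * ((1 - ‖s‖⁻¹)⁻¹ * ‖s‖⁻¹), fun n => ?_⟩
    obtain ⟨N, hN, hNm⟩ := hC n
    have hC0 : 0 ≤ C := (norm_nonneg _).trans hN
    set x : Matrix (Fin n) (Fin n) ℂ := s⁻¹ • shiftMat ℂ n with hx
    have hinv1 : ‖s‖⁻¹ < 1 := inv_lt_one_of_one_lt₀ hs1
    have hxn : ‖x‖ ≤ ‖s‖⁻¹ := by
      rw [hx, norm_smul, norm_inv]
      exact mul_le_of_le_one_right (by positivity) (norm_shiftMat_le n)
    have hx1 : ‖x‖ < 1 := hxn.trans_lt hinv1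
    have hone : ‖(1 : Matrix (Fin n) (Fin n) ℂ)‖ ≤ 1 := by
      rcases n with _ | n
      · rw [Subsingleton.elim (1 : Matrix (Fin 0) (Fin 0) ℂ) 0]; simp
      · exact CStarRing.norm_one.le
    have hg := geom_series_mul_neg x hx1
    have hgn := tsum_geometric_le_of_norm_lt_one x hx1
    set T := ∑' i : ℕ, x ^ i
    have hTn : ‖T‖ ≤ (1 - ‖s‖⁻¹)⁻¹ := by
      have : (1 - ‖x‖)⁻¹ ≤ (1 - ‖s‖⁻¹)⁻¹ := by
        apply inv_anti₀ <;> linarith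
      linarith
    have hfac : Polynomial.aeval (shiftMat ℂ n) (Polynomial.X - Polynomial.C s)
        = (-s) • (1 - x) := by
      rw [hx, smul_sub, smul_smul, neg_mul, mul_inv_cancel₀ hs0]
      simp [Algebra.algebraMap_eq_smul_one]
      abel
    have hT2 : ((-s)⁻¹ • T) * Polynomial.aeval (shiftMat ℂ n) (Polynomial.X - Polynomial.C s)
        = 1 := by
      rw [hfac, Matrix.smul_mul, Matrix.mul_smul, smul_smul, hg,
        inv_mul_cancel₀ (neg_ne_zero.2 hs0), one_smul]
    refine ⟨N * ((-s)⁻¹ • T), ?_, ?_⟩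
    · refine (norm_mul_le _ _).trans ?_
      rw [norm_smul, norm_inv, norm_neg, mul_comm ‖s‖⁻¹]
      gcongr
    · rw [Multiset.map_cons, Multiset.prod_cons, map_mul,
        Matrix.mul_assoc, ← Matrix.mul_assoc _ _ (Polynomial.aeval _ _), hT2, Matrix.one_mul, hNm]

/-- The whitening matrix is `arPoly φ` evaluated at the shift; over `ℂ` the polynomial splits into
linear factors whose roots lie outside the closed unit disc. -/
theorem norm_arMat_inv_le {p : ℕ} {φ : Fin p → ℝ} (hφ : φ ∈ stable p) :
    ∃ C, ∀ n, ‖cplx (arMat φ n)⁻¹‖ ≤ C := by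
  have hroots : ∀ s ∈ (arPoly φ).roots, 1 < ‖s‖ := by
    intro s hs
    by_contra h
    exact arPoly_eval_ne_zero hφ (not_lt.1 h) (Polynomial.isRoot_of_mem_roots hs)
  obtain ⟨C, hC⟩ := exists_left_inv_prod _ hroots
  have h0 : arPoly φ ≠ 0 := by
    intro h
    have := arPoly_eval_ne_zero hφ (z := 0) (by simp)
    simp [h] at this
  have hl : (arPoly φ).leadingCoeff ≠ 0 := Polynomial.leadingCoeff_ne_zero.2 h0
  have hq : arPoly φ = Polynomial.C (arPoly φ).leadingCoeff
      * ((arPoly φ).roots.map fun s => Polynomial.X - Polynomial.C s).prod :=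
    (IsAlgClosed.splits (arPoly φ)).eq_prod_roots
  refine ⟨‖(arPoly φ).leadingCoeff⁻¹‖ * C, fun n => ?_⟩
  obtain ⟨N, hN, hNm⟩ := hC n
  have e : cplx (arMat φ n) = Polynomial.aeval (shiftMat ℂ n) (arPoly φ) := by
    rw [cplx_arMat]
    simp only [arPoly, map_sub, map_one, map_sum, map_mul, map_pow, Polynomial.aeval_X,
      Polynomial.aeval_C, Algebra.algebraMap_eq_smul_one, Matrix.smul_mul, Matrix.one_mul]
    rw [neg_smul, one_smul, sub_eq_add_neg]
  have hinv : (cplx (arMat φ n))⁻¹ = (arPoly φ).leadingCoeff⁻¹ • N := by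
    apply Matrix.inv_eq_left_inv
    rw [e]
    conv_lhs => rw [hq]
    rw [map_mul, Polynomial.aeval_C, Algebra.algebraMap_eq_smul_one, Matrix.smul_mul,
      Matrix.smul_mul, Matrix.one_mul, Matrix.mul_smul, hNm, smul_smul]
    rw [← hq, inv_mul_cancel₀ hl, one_smul]
  rw [cplx_inv _ (by simp [det_arMat]), hinv, norm_smul]
  gcongr

theorem hasSymbol_arMat_inv {p : ℕ} {φ : Fin p → ℝ} (hφ : φ ∈ stable p) :
    HasSymbol (fun n => cplx (arMat φ n)⁻¹) (fun ν => (1 - fourierAR φ ν)⁻¹) :=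
  (hasSymbol_arMat φ).inv (one_sub_fourierAR_ne_zero hφ) (norm_arMat_inv_le hφ) fun n => by
    rw [← map_mul, arMat_inv_mul, map_one]

/-! ### Standard Gaussian vectors -/

/-- The law of a vector of independent standard Gaussian variables. -/
def stdG (ι : Type*) [Fintype ι] : Measure (ι → ℝ) := Measure.pi fun _ => gaussianReal 0 1

instance (ι : Type*) [Fintype ι] : IsProbabilityMeasure (stdG ι) := by
  unfold stdG; infer_instance

theorem noise_one (n : ℕ) : noise n 1 = stdG (Fin n) := by
  simp [noise, stdG]

section
variable {ι : Type*} [Fintype ι] [DecidableEq ι]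

/-- The density of the standard Gaussian law. -/
def stdGDensity (z : ι → ℝ) : ℝ :=
  (√(2 * Real.pi))⁻¹ ^ Fintype.card ι * Real.exp (-(1 / 2) * (z ⬝ᵥ z))

theorem stdGDensity_eq_prod (z : ι → ℝ) : stdGDensity z = ∏ i, gaussianPDFReal 0 1 (z i) := by
  simp only [gaussianPDFReal_def, stdGDensity, Finset.prod_mul_distrib, Finset.prod_const,
    Finset.card_univ, ← Real.exp_sum]
  congr 2
  · simp
  · rw [dotProduct, Finset.mul_sum]
    refine Finset.sum_congr rfl fun i _ => ?_
    simp
    ring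

theorem continuous_stdGDensity : Continuous (stdGDensity : (ι → ℝ) → ℝ) := by
  unfold stdGDensity
  fun_prop

theorem stdG_eq_withDensity :
    stdG ι = volume.withDensity fun z => ENNReal.ofReal (stdGDensity z) := by
  unfold stdG
  refine Measure.pi_eq fun s hs => ?_
  rw [withDensity_apply _ (MeasurableSet.univ_pi hs),
    ← lintegral_indicator (MeasurableSet.univ_pi hs)]
  have e : (Set.univ.pi s).indicator (fun z : ι → ℝ => ENNReal.ofReal (stdGDensity z))
      = fun z => ENNReal.ofReal (∏ i, (s i).indicator (gaussianPDFReal 0 1) (z i)) := by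
    ext z
    by_cases hz : z ∈ Set.univ.pi s
    · rw [Set.indicator_of_mem hz, stdGDensity_eq_prod]
      congr 1
      exact Finset.prod_congr rfl fun i _ => (Set.indicator_of_mem (hz i trivial) _).symm
    · rw [Set.indicator_of_notMem hz]
      simp only [Set.mem_univ_pi, not_forall] at hz
      obtain ⟨i, hi⟩ := hz
      rw [Finset.prod_eq_zero (Finset.mem_univ i) (Set.indicator_of_notMem hi _)]
      simp
  have hint : ∀ i, Integrable ((s i).indicator (gaussianPDFReal 0 1)) :=
    fun i => (integrable_gaussianPDFReal 0 1).indicator (hs i)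
  have hnn : ∀ i x, 0 ≤ (s i).indicator (gaussianPDFReal 0 1) x :=
    fun i x => Set.indicator_nonneg (fun y _ => gaussianPDFReal_nonneg 0 1 y) x
  rw [e, ← ofReal_integral_eq_lintegral_ofReal]
  · rw [volume_pi, integral_fintype_prod_eq_prod (fun i => (s i).indicator (gaussianPDFReal 0 1)),
      ENNReal.ofReal_prod_of_nonneg fun i _ => integral_nonneg (hnn i)]
    refine Finset.prod_congr rfl fun i _ => ?_
    rw [gaussianReal_apply_eq_integral 0 one_ne_zero, integral_indicator (hs i)]
  · exact Integrable.fintype_prod hint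
  · exact ae_of_all _ fun z => Finset.prod_nonneg fun i _ => hnn i _

theorem lintegral_stdG {F : (ι → ℝ) → ℝ≥0∞} (hF : Measurable F) :
    ∫⁻ z, F z ∂(stdG ι) = ∫⁻ z, ENNReal.ofReal (stdGDensity z) * F z := by
  rw [stdG_eq_withDensity, lintegral_withDensity_eq_lintegral_mul _
    (continuous_stdGDensity.measurable.ennreal_ofReal) hF]
  rfl

theorem measurable_mulVec {κ : Type*} [Fintype κ] (A : Matrix κ ι ℝ) : Measurable fun z => A *ᵥ z :=
  (Continuous.matrix_mulVec continuous_const continuous_id).measurable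

/-- Exponential tilting of the standard Gaussian law by `exp (-(ω/2) |y - B z|²)`. -/
theorem lintegral_tilt {B S : Matrix ι ι ℝ} {ω : ℝ} {y m : ι → ℝ}
    (hS : Sᵀ * S = 1 + ω • (Bᵀ * B)) (hdet : S.det ≠ 0)
    (hm : (1 + ω • (Bᵀ * B)) *ᵥ m = ω • (Bᵀ *ᵥ y)) {F : (ι → ℝ) → ℝ≥0∞} (hF : Measurable F) :
    ∫⁻ z, ENNReal.ofReal (Real.exp (-(ω / 2) * ((y - B *ᵥ z) ⬝ᵥ (y - B *ᵥ z)))) * F z ∂(stdG ι)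
      = ENNReal.ofReal (|S.det|⁻¹ * Real.exp (-(ω / 2) * (y ⬝ᵥ (y - B *ᵥ m))))
        * ∫⁻ u, F (m + S⁻¹ *ᵥ u) ∂(stdG ι) := by
  set G := 1 + ω • (Bᵀ * B) with hG
  have hGt : Gᵀ = G := by rw [← hS]; simp
  -- Completing the square: `hm` makes `m` the minimiser of the total quadratic exponent, so no
  -- linear term in `z - m` survives.
  have hsq : ∀ z : ι → ℝ, (1 / 2) * (z ⬝ᵥ z) + ω / 2 * ((y - B *ᵥ z) ⬝ᵥ (y - B *ᵥ z))
      = 1 / 2 * ((S *ᵥ (z - m)) ⬝ᵥ (S *ᵥ (z - m))) + ω / 2 * (y ⬝ᵥ (y - B *ᵥ m)) := by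
    intro z
    have h1 : (S *ᵥ (z - m)) ⬝ᵥ (S *ᵥ (z - m)) = (z - m) ⬝ᵥ (G *ᵥ (z - m)) := by
      rw [← hS, ← Matrix.mulVec_mulVec, Matrix.dotProduct_mulVec _ Sᵀ, Matrix.vecMul_transpose]
    have h2 : z ⬝ᵥ (G *ᵥ z) = z ⬝ᵥ z + ω * ((B *ᵥ z) ⬝ᵥ (B *ᵥ z)) := by
      rw [hG, Matrix.add_mulVec, Matrix.one_mulVec, Matrix.smul_mulVec, dotProduct_add,
        dotProduct_smul, ← Matrix.mulVec_mulVec, Matrix.dotProduct_mulVec _ Bᵀ,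
        Matrix.vecMul_transpose, smul_eq_mul]
    have h3 : ∀ v : ι → ℝ, v ⬝ᵥ (G *ᵥ m) = ω * ((B *ᵥ v) ⬝ᵥ y) := by
      intro v
      rw [hm, dotProduct_smul, Matrix.dotProduct_mulVec, Matrix.vecMul_transpose, smul_eq_mul]
    have h4 : m ⬝ᵥ (G *ᵥ z) = z ⬝ᵥ (G *ᵥ m) := by
      rw [Matrix.dotProduct_mulVec, ← Matrix.mulVec_transpose, hGt, dotProduct_comm]
    rw [h1]
    simp only [Matrix.mulVec_sub, sub_dotProduct, dotProduct_sub, h4, h3, h2]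
    rw [dotProduct_comm y (B *ᵥ z), dotProduct_comm y (B *ᵥ m)]
    ring
  have hmeas1 : Measurable fun z : ι → ℝ =>
      ENNReal.ofReal (Real.exp (-(ω / 2) * ((y - B *ᵥ z) ⬝ᵥ (y - B *ᵥ z)))) := by
    refine Measurable.ennreal_ofReal (Continuous.measurable ?_)
    have := Continuous.matrix_mulVec (continuous_const (y := B)) (continuous_id (X := ι → ℝ))
    simp only [id] at this
    fun_prop
  set h : (ι → ℝ) → ℝ≥0∞ := fun u => ENNReal.ofReal (stdGDensity u) * F (m + S⁻¹ *ᵥ u) with hh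
  have hFm : Measurable fun u : ι → ℝ => F (m + S⁻¹ *ᵥ u) :=
    hF.comp ((measurable_mulVec _).const_add m)
  have hhm : Measurable h := (continuous_stdGDensity.measurable.ennreal_ofReal).mul hFm
  -- Change of variables `u = S (z - m)`, under which the remaining quadratic exponent becomes
  -- standard Gaussian.
  have hcv : ∫⁻ z, h (S *ᵥ (z - m)) = ENNReal.ofReal |S.det|⁻¹ * ∫⁻ u, h u := by
    rw [lintegral_sub_right_eq_self (fun z => h (S *ᵥ z)) m]
    have := Real.map_matrix_volume_pi_eq_smul_volume_pi hdet
    have h2 : ∫⁻ u, h u ∂(Measure.map (Matrix.toLin' S) volume) = ∫⁻ z, h (S *ᵥ z) := by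
      rw [lintegral_map hhm]
      · simp only [Matrix.toLin'_apply]
      · exact measurable_mulVec S
    rw [← h2, this, lintegral_smul_measure, abs_inv, smul_eq_mul]
  have hhm2 : Measurable fun z => h (S *ᵥ (z - m)) :=
    hhm.comp ((measurable_mulVec S).comp (measurable_id.sub_const m))
  rw [lintegral_stdG (F := fun z => ENNReal.ofReal (Real.exp (-(ω / 2) *
    ((y - B *ᵥ z) ⬝ᵥ (y - B *ᵥ z)))) * F z) (hmeas1.mul hF), lintegral_stdG hFm,
    ENNReal.ofReal_mul (by positivity), mul_assoc, mul_left_comm, ← hcv,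
    ← lintegral_const_mul _ hhm2]
  refine lintegral_congr fun z => ?_
  simp only [hh]
  have e1 : m + S⁻¹ *ᵥ (S *ᵥ (z - m)) = z := by
    rw [Matrix.mulVec_mulVec, Matrix.nonsing_inv_mul _ hdet.isUnit, Matrix.one_mulVec]; abel
  rw [e1, ← mul_assoc, ← mul_assoc, ← ENNReal.ofReal_mul (by unfold stdGDensity; positivity),
    ← ENNReal.ofReal_mul (by positivity)]
  congr 2
  unfold stdGDensity
  rw [mul_assoc, ← Real.exp_add, mul_left_comm, ← Real.exp_add]
  congr 2
  linarith [hsq z]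

/-- Rotation invariance is the tilt with `ω = 0`, in which only the change of variables remains. -/
theorem lintegral_stdG_orthogonal {S : Matrix ι ι ℝ} (hS : Sᵀ * S = 1)
    {F : (ι → ℝ) → ℝ≥0∞} (hF : Measurable F) :
    ∫⁻ z, F z ∂(stdG ι) = ∫⁻ u, F (Sᵀ *ᵥ u) ∂(stdG ι) := by
  have hd : S.det * S.det = 1 := by
    have := congrArg Matrix.det hS
    simpa using this
  have hd0 : S.det ≠ 0 := by intro h; simp [h] at hd
  have habs : |S.det| = 1 := by
    rcases mul_self_eq_one_iff.1 hd with h | h <;> simp [h]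
  have := lintegral_tilt (B := 0) (S := S) (ω := 0) (y := 0) (m := 0) (by simpa using hS) hd0
    (by simp) hF
  have hinv : S⁻¹ = Sᵀ := Matrix.inv_eq_left_inv hS
  simpa [habs, hinv] using this

/-! ### Concentration of Gaussian quadratic forms -/

/-- The variance of the square of a standard Gaussian variable. -/
def sqVar : ℝ := Var[fun x => x ^ 2; gaussianReal 0 1]

theorem memLp_sq_gaussian : MemLp (fun x : ℝ => x ^ 2) 2 (gaussianReal 0 1) := by
  have h := memLp_id_gaussianReal' (μ := 0) (v := 1) 4 (by norm_num)
  -- Hölder's inequality: a finite fourth moment puts the product of two copies of the coordinate in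
  -- `L²`.
  have h2 := MemLp.mul (p := 4) (q := 4) (r := 2) h h (hpqr := ⟨by
    rw [← two_mul, show (4 : ℝ≥0∞) = 2 * 2 by norm_num, ENNReal.mul_inv (by simp) (by simp),
      ← mul_assoc, ENNReal.mul_inv_cancel (by simp) (by simp), one_mul]⟩)
  refine h2.congr_norm (by fun_prop) (ae_of_all _ fun x => ?_)
  simp [sq]

theorem integral_sq_gaussian : ∫ x, x ^ 2 ∂(gaussianReal 0 1) = 1 := by
  have h := variance_fun_id_gaussianReal (μ := 0) (v := 1)
  rw [variance_of_integral_eq_zero (by fun_prop) (by simp)] at h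
  simpa using h

/-- Chebyshev's inequality for a weighted sum of independent squares; only the finiteness of `sqVar`
matters, not its value. -/
theorem stdG_diag_deviation (d : ι → ℝ) {t : ℝ} (ht : 0 < t) :
    stdG ι {v | t ≤ |∑ i, d i * v i ^ 2 - ∑ i, d i|}
      ≤ ENNReal.ofReal (sqVar * (∑ i, d i ^ 2) / t ^ 2) := by
  have hmem : ∀ i, MemLp (fun x : ℝ => d i * x ^ 2) 2 (gaussianReal 0 1) :=
    fun i => memLp_sq_gaussian.const_mul (d i)
  have hmemv : ∀ i, MemLp (fun v : ι → ℝ => d i * v i ^ 2) 2 (stdG ι) := fun i =>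
    (hmem i).comp_measurePreserving (measurePreserving_eval (fun _ : ι => gaussianReal 0 1) i)
  have hsum : MemLp (fun v : ι → ℝ => ∑ i, d i * v i ^ 2) 2 (stdG ι) :=
    memLp_finsetSum _ fun i _ => hmemv i
  have hmean : ∫ v, ∑ i, d i * v i ^ 2 ∂(stdG ι) = ∑ i, d i := by
    rw [integral_finsetSum _ fun i _ => (hmemv i).integrable (by norm_num)]
    refine Finset.sum_congr rfl fun i _ => ?_
    have hp := measurePreserving_eval (fun _ : ι => gaussianReal 0 1) i
    have h := integral_map (μ := stdG ι) (f := fun x : ℝ => d i * x ^ 2)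
      hp.measurable.aemeasurable (by fun_prop)
    have hmap : Measure.map (Function.eval i) (stdG ι) = gaussianReal 0 1 := hp.map_eq
    rw [hmap, integral_const_mul, integral_sq_gaussian, mul_one] at h
    exact h.symm
  have hvar : Var[fun v : ι → ℝ => ∑ i, d i * v i ^ 2; stdG ι] = sqVar * ∑ i, d i ^ 2 := by
    have h := variance_sum_pi (μ := fun _ : ι => gaussianReal 0 1)
      (X := fun i x => d i * x ^ 2) hmem
    have e : (∑ i, fun v : ι → ℝ => d i * v i ^ 2) = fun v => ∑ i, d i * v i ^ 2 := by
      ext v; simp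
    rw [e] at h
    unfold stdG
    rw [h, Finset.mul_sum]
    refine Finset.sum_congr rfl fun i _ => ?_
    rw [variance_const_mul, sqVar, mul_comm]
  have h := meas_ge_le_variance_div_sq hsum ht
  rwa [hmean, hvar] at h

theorem hs_eq_trace (M : Matrix ι ι ℝ) : hs M = (M * Mᵀ).trace := by
  simp only [hs, Matrix.trace, Matrix.diag, Matrix.mul_apply, Matrix.transpose_apply,
    Real.norm_eq_abs, sq_abs]
  simp only [sq]

/-- Chebyshev's inequality for the quadratic form of a symmetric matrix. -/
theorem stdG_quadForm_deviation {M : Matrix ι ι ℝ} (hM : M.IsSymm) {t : ℝ} (ht : 0 < t) :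
    stdG ι {g | t ≤ |g ⬝ᵥ (M *ᵥ g) - M.trace|} ≤ ENNReal.ofReal (sqVar * hs M / t ^ 2) := by
  have hH : M.IsHermitian := by
    rw [Matrix.IsHermitian, Matrix.conjTranspose_eq_transpose_of_trivial]; exact hM
  -- Diagonalise `M`: rotation invariance reduces the form to a weighted sum of squares, with the
  -- trace and the Hilbert–Schmidt sum read off from the eigenvalues.
  set d := hH.eigenvalues with hd
  set U : Matrix ι ι ℝ := (hH.eigenvectorUnitary : Matrix ι ι ℝ) with hU
  have hUU : U * Uᵀ = 1 := by
    have := (hH.eigenvectorUnitary).2.2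
    rwa [Matrix.star_eq_conjTranspose, Matrix.conjTranspose_eq_transpose_of_trivial] at this
  have hUU' : Uᵀ * U = 1 := mul_eq_one_comm.1 hUU
  have hspec : M = U * Matrix.diagonal d * Uᵀ := by
    have := hH.spectral_theorem
    rw [Unitary.conjStarAlgAut_apply, Matrix.star_eq_conjTranspose,
      Matrix.conjTranspose_eq_transpose_of_trivial] at this
    exact this
  have htr : M.trace = ∑ i, d i := by
    rw [hspec, Matrix.trace_mul_comm, ← Matrix.mul_assoc, hUU', Matrix.one_mul,
      Matrix.trace_diagonal]
  have hhs : hs M = ∑ i, d i ^ 2 := by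
    rw [hs_eq_trace, hM.eq, hspec]
    calc _ = (U * Matrix.diagonal d * (Uᵀ * U) * Matrix.diagonal d * Uᵀ).trace := by
          simp only [Matrix.mul_assoc]
      _ = _ := by
        rw [hUU', Matrix.mul_one, Matrix.trace_mul_comm, ← Matrix.mul_assoc, ← Matrix.mul_assoc,
          hUU', Matrix.one_mul, Matrix.diagonal_mul_diagonal, Matrix.trace_diagonal]
        simp only [sq]
  have hmeas : MeasurableSet {g : ι → ℝ | t ≤ |g ⬝ᵥ (M *ᵥ g) - M.trace|} := by
    refine measurableSet_le measurable_const ?_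
    have := Continuous.matrix_mulVec (continuous_const (y := M)) (continuous_id (X := ι → ℝ))
    simp only [id] at this
    exact Continuous.measurable (by fun_prop)
  have hquad : ∀ v : ι → ℝ, (U *ᵥ v) ⬝ᵥ (M *ᵥ (U *ᵥ v)) = ∑ i, d i * v i ^ 2 := by
    intro v
    rw [hspec, ← Matrix.mulVec_mulVec, ← Matrix.mulVec_mulVec, Matrix.mulVec_mulVec v,
      hUU', Matrix.one_mulVec, Matrix.dotProduct_mulVec, ← Matrix.mulVec_transpose,
      Matrix.mulVec_mulVec, hUU', Matrix.one_mulVec]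
    simp only [dotProduct, Matrix.mulVec_diagonal]
    exact Finset.sum_congr rfl fun i _ => by ring
  rw [hhs, ← lintegral_indicator_one hmeas,
    lintegral_stdG_orthogonal (S := Uᵀ) (by simpa using hUU)
      (measurable_one.indicator hmeas)]
  refine le_trans (le_of_eq ?_) (stdG_diag_deviation d ht)
  rw [← lintegral_indicator_one]
  · refine lintegral_congr fun v => ?_
    simp only [Set.indicator, Set.mem_ofPred_eq, Matrix.transpose_transpose, hquad, htr,
      Pi.one_apply]
  · exact measurableSet_le measurable_const (by fun_prop)

theorem trace_mul_self_le_hs (M : Matrix ι ι ℝ) : (M * M).trace ≤ hs M := by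
  have h1 : (M * M).trace = ∑ i, ∑ j, M i j * M j i := by
    simp [Matrix.trace, Matrix.mul_apply]
  have h2 : hs M = ∑ i, ∑ j, (M i j ^ 2 + M j i ^ 2) / 2 := by
    have e : hs M = ∑ i, ∑ j, M i j ^ 2 := by simp [hs]
    have e2 : ∑ i, ∑ j, M j i ^ 2 = ∑ i, ∑ j, M i j ^ 2 := Finset.sum_comm
    simp only [add_div, Finset.sum_add_distrib, ← Finset.sum_div]
    rw [e2, e]; ring
  rw [h1, h2]
  refine Finset.sum_le_sum fun i _ => Finset.sum_le_sum fun j _ => ?_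
  nlinarith [sq_nonneg (M i j - M j i)]

/-- The Hilbert–Schmidt sum of `Tᵀ N T` equals the trace of `(N T Tᵀ)²`, hence is at most that of `N
T Tᵀ`. Only the covariance `T Tᵀ` appears in the bound, not `T` itself. -/
theorem stdG_quadForm_comp_deviation {κ : Type*} [Fintype κ] [DecidableEq κ] (T : Matrix κ ι ℝ)
    {N : Matrix κ κ ℝ} (hN : N.IsSymm) {t : ℝ} (ht : 0 < t) :
    stdG ι {g | t ≤ |(T *ᵥ g) ⬝ᵥ (N *ᵥ (T *ᵥ g)) - (N * (T * Tᵀ)).trace|}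
      ≤ ENNReal.ofReal (sqVar * hs (N * (T * Tᵀ)) / t ^ 2) := by
  have hsym : (Tᵀ * N * T).IsSymm := by
    rw [Matrix.IsSymm]
    simp [Matrix.transpose_mul, hN.eq, Matrix.mul_assoc]
  have h := stdG_quadForm_deviation hsym ht
  have e1 : (Tᵀ * N * T).trace = (N * (T * Tᵀ)).trace := by
    rw [Matrix.mul_assoc, Matrix.trace_mul_comm, Matrix.mul_assoc]
  have e2 : hs (Tᵀ * N * T) ≤ hs (N * (T * Tᵀ)) := by
    refine le_trans (le_of_eq ?_) (trace_mul_self_le_hs _)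
    rw [hs_eq_trace, hsym.eq]
    calc (Tᵀ * N * T * (Tᵀ * N * T)).trace = (Tᵀ * (N * T * (Tᵀ * N * T))).trace := by
          simp only [Matrix.mul_assoc]
      _ = _ := by
          rw [Matrix.trace_mul_comm]; simp only [Matrix.mul_assoc]
  have e3 : ∀ g : ι → ℝ, g ⬝ᵥ ((Tᵀ * N * T) *ᵥ g) = (T *ᵥ g) ⬝ᵥ (N *ᵥ (T *ᵥ g)) := by
    intro g
    rw [← Matrix.mulVec_mulVec, ← Matrix.mulVec_mulVec, Matrix.dotProduct_mulVec g Tᵀ,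
      Matrix.vecMul_transpose]
  simp only [e1, e3] at h
  refine h.trans (ENNReal.ofReal_le_ofReal ?_)
  have : 0 ≤ sqVar := variance_nonneg _ _
  gcongr

end

/-! ### Quadratic forms in three independent Gaussian blocks -/

/-- The joint law of three independent standard Gaussian vectors of length `n`. -/
def tri (n : ℕ) : Measure ((Fin n → ℝ) × (Fin n → ℝ) × (Fin n → ℝ)) :=
  (stdG (Fin n)).prod ((stdG (Fin n)).prod (stdG (Fin n)))

theorem measurePreserving_tri (n : ℕ) :
    MeasurePreserving (fun g : Fin n ⊕ (Fin n ⊕ Fin n) → ℝ =>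
      (g ∘ Sum.inl, g ∘ Sum.inr ∘ Sum.inl, g ∘ Sum.inr ∘ Sum.inr))
      (stdG (Fin n ⊕ (Fin n ⊕ Fin n))) (tri n) := by
  have h1 : MeasurePreserving (MeasurableEquiv.sumPiEquivProdPi fun _ => ℝ)
      (stdG (Fin n ⊕ (Fin n ⊕ Fin n))) ((stdG (Fin n)).prod (stdG (Fin n ⊕ Fin n))) :=
    measurePreserving_sumPiEquivProdPi fun _ => gaussianReal 0 1
  have h2 : MeasurePreserving (MeasurableEquiv.sumPiEquivProdPi fun _ => ℝ)
      (stdG (Fin n ⊕ Fin n)) ((stdG (Fin n)).prod (stdG (Fin n))) :=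
    measurePreserving_sumPiEquivProdPi fun _ => gaussianReal 0 1
  exact ((MeasurePreserving.id (stdG (Fin n))).prod h2).comp h1

theorem continuous_mulVec {κ ι : Type*} [Fintype ι] (A : Matrix κ ι ℝ) :
    Continuous fun z => A *ᵥ z :=
  Continuous.matrix_mulVec continuous_const continuous_id

/-- The quadratic form of `N` at `T₁ z + T₂ w + T₃ u`. -/
def triForm {n : ℕ} (N T₁ T₂ T₃ : Matrix (Fin n) (Fin n) ℝ)
    (x : (Fin n → ℝ) × (Fin n → ℝ) × (Fin n → ℝ)) : ℝ :=
  (T₁ *ᵥ x.1 + (T₂ *ᵥ x.2.1 + T₃ *ᵥ x.2.2)) ⬝ᵥ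
    (N *ᵥ (T₁ *ᵥ x.1 + (T₂ *ᵥ x.2.1 + T₃ *ᵥ x.2.2)))

theorem continuous_triForm {n : ℕ} (N T₁ T₂ T₃ : Matrix (Fin n) (Fin n) ℝ) :
    Continuous (triForm N T₁ T₂ T₃) := by
  have h := continuous_mulVec N
  have h1 := continuous_mulVec T₁
  have h2 := continuous_mulVec T₂
  have h3 := continuous_mulVec T₃
  have hv : Continuous fun x : (Fin n → ℝ) × (Fin n → ℝ) × (Fin n → ℝ) =>
      T₁ *ᵥ x.1 + (T₂ *ᵥ x.2.1 + T₃ *ᵥ x.2.2) :=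
    (h1.comp continuous_fst).add ((h2.comp (continuous_fst.comp continuous_snd)).add
      (h3.comp (continuous_snd.comp continuous_snd)))
  exact hv.dotProduct (h.comp hv)

/-- Juxtaposing the three blocks gives one matrix acting on a single Gaussian vector, with
covariance the sum of the three covariances. -/
theorem tri_deviation {n : ℕ} {N : Matrix (Fin n) (Fin n) ℝ} (T₁ T₂ T₃ : Matrix (Fin n) (Fin n) ℝ)
    (hN : N.IsSymm) {t : ℝ} (ht : 0 < t) :
    tri n {x | t ≤ |triForm N T₁ T₂ T₃ x
        - (N * (T₁ * T₁ᵀ + (T₂ * T₂ᵀ + T₃ * T₃ᵀ))).trace|}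
      ≤ ENNReal.ofReal (sqVar * hs (N * (T₁ * T₁ᵀ + (T₂ * T₂ᵀ + T₃ * T₃ᵀ))) / t ^ 2) := by
  have hmeas : MeasurableSet {x | t ≤ |triForm N T₁ T₂ T₃ x
        - (N * (T₁ * T₁ᵀ + (T₂ * T₂ᵀ + T₃ * T₃ᵀ))).trace|} :=
    measurableSet_le measurable_const
      ((continuous_triForm N T₁ T₂ T₃).sub continuous_const).abs.measurable
  rw [← (measurePreserving_tri n).measure_preimage hmeas.nullMeasurableSet]
  have h := stdG_quadForm_comp_deviation (fromCols T₁ (fromCols T₂ T₃)) hN ht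
  have e : fromCols T₁ (fromCols T₂ T₃) * (fromCols T₁ (fromCols T₂ T₃))ᵀ
      = T₁ * T₁ᵀ + (T₂ * T₂ᵀ + T₃ * T₃ᵀ) := by
    rw [transpose_fromCols, transpose_fromCols, fromCols_mul_fromRows, fromCols_mul_fromRows]
  rw [e] at h
  simp only [fromCols_mulVec] at h
  exact h

theorem avg_ofReal (r : ℝ → ℝ) : avg (fun ν => (r ν : ℂ)) = ((avg r : ℝ) : ℂ) := by
  unfold avg
  rw [intervalIntegral.integral_ofReal]
  simp

/-- Real matrices: convergence of normalised traces. -/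
theorem HasSymbol.real_trace_tendsto {M : ∀ n, Matrix (Fin n) (Fin n) ℝ} {r : ℝ → ℝ}
    (hM : HasSymbol (fun n => cplx (M n)) (fun ν => (r ν : ℂ))) :
    Tendsto (fun n : ℕ => (M n).trace / n) atTop (𝓝 (avg r)) := by
  have h := (Complex.continuous_re.tendsto _).comp hM.trace_tendsto
  rw [avg_ofReal, Complex.ofReal_re] at h
  refine h.congr fun n => ?_
  simp only [Function.comp_apply, cplx_trace, Complex.smul_re, Complex.ofReal_re, smul_eq_mul]
  ring

/-- The variance is at most of order `n`, by the operator norm bound, against a squared deviation of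
order `n²`; the symbol identifies the limit of the mean divided by `n`. -/
theorem tri_tendsto {N T₁ T₂ T₃ : ∀ n, Matrix (Fin n) (Fin n) ℝ} (hN : ∀ n, (N n).IsSymm)
    {r : ℝ → ℝ} (hs : HasSymbol (fun n => cplx (N n * (T₁ n * (T₁ n)ᵀ
      + (T₂ n * (T₂ n)ᵀ + T₃ n * (T₃ n)ᵀ)))) (fun ν => (r ν : ℂ))) {ε : ℝ} (hε : 0 < ε) :
    Tendsto (fun n : ℕ => tri n {x | ε * n ≤ |triForm (N n) (T₁ n) (T₂ n) (T₃ n) x - n * avg r|})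
      atTop (𝓝 0) := by
  obtain ⟨C, hC⟩ := hs.bdd
  have htr := hs.real_trace_tendsto
  have hup : Tendsto (fun n : ℕ => ENNReal.ofReal (sqVar * C ^ 2 / (ε / 2) ^ 2 * (1 / (n : ℝ))))
      atTop (𝓝 0) := by
    rw [← ENNReal.ofReal_zero]
    refine (ENNReal.continuous_ofReal.tendsto 0).comp ?_
    have h := (tendsto_one_div_atTop_nhds_zero_nat (𝕜 := ℝ)).const_mul
      (sqVar * C ^ 2 / (ε / 2) ^ 2)
    rwa [mul_zero] at h
  refine tendsto_of_tendsto_of_tendsto_of_le_of_le' tendsto_const_nhds hup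
    (Eventually.of_forall fun _ => zero_le) ?_
  filter_upwards [eventually_gt_atTop 0, htr.eventually (Metric.ball_mem_nhds _ (half_pos hε))]
    with n hn hd
  have hn' : (0 : ℝ) < n := by exact_mod_cast hn
  set Q := N n * (T₁ n * (T₁ n)ᵀ + (T₂ n * (T₂ n)ᵀ + T₃ n * (T₃ n)ᵀ)) with hQ
  have hd' : |Q.trace - n * avg r| < ε / 2 * n := by
    rw [Real.dist_eq] at hd
    have : Q.trace - n * avg r = (Q.trace / n - avg r) * n := by field_simp
    rw [this, abs_mul, abs_of_pos hn']
    exact mul_lt_mul_of_pos_right hd hn'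
  have hdev := tri_deviation (T₁ n) (T₂ n) (T₃ n) (hN n) (t := ε / 2 * n) (by positivity)
  refine (measure_mono fun x hx => ?_).trans (hdev.trans (ENNReal.ofReal_le_ofReal ?_))
  · simp only [Set.mem_ofPred_eq] at hx ⊢
    have h3 := abs_sub_le (triForm (N n) (T₁ n) (T₂ n) (T₃ n) x) Q.trace (n * avg r)
    linarith
  · have h1 : ISI.hs Q ≤ C ^ 2 * n := by
      rw [← hs_cplx]
      refine (hs_le_opNorm _).trans ?_
      rw [Fintype.card_fin]
      have := hC n
      gcongr
    have h0 : 0 ≤ sqVar := variance_nonneg _ _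
    calc sqVar * ISI.hs Q / (ε / 2 * n) ^ 2 ≤ sqVar * (C ^ 2 * n) / (ε / 2 * n) ^ 2 := by gcongr
      _ = _ := by field_simp

/-! ### Pairwise error probabilities of a Gaussian codeword -/

section pairwise
variable {ι : Type*} [Fintype ι] [DecidableEq ι]

/-- The matrix `1 + ω Bᵀ B`. -/
def gram (B : Matrix ι ι ℝ) (ω : ℝ) : Matrix ι ι ℝ := 1 + ω • (Bᵀ * B)

/-- The matrix `1 - ω B (1 + ω Bᵀ B)⁻¹ Bᵀ = (1 + ω B Bᵀ)⁻¹`. -/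
def resid (B : Matrix ι ι ℝ) (ω : ℝ) : Matrix ι ι ℝ := 1 - ω • (B * (gram B ω)⁻¹ * Bᵀ)

theorem cplx_gram (B : Matrix ι ι ℝ) (ω : ℝ) :
    cplx (gram B ω) = 1 + (ω : ℂ) • ((cplx B)ᴴ * cplx B) := by
  rw [gram, map_add, map_one, cplx_smul, map_mul, cplx_transpose]

theorem posDef_gram (B : Matrix ι ι ℝ) {ω : ℝ} (hω : 0 ≤ ω) : (gram B ω).PosDef := by
  have h := (Matrix.posSemidef_conjTranspose_mul_self B).smul hω
  rw [Matrix.conjTranspose_eq_transpose_of_trivial] at h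
  exact Matrix.PosDef.one.add_posSemidef h

theorem posDef_cplx_gram (B : Matrix ι ι ℝ) {ω : ℝ} (hω : 0 ≤ ω) : (cplx (gram B ω)).PosDef := by
  rw [cplx_gram]
  refine Matrix.PosDef.one.add_posSemidef ?_
  exact (Matrix.posSemidef_conjTranspose_mul_self (cplx B)).smul (by exact_mod_cast hω)

theorem isUnit_det_gram (B : Matrix ι ι ℝ) {ω : ℝ} (hω : 0 ≤ ω) : IsUnit (gram B ω).det :=
  (posDef_gram B hω).det_pos.ne'.isUnit

theorem gram_transpose (B : Matrix ι ι ℝ) (ω : ℝ) : (gram B ω)ᵀ = gram B ω := by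
  simp [gram, Matrix.transpose_mul]

theorem resid_isSymm (B : Matrix ι ι ℝ) (ω : ℝ) : (resid B ω).IsSymm := by
  rw [Matrix.IsSymm, resid]
  simp [Matrix.transpose_mul, Matrix.transpose_nonsing_inv, gram_transpose, Matrix.mul_assoc]

theorem exists_transpose_mul_self_eq {M : Matrix ι ι ℝ} (hM : M.PosDef) :
    ∃ S : Matrix ι ι ℝ, Sᵀ * S = M := by
  have hH := hM.1
  set U : Matrix ι ι ℝ := (hH.eigenvectorUnitary : Matrix ι ι ℝ) with hU
  refine ⟨Matrix.diagonal (fun i => √(hH.eigenvalues i)) * Uᵀ, ?_⟩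
  have := hH.spectral_theorem
  rw [Unitary.conjStarAlgAut_apply, Matrix.star_eq_conjTranspose,
    Matrix.conjTranspose_eq_transpose_of_trivial] at this
  rw [Matrix.transpose_mul, Matrix.diagonal_transpose, Matrix.transpose_transpose]
  conv_rhs => rw [this]
  rw [← Matrix.mul_assoc, Matrix.mul_assoc U, Matrix.diagonal_mul_diagonal]
  congr 3
  ext i
  simp [Real.mul_self_sqrt (hM.eigenvalues_pos i).le]

/-- The squared distance `|y - B z|²`. -/
def dist2 (B : Matrix ι ι ℝ) (y z : ι → ℝ) : ℝ := (y - B *ᵥ z) ⬝ᵥ (y - B *ᵥ z)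

theorem continuous_dist2 (B : Matrix ι ι ℝ) :
    Continuous fun x : (ι → ℝ) × (ι → ℝ) => dist2 B x.1 x.2 := by
  have h : Continuous fun x : (ι → ℝ) × (ι → ℝ) => x.1 - B *ᵥ x.2 :=
    continuous_fst.sub ((continuous_mulVec B).comp continuous_snd)
  exact h.dotProduct h

theorem measurable_dist2 (B : Matrix ι ι ℝ) (y : ι → ℝ) : Measurable (dist2 B y) :=
  ((continuous_dist2 B).comp (Continuous.prodMk continuous_const continuous_id)).measurable

/-- The probability that an independent Gaussian codeword is at least as close to `y`. -/
def closeProb (B : Matrix ι ι ℝ) (y : ι → ℝ) (T : ℝ) : ℝ≥0∞ := stdG ι {z | dist2 B y z ≤ T}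

/-- The Laplace transform of the squared distance. -/
def laplace (B : Matrix ι ι ℝ) (ω : ℝ) (y : ι → ℝ) : ℝ :=
  Real.exp (-(1 / 2) * Real.log (gram B ω).det - ω / 2 * (y ⬝ᵥ (resid B ω *ᵥ y)))

/-- Under the tilted law the competitor is `m + S⁻¹ u`, where `m` is the ridge-regression fit of
`y`; the residual `y - B m` is `resid B ω` applied to `y`. -/
theorem lintegral_dist2_tilt {B S : Matrix ι ι ℝ} {ω : ℝ} (hω : 0 ≤ ω) (y : ι → ℝ)
    (hS : Sᵀ * S = gram B ω) {F : ℝ → ℝ≥0∞} (hF : Measurable F) :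
    ∫⁻ z, ENNReal.ofReal (Real.exp (-(ω / 2) * dist2 B y z)) * F (dist2 B y z) ∂(stdG ι)
      = ENNReal.ofReal (laplace B ω y) * ∫⁻ u, F ((resid B ω *ᵥ y - (B * S⁻¹) *ᵥ u) ⬝ᵥ
          (resid B ω *ᵥ y - (B * S⁻¹) *ᵥ u)) ∂(stdG ι) := by
  have hdet2 : S.det * S.det = (gram B ω).det := by rw [← hS]; simp
  have hpos := (posDef_gram B hω).det_pos
  have hd0 : S.det ≠ 0 := by intro h; rw [h, mul_zero] at hdet2; exact hpos.ne hdet2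
  set m := ω • ((gram B ω)⁻¹ *ᵥ (Bᵀ *ᵥ y)) with hm
  have hGm : gram B ω *ᵥ m = ω • (Bᵀ *ᵥ y) := by
    rw [hm, Matrix.mulVec_smul, Matrix.mulVec_mulVec, Matrix.mul_nonsing_inv _
      (isUnit_det_gram B hω), Matrix.one_mulVec]
  have hres : y - B *ᵥ m = resid B ω *ᵥ y := by
    rw [hm, resid, Matrix.sub_mulVec, Matrix.one_mulVec, Matrix.smul_mulVec, Matrix.mulVec_smul,
      Matrix.mulVec_mulVec, Matrix.mulVec_mulVec]
  have h := lintegral_tilt (B := B) (S := S) (ω := ω) (y := y) (m := m) hS hd0 hGm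
    (F := fun z => F (dist2 B y z)) (hF.comp (measurable_dist2 B y))
  have e1 : |S.det|⁻¹ * Real.exp (-(ω / 2) * (y ⬝ᵥ (y - B *ᵥ m))) = laplace B ω y := by
    have hab : 0 < |S.det| := abs_pos.2 hd0
    have : |S.det|⁻¹ = Real.exp (-(1 / 2) * Real.log (gram B ω).det) := by
      rw [← hdet2, ← abs_mul_abs_self, Real.log_mul hab.ne' hab.ne', ← Real.exp_log (inv_pos.2 hab),
        Real.log_inv]
      congr 1
      ring
    rw [hres, this, laplace, ← Real.exp_add]
    congr 1
    ring
  have e2 : ∀ u, dist2 B y (m + S⁻¹ *ᵥ u) = (resid B ω *ᵥ y - (B * S⁻¹) *ᵥ u) ⬝ᵥ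
          (resid B ω *ᵥ y - (B * S⁻¹) *ᵥ u) := by
    intro u
    unfold dist2
    rw [Matrix.mulVec_add, ← sub_sub, hres, Matrix.mulVec_mulVec]
  rw [e1] at h
  simp only [e2] at h
  exact h

/-- Chernoff's bound: the indicator of `dist2 ≤ T` is dominated by `exp (ω/2 (T - dist2))`. -/
theorem closeProb_le {B : Matrix ι ι ℝ} {ω : ℝ} (hω : 0 ≤ ω) (y : ι → ℝ) (T : ℝ) :
    closeProb B y T ≤ ENNReal.ofReal (Real.exp (ω / 2 * T) * laplace B ω y) := by
  obtain ⟨S, hS⟩ := exists_transpose_mul_self_eq (posDef_gram B hω)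
  have h := lintegral_dist2_tilt hω y hS (F := fun _ => 1) measurable_const
  simp only [mul_one, lintegral_const, measure_univ] at h
  have hmeas : MeasurableSet {z | dist2 B y z ≤ T} :=
    measurableSet_le (measurable_dist2 B y) measurable_const
  rw [ENNReal.ofReal_mul (Real.exp_pos _).le, ← h, ← lintegral_const_mul]
  · rw [closeProb, ← lintegral_indicator_one hmeas]
    refine lintegral_mono fun z => ?_
    by_cases hz : dist2 B y z ≤ T
    · rw [Set.indicator_of_mem (by exact hz), Pi.one_apply,
        ← ENNReal.ofReal_mul (Real.exp_pos _).le, ← Real.exp_add, ← ENNReal.ofReal_one]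
      refine ENNReal.ofReal_le_ofReal (Real.one_le_exp ?_)
      nlinarith
    · rw [Set.indicator_of_notMem (by exact hz)]
      exact zero_le
  · exact ((measurable_dist2 B y).const_mul _).exp.ennreal_ofReal

/-- Change of measure: on the event that the distance lies in `[t, T]`, undoing the tilt costs at
worst the factor `exp (ω t / 2)`. It becomes effective when the tilted law concentrates on that
window. -/
theorem le_closeProb {B S : Matrix ι ι ℝ} {ω : ℝ} (hω : 0 ≤ ω) (y : ι → ℝ)
    (hS : Sᵀ * S = gram B ω) (t T : ℝ) :
    ENNReal.ofReal (Real.exp (ω / 2 * t) * laplace B ω y) *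
      stdG ι {u | (resid B ω *ᵥ y - (B * S⁻¹) *ᵥ u) ⬝ᵥ (resid B ω *ᵥ y - (B * S⁻¹) *ᵥ u) ∈ Icc t T}
      ≤ closeProb B y T := by
  have hmeasF : Measurable fun s : ℝ => (Icc t T).indicator
      (fun s => ENNReal.ofReal (Real.exp (ω / 2 * s))) s :=
    (measurable_id.const_mul (ω / 2)).exp.ennreal_ofReal.indicator measurableSet_Icc
  have h := lintegral_dist2_tilt hω y hS hmeasF
  have hc : Measurable fun u : ι → ℝ =>
      (resid B ω *ᵥ y - (B * S⁻¹) *ᵥ u) ⬝ᵥ (resid B ω *ᵥ y - (B * S⁻¹) *ᵥ u) := by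
    have h1 : Continuous fun u : ι → ℝ => resid B ω *ᵥ y - (B * S⁻¹) *ᵥ u :=
      continuous_const.sub (continuous_mulVec _)
    exact (h1.dotProduct h1).measurable
  set f : (ι → ℝ) → ℝ := fun u =>
    (resid B ω *ᵥ y - (B * S⁻¹) *ᵥ u) ⬝ᵥ (resid B ω *ᵥ y - (B * S⁻¹) *ᵥ u) with hf
  have hA : MeasurableSet {u | f u ∈ Icc t T} := hc measurableSet_Icc
  calc _ = ENNReal.ofReal (laplace B ω y) * ∫⁻ u, {u | f u ∈ Icc t T}.indicator
          (fun _ => ENNReal.ofReal (Real.exp (ω / 2 * t))) u ∂(stdG ι) := by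
        rw [lintegral_indicator_const hA, ENNReal.ofReal_mul (Real.exp_pos _).le]
        ring
    _ ≤ ENNReal.ofReal (laplace B ω y) * ∫⁻ u, (Icc t T).indicator
          (fun s => ENNReal.ofReal (Real.exp (ω / 2 * s))) (f u) ∂(stdG ι) := by
        gcongr with u
        by_cases hu : f u ∈ Icc t T
        · rw [Set.indicator_of_mem hu, Set.indicator_of_mem (by exact hu)]
          refine ENNReal.ofReal_le_ofReal (Real.exp_le_exp.2 ?_)
          have := hu.1
          gcongr
        · rw [Set.indicator_of_notMem (by exact hu)]
          exact zero_le
    _ = _ := h.symm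
    _ ≤ ∫⁻ z, {z | dist2 B y z ≤ T}.indicator 1 z ∂(stdG ι) := by
        refine lintegral_mono fun z => ?_
        by_cases hz : dist2 B y z ∈ Icc t T
        · rw [Set.indicator_of_mem hz, Set.indicator_of_mem (by exact hz.2),
            ← ENNReal.ofReal_mul (Real.exp_pos _).le, ← Real.exp_add]
          simp
        · rw [Set.indicator_of_notMem hz, mul_zero]
          exact zero_le
    _ = closeProb B y T := by
        rw [lintegral_indicator_one (measurableSet_le (measurable_dist2 B y) measurable_const)]
        rfl

end pairwise

/-! ### Symbols of the matrices in the exponents -/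

/-- Coercivity bounds the inverse: with `v = N x` and `M v = x`, Cauchy–Schwarz gives `‖v‖² ≤ ‖v‖
‖x‖`. -/
theorem norm_le_one_of_left_inv {n : ℕ} {M N : Matrix (Fin n) (Fin n) ℂ} (h : M * N = 1)
    (hM : ∀ v : EuclideanSpace ℂ (Fin n),
      ‖v‖ ^ 2 ≤ (inner ℂ v (WithLp.toLp 2 (M *ᵥ v.ofLp))).re) : ‖N‖ ≤ 1 := by
  rw [Matrix.l2_opNorm_def]
  refine ContinuousLinearMap.opNorm_le_bound _ zero_le_one fun x => ?_
  set v : EuclideanSpace ℂ (Fin n) := WithLp.toLp 2 (N *ᵥ x.ofLp) with hv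
  have e : ((Matrix.toEuclideanLin (𝕜 := ℂ) (m := Fin n) (n := Fin n)).trans
      LinearMap.toContinuousLinearMap) N x = v := rfl
  rw [e, one_mul]
  have h1 := hM v
  have h2 : M *ᵥ v.ofLp = x.ofLp := by
    rw [hv, Matrix.mulVec_mulVec, h, Matrix.one_mulVec]
  rw [h2, WithLp.toLp_ofLp] at h1
  have h3 := (Complex.re_le_norm _).trans (norm_inner_le_norm (𝕜 := ℂ) v x)
  have h4 : ‖v‖ * ‖v‖ ≤ ‖v‖ * ‖x‖ := by nlinarith
  rcases (norm_nonneg v).eq_or_lt with h0 | h0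
  · rw [← h0]; positivity
  · exact le_of_mul_le_mul_left h4 h0

theorem norm_gram_inv_le {n : ℕ} (B : Matrix (Fin n) (Fin n) ℝ) {ω : ℝ} (hω : 0 ≤ ω) :
    ‖cplx (gram B ω)⁻¹‖ ≤ 1 := by
  refine norm_le_one_of_left_inv (M := cplx (gram B ω)) ?_ fun v => ?_
  · rw [← map_mul, Matrix.mul_nonsing_inv _ (isUnit_det_gram B hω), map_one]
  · rw [cplx_gram, EuclideanSpace.inner_eq_star_dotProduct, EuclideanSpace.norm_sq_eq]
    have h2 := (Matrix.posSemidef_conjTranspose_mul_self (cplx B)).re_dotProduct_nonneg v.ofLp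
    have h3 : (star v.ofLp ⬝ᵥ v.ofLp).re = ∑ i, ‖v.ofLp i‖ ^ 2 := by
      simp only [dotProduct, Complex.re_sum]
      refine Finset.sum_congr rfl fun i _ => ?_
      simp [← Complex.normSq_eq_norm_sq, Complex.normSq_apply]
    rw [dotProduct_comm, Matrix.add_mulVec, dotProduct_add, Matrix.one_mulVec, Matrix.smul_mulVec,
      dotProduct_smul, Complex.add_re, smul_eq_mul, Complex.re_ofReal_mul, h3]
    exact le_add_of_nonneg_right (mul_nonneg hω h2)

section symbols
variable {B C : ∀ n, Matrix (Fin n) (Fin n) ℝ} {β κ : ℝ → ℂ}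

theorem HasSymbol.transpose_real (hB : HasSymbol (fun n => cplx (B n)) β) :
    HasSymbol (fun n => cplx (B n)ᵀ) (fun ν => conj (β ν)) := by
  simpa only [cplx_transpose] using hB.conjTranspose

theorem HasSymbol.mul_real (hB : HasSymbol (fun n => cplx (B n)) β)
    (hC : HasSymbol (fun n => cplx (C n)) κ) :
    HasSymbol (fun n => cplx (B n * C n)) (fun ν => β ν * κ ν) := by
  simpa only [map_mul] using hB.mul hC

theorem HasSymbol.add_real (hB : HasSymbol (fun n => cplx (B n)) β)
    (hC : HasSymbol (fun n => cplx (C n)) κ) :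
    HasSymbol (fun n => cplx (B n + C n)) (fun ν => β ν + κ ν) := by
  simpa only [map_add] using hB.add hC

theorem HasSymbol.smul_real (c : ℝ) (hB : HasSymbol (fun n => cplx (B n)) β) :
    HasSymbol (fun n => cplx (c • B n)) (fun ν => c * β ν) := by
  simpa only [cplx_smul] using hB.const_smul (c : ℂ)

theorem HasSymbol.one_real : HasSymbol (fun n => cplx (1 : Matrix (Fin n) (Fin n) ℝ))
    (fun _ => 1) := by
  simpa only [map_one] using HasSymbol.one

theorem HasSymbol.sub_real (hB : HasSymbol (fun n => cplx (B n)) β)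
    (hC : HasSymbol (fun n => cplx (C n)) κ) :
    HasSymbol (fun n => cplx (B n - C n)) (fun ν => β ν - κ ν) := by
  have h := (hB.add_real (hC.smul_real (-1))).congr_symbol (t := fun ν => β ν - κ ν)
    fun ν => by push_cast; ring
  simpa only [neg_smul, one_smul, ← sub_eq_add_neg] using h

theorem hasSymbol_gram (hB : HasSymbol (fun n => cplx (B n)) β) (ω : ℝ) :
    HasSymbol (fun n => cplx (gram (B n) ω)) (fun ν => ((1 + ω * ‖β ν‖ ^ 2 : ℝ) : ℂ)) :=
  (HasSymbol.one_real.add_real ((hB.transpose_real.mul_real hB).smul_real ω)).congr_symbol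
    fun ν => by rw [Complex.conj_mul']; push_cast; ring

theorem one_add_pos {ω : ℝ} (hω : 0 ≤ ω) (z : ℂ) : 0 < 1 + ω * ‖z‖ ^ 2 := by positivity

theorem hasSymbol_gram_inv (hB : HasSymbol (fun n => cplx (B n)) β) {ω : ℝ} (hω : 0 ≤ ω) :
    HasSymbol (fun n => cplx (gram (B n) ω)⁻¹) (fun ν => ((1 + ω * ‖β ν‖ ^ 2 : ℝ) : ℂ)⁻¹) :=
  (hasSymbol_gram hB ω).inv
    (fun ν => by exact_mod_cast (one_add_pos hω (β ν)).ne') ⟨1, fun n => norm_gram_inv_le _ hω⟩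
    fun n => by rw [← map_mul, Matrix.nonsing_inv_mul _ (isUnit_det_gram _ hω), map_one]

theorem hasSymbol_resid (hB : HasSymbol (fun n => cplx (B n)) β) {ω : ℝ} (hω : 0 ≤ ω) :
    HasSymbol (fun n => cplx (resid (B n) ω)) (fun ν => ((1 + ω * ‖β ν‖ ^ 2 : ℝ) : ℂ)⁻¹) :=
  (HasSymbol.one_real.sub_real (((hB.mul_real (hasSymbol_gram_inv hB hω)).mul_real
    hB.transpose_real).smul_real ω)).congr_symbol fun ν => by
      have h0 : ((1 + ω * ‖β ν‖ ^ 2 : ℝ) : ℂ) ≠ 0 := by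
        exact_mod_cast (one_add_pos hω (β ν)).ne'
      have h1 : β ν * ((1 + ω * ‖β ν‖ ^ 2 : ℝ) : ℂ)⁻¹ * conj (β ν)
          = ((1 + ω * ‖β ν‖ ^ 2 : ℝ) : ℂ)⁻¹ * (‖β ν‖ : ℂ) ^ 2 := by
        rw [← Complex.mul_conj']; ring
      rw [h1]
      field_simp
      push_cast
      ring

theorem log_det_gram_tendsto (hB : HasSymbol (fun n => cplx (B n)) β) {ω : ℝ} (hω : 0 ≤ ω) :
    Tendsto (fun n : ℕ => Real.log (gram (B n) ω).det / n) atTop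
      (𝓝 (avg fun ν => Real.log (1 + ω * ‖β ν‖ ^ 2))) := by
  have h := (hasSymbol_gram hB ω).log_det_tendsto (fun ν => one_add_pos hω (β ν))
    (fun n => posDef_cplx_gram (B n) hω)
    ⟨1, fun n => by rw [← cplx_inv _ (isUnit_det_gram _ hω)]; exact norm_gram_inv_le _ hω⟩
  refine h.congr fun n => ?_
  rw [cplx_det, Complex.ofReal_re]
  ring

end symbols

/-! ### Exponential behaviour of the pairwise error probability -/

/-- The exponent of the Chernoff bound with parameter `ω`, for symbols `β`, `κ` of the decoder and
of the channel. -/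
def rateFn (β κ : ℝ → ℂ) (σ ω : ℝ) : ℝ :=
  1 / 2 * avg (fun ν => Real.log (1 + ω * ‖β ν‖ ^ 2))
    + ω / 2 * avg (fun ν => (‖κ ν‖ ^ 2 + σ ^ 2) / (1 + ω * ‖β ν‖ ^ 2))
    - ω / 2 * avg (fun ν => ‖κ ν - β ν‖ ^ 2 + σ ^ 2)

/-- The limiting normalised distance under the law tilted with parameter `ω`. -/
def slopeFn (β κ : ℝ → ℂ) (σ ω : ℝ) : ℝ :=
  avg (fun ν => (‖κ ν‖ ^ 2 + σ ^ 2) / (1 + ω * ‖β ν‖ ^ 2) ^ 2 + ‖β ν‖ ^ 2 / (1 + ω * ‖β ν‖ ^ 2))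

/-- The limiting normalised distance of the transmitted codeword. -/
def trueDist (β κ : ℝ → ℂ) (σ : ℝ) : ℝ := avg (fun ν => ‖κ ν - β ν‖ ^ 2 + σ ^ 2)

/-- The law of codeword innovations and (normalised) noise. -/
def pairLaw (n : ℕ) : Measure ((Fin n → ℝ) × (Fin n → ℝ)) := (stdG (Fin n)).prod (stdG (Fin n))

instance (n : ℕ) : IsProbabilityMeasure (pairLaw n) := by unfold pairLaw; infer_instance

theorem measurePreserving_pair_assoc (n : ℕ) :
    MeasurePreserving (MeasurableEquiv.prodAssoc (α := Fin n → ℝ) (β := Fin n → ℝ)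
      (γ := Fin n → ℝ)) ((pairLaw n).prod (stdG (Fin n))) (tri n) :=
  measurePreserving_prodAssoc _ _ _

theorem pairLaw_apply {n : ℕ} {S : Set ((Fin n → ℝ) × (Fin n → ℝ))} (hS : MeasurableSet S) :
    pairLaw n S = tri n {x | (x.1, x.2.1) ∈ S} := by
  have h : MeasurePreserving (Prod.map id Prod.fst) (tri n) (pairLaw n) :=
    (MeasurePreserving.id (stdG (Fin n))).prod measurePreserving_fst
  exact (h.measure_preimage hS.nullMeasurableSet).symm

theorem pair_tendsto {N T₁ T₂ : ∀ n, Matrix (Fin n) (Fin n) ℝ} (hN : ∀ n, (N n).IsSymm)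
    {r : ℝ → ℝ} (hs : HasSymbol (fun n => cplx (N n * (T₁ n * (T₁ n)ᵀ + T₂ n * (T₂ n)ᵀ)))
      (fun ν => (r ν : ℂ))) {ε : ℝ} (hε : 0 < ε) :
    Tendsto (fun n : ℕ => pairLaw n {x | ε * n ≤ |(T₁ n *ᵥ x.1 + T₂ n *ᵥ x.2) ⬝ᵥ
      (N n *ᵥ (T₁ n *ᵥ x.1 + T₂ n *ᵥ x.2)) - n * avg r|}) atTop (𝓝 0) := by
  have h := tri_tendsto (T₃ := fun _ => 0) hN (by simpa using hs) hε
  refine h.congr fun n => ?_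
  rw [pairLaw_apply]
  · simp only [triForm, Matrix.zero_mulVec, add_zero, Set.mem_ofPred_eq]
  · have hv : Continuous fun x : (Fin n → ℝ) × (Fin n → ℝ) => T₁ n *ᵥ x.1 + T₂ n *ᵥ x.2 :=
      ((continuous_mulVec _).comp continuous_fst).add ((continuous_mulVec _).comp continuous_snd)
    refine measurableSet_le measurable_const (Continuous.measurable ?_)
    exact ((hv.dotProduct ((continuous_mulVec _).comp hv)).sub continuous_const).abs

variable {B C : ∀ n, Matrix (Fin n) (Fin n) ℝ} {β κ : ℝ → ℂ}

/-- The channel output as a function of innovations and normalised noise. -/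
def chanOut {n : ℕ} (C : Matrix (Fin n) (Fin n) ℝ) (σ : ℝ) (x : (Fin n → ℝ) × (Fin n → ℝ)) :
    Fin n → ℝ := C *ᵥ x.1 + σ • x.2

/-- The probability that an independent codeword beats the transmitted one. -/
def pairErr {n : ℕ} (B C : Matrix (Fin n) (Fin n) ℝ) (σ : ℝ)
    (x : (Fin n → ℝ) × (Fin n → ℝ)) : ℝ≥0∞ :=
  closeProb B (chanOut C σ x) (dist2 B (chanOut C σ x) x.1)

theorem smul_one_mulVec {n : ℕ} (σ : ℝ) (w : Fin n → ℝ) :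
    (σ • (1 : Matrix (Fin n) (Fin n) ℝ)) *ᵥ w = σ • w := by
  rw [Matrix.smul_mulVec, Matrix.one_mulVec]

theorem dist2_chanOut {n : ℕ} (B C : Matrix (Fin n) (Fin n) ℝ) (σ : ℝ)
    (x : (Fin n → ℝ) × (Fin n → ℝ)) :
    dist2 B (chanOut C σ x) x.1 = ((C - B) *ᵥ x.1 + (σ • (1 : Matrix (Fin n) (Fin n) ℝ)) *ᵥ x.2) ⬝ᵥ
      ((1 : Matrix (Fin n) (Fin n) ℝ) *ᵥ
        ((C - B) *ᵥ x.1 + (σ • (1 : Matrix (Fin n) (Fin n) ℝ)) *ᵥ x.2)) := by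
  have : chanOut C σ x - B *ᵥ x.1
      = (C - B) *ᵥ x.1 + (σ • (1 : Matrix (Fin n) (Fin n) ℝ)) *ᵥ x.2 := by
    rw [chanOut, Matrix.sub_mulVec, smul_one_mulVec]; abel
  rw [dist2, this, Matrix.one_mulVec]

theorem hasSymbol_smul_one_sq (σ : ℝ) :
    HasSymbol (fun n => cplx ((σ • (1 : Matrix (Fin n) (Fin n) ℝ))
      * (σ • (1 : Matrix (Fin n) (Fin n) ℝ))ᵀ)) (fun _ => ((σ ^ 2 : ℝ) : ℂ)) := by
  have h := (HasSymbol.one_real.smul_real σ)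
  exact (h.mul_real h.transpose_real).congr_symbol fun ν => by
    simp [sq]

theorem hasSymbol_mul_transpose (hC : HasSymbol (fun n => cplx (C n)) κ) :
    HasSymbol (fun n => cplx (C n * (C n)ᵀ)) (fun ν => ((‖κ ν‖ ^ 2 : ℝ) : ℂ)) :=
  (hC.mul_real hC.transpose_real).congr_symbol fun ν => by
    rw [Complex.mul_conj']; push_cast; rfl

theorem trueDist_tendsto (hB : HasSymbol (fun n => cplx (B n)) β)
    (hC : HasSymbol (fun n => cplx (C n)) κ) (σ : ℝ) {ε : ℝ} (hε : 0 < ε) :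
    Tendsto (fun n : ℕ => pairLaw n {x | ε * n ≤ |dist2 (B n) (chanOut (C n) σ x) x.1
      - n * trueDist β κ σ|}) atTop (𝓝 0) := by
  simp only [dist2_chanOut]
  refine pair_tendsto (N := fun _ => 1) (fun n => Matrix.isSymm_one) ?_ hε
  exact (HasSymbol.one_real.mul_real ((hasSymbol_mul_transpose (hC.sub_real hB)).add_real
    (hasSymbol_smul_one_sq σ))).congr_symbol fun ν => by push_cast; ring

theorem residForm_tendsto (hB : HasSymbol (fun n => cplx (B n)) β)
    (hC : HasSymbol (fun n => cplx (C n)) κ) (σ : ℝ) {ω : ℝ} (hω : 0 ≤ ω) {ε : ℝ} (hε : 0 < ε) :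
    Tendsto (fun n : ℕ => pairLaw n {x | ε * n ≤ |chanOut (C n) σ x ⬝ᵥ
      (resid (B n) ω *ᵥ chanOut (C n) σ x)
      - n * avg (fun ν => (‖κ ν‖ ^ 2 + σ ^ 2) / (1 + ω * ‖β ν‖ ^ 2))|}) atTop (𝓝 0) := by
  simp only [chanOut, ← smul_one_mulVec]
  refine pair_tendsto (N := fun n => resid (B n) ω) (fun n => resid_isSymm _ _) ?_ hε
  exact ((hasSymbol_resid hB hω).mul_real ((hasSymbol_mul_transpose hC).add_real
    (hasSymbol_smul_one_sq σ))).congr_symbol fun ν => by push_cast; ring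

theorem log_laplace {n : ℕ} (B : Matrix (Fin n) (Fin n) ℝ) (ω : ℝ) (y : Fin n → ℝ) (a : ℝ) :
    Real.exp a * laplace B ω y = Real.exp (a - 1 / 2 * Real.log (gram B ω).det
      - ω / 2 * (y ⬝ᵥ (resid B ω *ᵥ y))) := by
  rw [laplace, ← Real.exp_add]
  congr 1
  ring

/-- The Chernoff bound on the pairwise error probability. -/
theorem pairErr_upper (hB : HasSymbol (fun n => cplx (B n)) β)
    (hC : HasSymbol (fun n => cplx (C n)) κ) (σ : ℝ) {ω : ℝ} (hω : 0 ≤ ω) {ε : ℝ} (hε : 0 < ε) :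
    Tendsto (fun n : ℕ => pairLaw n {x | ¬ pairErr (B n) (C n) σ x
      ≤ ENNReal.ofReal (Real.exp (-(n * (rateFn β κ σ ω - ε))))}) atTop (𝓝 0) := by
  -- The two quadratic forms each contribute an error `ω δ / 2` to the exponent and the
  -- log-determinant contributes `δ / 2`, in total at most `(ω + 1) δ = ε`.
  set δ := ε / (ω + 1) with hδ
  have hδ0 : 0 < δ := by positivity
  have h1 := trueDist_tendsto hB hC σ hδ0
  have h2 := residForm_tendsto hB hC σ hω hδ0
  have h3 := log_det_gram_tendsto hB hω
  have hsum := h1.add h2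
  rw [add_zero] at hsum
  refine tendsto_of_tendsto_of_tendsto_of_le_of_le' tendsto_const_nhds hsum
    (Eventually.of_forall fun _ => zero_le) ?_
  filter_upwards [eventually_gt_atTop 0, h3.eventually (Metric.ball_mem_nhds _ hδ0)] with n hn hd
  have hn' : (0 : ℝ) < n := by exact_mod_cast hn
  refine (measure_mono fun x hx => ?_).trans (measure_union_le _ _)
  by_contra hcon
  simp only [Set.mem_union, Set.mem_ofPred_eq, not_or, not_le] at hcon
  refine hx ((closeProb_le hω _ _).trans (ENNReal.ofReal_le_ofReal ?_))
  rw [log_laplace, Real.exp_le_exp]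
  have hd1 := (abs_lt.1 (by simpa [Real.dist_eq] using hd)).1
  have hd2 : n * (avg fun ν => Real.log (1 + ω * ‖β ν‖ ^ 2)) - δ * n
      < Real.log (gram (B n) ω).det := by
    rw [lt_sub_iff_add_lt, lt_div_iff₀ hn'] at hd1
    linarith
  have hT := (abs_lt.1 hcon.1).2
  have hE := (abs_lt.1 hcon.2).1
  have hεδ : ε = δ * (ω + 1) := by rw [hδ]; field_simp
  rw [hεδ, rateFn]
  rw [trueDist] at hT
  have hT' := mul_le_mul_of_nonneg_left hT.le (div_nonneg hω zero_le_two)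
  have hE' := mul_le_mul_of_nonneg_left hE.le (div_nonneg hω zero_le_two)
  have : 0 ≤ δ * n := by positivity
  linarith

/-- The tilted distance is a quadratic form in the true innovations, the noise and the tilted
competitor. The factor `S n` is arbitrary and need not have a symbol: only `S⁻¹ S⁻ᵀ = (gram B ω)⁻¹`
enters the covariance. -/
theorem tilted_tendsto (hB : HasSymbol (fun n => cplx (B n)) β)
    (hC : HasSymbol (fun n => cplx (C n)) κ) (σ : ℝ) {ω : ℝ} (hω : 0 ≤ ω)
    {S : ∀ n, Matrix (Fin n) (Fin n) ℝ} (hS : ∀ n, (S n)ᵀ * S n = gram (B n) ω)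
    {ε : ℝ} (hε : 0 < ε) :
    Tendsto (fun n : ℕ => tri n {x | ε * n ≤ |triForm 1 (resid (B n) ω * C n)
      (resid (B n) ω * (σ • (1 : Matrix (Fin n) (Fin n) ℝ))) (-(B n * (S n)⁻¹)) x
      - n * slopeFn β κ σ ω|}) atTop (𝓝 0) := by
  refine tri_tendsto (N := fun _ => 1) (fun n => Matrix.isSymm_one) ?_ hε
  have hR := hasSymbol_resid hB hω
  have hRt := hR.transpose_real
  have h1 := (hR.mul_real (((hasSymbol_mul_transpose hC).add_real
    (hasSymbol_smul_one_sq σ)))).mul_real hRt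
  have h2 := (hB.mul_real (hasSymbol_gram_inv hB hω)).mul_real hB.transpose_real
  have e : ∀ n, (1 : Matrix (Fin n) (Fin n) ℝ) * (resid (B n) ω * C n * (resid (B n) ω * C n)ᵀ
      + (resid (B n) ω * (σ • (1 : Matrix (Fin n) (Fin n) ℝ))
        * (resid (B n) ω * (σ • (1 : Matrix (Fin n) (Fin n) ℝ)))ᵀ
        + -(B n * (S n)⁻¹) * (-(B n * (S n)⁻¹))ᵀ))
      = resid (B n) ω * (C n * (C n)ᵀ + (σ • (1 : Matrix (Fin n) (Fin n) ℝ))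
        * (σ • (1 : Matrix (Fin n) (Fin n) ℝ))ᵀ) * (resid (B n) ω)ᵀ
        + B n * (gram (B n) ω)⁻¹ * (B n)ᵀ := by
    intro n
    have hinv : (gram (B n) ω)⁻¹ = (S n)⁻¹ * ((S n)⁻¹)ᵀ := by
      rw [← hS, Matrix.mul_inv_rev, Matrix.transpose_nonsing_inv]
    rw [hinv]
    simp only [Matrix.transpose_mul, Matrix.transpose_neg, Matrix.neg_mul, Matrix.mul_neg, neg_neg,
      Matrix.one_mul, Matrix.mul_add, Matrix.add_mul, Matrix.mul_assoc, add_assoc]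
  simp only [e]
  refine (h1.add_real h2).congr_symbol fun ν => ?_
  have h1 : β ν * ((1 + ω * ‖β ν‖ ^ 2 : ℝ) : ℂ)⁻¹ * conj (β ν)
      = (‖β ν‖ : ℂ) ^ 2 * ((1 + ω * ‖β ν‖ ^ 2 : ℝ) : ℂ)⁻¹ := by
    rw [← Complex.mul_conj']; ring
  rw [h1, ← Complex.ofReal_inv, Complex.conj_ofReal]
  generalize 1 + ω * ‖β ν‖ ^ 2 = a
  push_cast
  ring

/-- The matching lower bound on the pairwise error probability. -/
theorem pairErr_lower (hB : HasSymbol (fun n => cplx (B n)) β)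
    (hC : HasSymbol (fun n => cplx (C n)) κ) (σ : ℝ) {ω : ℝ} (hω : 0 ≤ ω)
    (hsl : slopeFn β κ σ ω < trueDist β κ σ) {ε : ℝ} (hε : 0 < ε) :
    Tendsto (fun n : ℕ => pairLaw n {x | ¬ ENNReal.ofReal (Real.exp (-(n * (rateFn β κ σ ω
      + ω / 2 * (trueDist β κ σ - slopeFn β κ σ ω) + ε)))) ≤ pairErr (B n) (C n) σ x})
      atTop (𝓝 0) := by
  choose S hS using fun n => exists_transpose_mul_self_eq (posDef_gram (B n) hω)
  set d := slopeFn β κ σ ω with hd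
  set τ := trueDist β κ σ with hτ
  -- The first bound gives `d + δ ≤ τ - δ`, so a typical tilted distance lies below the distance of
  -- the true word. The second keeps the fluctuation errors within `ε / 2`; the other `ε / 2` pays
  -- for a factor `1 / 2` in probability.
  set δ := min ((τ - d) / 2) (ε / 2 / (ω + 1)) with hδ
  have hδ0 : 0 < δ := lt_min (by linarith) (by positivity)
  have hδ1 : δ ≤ (τ - d) / 2 := min_le_left _ _
  have hδ2 : δ * (ω + 1) ≤ ε / 2 := (le_div_iff₀ (by positivity)).1 (min_le_right _ _)
  have hlog := log_det_gram_tendsto hB hω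
  have h1 := trueDist_tendsto hB hC σ hδ0
  have h2 := residForm_tendsto hB hC σ hω hδ0
  have h3 := tilted_tendsto hB hC σ hω hS hδ0
  have hsum := (h1.add h2).add (ENNReal.Tendsto.const_mul h3 (a := 2) (Or.inr (by simp)))
  simp only [mul_zero, add_zero] at hsum
  refine tendsto_of_tendsto_of_tendsto_of_le_of_le' tendsto_const_nhds hsum
    (Eventually.of_forall fun _ => zero_le) ?_
  have hlarge : ∀ᶠ n : ℕ in atTop, Real.log 2 ≤ n * (ε / 2) := by
    filter_upwards [eventually_ge_atTop ⌈Real.log 2 / (ε / 2)⌉₊] with n hn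
    exact (div_le_iff₀ (by positivity)).1 (Nat.ceil_le.1 hn)
  filter_upwards [eventually_gt_atTop 0, hlog.eventually (Metric.ball_mem_nhds _ hδ0), hlarge]
    with n hn hball hn2
  have hn' : (0 : ℝ) < n := by exact_mod_cast hn
  set V := {x | δ * n ≤ |triForm 1 (resid (B n) ω * C n)
      (resid (B n) ω * (σ • (1 : Matrix (Fin n) (Fin n) ℝ))) (-(B n * (S n)⁻¹)) x - n * d|} with hV
  have hVm : MeasurableSet V := measurableSet_le measurable_const
    ((continuous_triForm _ _ _ _).sub continuous_const).abs.measurable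
  have hVm' : MeasurableSet ((MeasurableEquiv.prodAssoc (α := Fin n → ℝ) (β := Fin n → ℝ)
      (γ := Fin n → ℝ)) ⁻¹' V) := MeasurableEquiv.prodAssoc.measurable hVm
  set f : (Fin n → ℝ) × (Fin n → ℝ) → ℝ≥0∞ := fun x => stdG (Fin n) {u | (x.1, x.2, u) ∈ V} with hf
  have hfm : Measurable f := measurable_measure_prodMk_left hVm'
  have hfint : ∫⁻ x, f x ∂(pairLaw n) = tri n V := by
    rw [← (measurePreserving_pair_assoc n).measure_preimage hVm.nullMeasurableSet,
      Measure.prod_apply hVm']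
    rfl
  -- Concentration holds jointly in the three vectors. Markov's inequality turns it into a statement
  -- for most `(z, w)`: the conditional probability of an atypical tilted competitor is below `1 /
  -- 2`.
  have hmarkov : pairLaw n {x | 2⁻¹ ≤ f x} ≤ 2 * tri n V := by
    rw [← hfint]
    have := mul_meas_ge_le_lintegral (μ := pairLaw n) hfm 2⁻¹
    calc _ = 2 * (2⁻¹ * pairLaw n {x | 2⁻¹ ≤ f x}) := by
          rw [← mul_assoc, ENNReal.mul_inv_cancel (by simp) (by simp), one_mul]
      _ ≤ _ := by gcongr
  refine le_trans (measure_mono fun x hx => ?_) ((measure_union_le _ _).trans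
    (add_le_add (measure_union_le _ _) hmarkov))
  by_contra hcon
  simp only [Set.mem_union, Set.mem_ofPred_eq, not_or, not_le] at hcon
  obtain ⟨⟨hT, hE⟩, hfx⟩ := hcon
  refine hx ?_
  have hy : ∀ u, (resid (B n) ω *ᵥ chanOut (C n) σ x - (B n * (S n)⁻¹) *ᵥ u) ⬝ᵥ
      (resid (B n) ω *ᵥ chanOut (C n) σ x - (B n * (S n)⁻¹) *ᵥ u)
      = triForm 1 (resid (B n) ω * C n) (resid (B n) ω * (σ • (1 : Matrix (Fin n) (Fin n) ℝ)))
        (-(B n * (S n)⁻¹)) (x.1, x.2, u) := by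
    intro u
    have e : resid (B n) ω *ᵥ chanOut (C n) σ x - (B n * (S n)⁻¹) *ᵥ u
        = (resid (B n) ω * C n) *ᵥ x.1
          + ((resid (B n) ω * (σ • (1 : Matrix (Fin n) (Fin n) ℝ))) *ᵥ x.2
            + (-(B n * (S n)⁻¹)) *ᵥ u) := by
      rw [chanOut, Matrix.mulVec_add, Matrix.mulVec_mulVec, ← Matrix.mulVec_mulVec x.2,
        smul_one_mulVec, Matrix.neg_mulVec]
      abel
    rw [triForm, e, Matrix.one_mulVec]
  have hT1 := (abs_lt.1 hT).1
  set T := dist2 (B n) (chanOut (C n) σ x) x.1 with hTdef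
  have hgood : 2⁻¹ ≤ stdG (Fin n) {u | (resid (B n) ω *ᵥ chanOut (C n) σ x
      - (B n * (S n)⁻¹) *ᵥ u) ⬝ᵥ (resid (B n) ω *ᵥ chanOut (C n) σ x
      - (B n * (S n)⁻¹) *ᵥ u) ∈ Icc (n * (d - δ)) T} := by
    have hsub : {u | (x.1, x.2, u) ∈ V}ᶜ ⊆ {u | (resid (B n) ω *ᵥ chanOut (C n) σ x
        - (B n * (S n)⁻¹) *ᵥ u) ⬝ᵥ (resid (B n) ω *ᵥ chanOut (C n) σ x
        - (B n * (S n)⁻¹) *ᵥ u) ∈ Icc (n * (d - δ)) T} := by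
      intro u hu
      have hu' : ¬ (x.1, x.2, u) ∈ V := hu
      simp only [hV, Set.mem_ofPred_eq, not_le] at hu'
      simp only [Set.mem_ofPred_eq, hy, Set.mem_Icc]
      have ha := abs_lt.1 hu'
      have hτd : n * (d + δ) ≤ n * (τ - δ) := by gcongr; linarith
      constructor
      · linarith [ha.1]
      · linarith [ha.2]
    refine le_trans ?_ (measure_mono hsub)
    have hm : MeasurableSet {u | (x.1, x.2, u) ∈ V} :=
      (measurable_const.prodMk (measurable_const.prodMk measurable_id)) hVm
    rw [prob_compl_eq_one_sub hm]
    refine ENNReal.le_sub_of_add_le_left (measure_ne_top _ _) ?_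
    calc stdG (Fin n) {u | (x.1, x.2, u) ∈ V} + 2⁻¹ ≤ 2⁻¹ + 2⁻¹ := by gcongr
      _ = 1 := ENNReal.inv_two_add_inv_two
  refine le_trans ?_ (le_closeProb hω (chanOut (C n) σ x) (hS n) (n * (d - δ)) T)
  refine le_trans ?_ (mul_le_mul_right hgood _)
  have h2 : (2⁻¹ : ℝ≥0∞) = ENNReal.ofReal (Real.exp (-Real.log 2)) := by
    rw [Real.exp_neg, Real.exp_log two_pos, ENNReal.ofReal_inv_of_pos two_pos]
    simp
  rw [h2, log_laplace, ← ENNReal.ofReal_mul (Real.exp_pos _).le, ← Real.exp_add]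
  refine ENNReal.ofReal_le_ofReal (Real.exp_le_exp.2 ?_)
  have hd1 := (abs_lt.1 (by simpa [Real.dist_eq] using hball)).2
  have hd2 : Real.log (gram (B n) ω).det
      < n * (avg fun ν => Real.log (1 + ω * ‖β ν‖ ^ 2)) + δ * n := by
    rw [sub_lt_iff_lt_add, div_lt_iff₀ hn'] at hd1
    linarith
  have hE' := mul_le_mul_of_nonneg_left (abs_lt.1 hE).2.le (div_nonneg hω zero_le_two)
  have hδ3 := mul_le_mul_of_nonneg_left hδ2 hn'.le
  have hr : rateFn β κ σ ω = 1 / 2 * avg (fun ν => Real.log (1 + ω * ‖β ν‖ ^ 2))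
    + ω / 2 * avg (fun ν => (‖κ ν‖ ^ 2 + σ ^ 2) / (1 + ω * ‖β ν‖ ^ 2))
    - ω / 2 * τ := rfl
  rw [hr]
  have : 0 ≤ δ * n := by positivity
  linarith

/-! ### The ensemble average of the error probability -/

/-- The probability that at least one of `m` independent competitors hits, integrated over the
transmitted word and the noise. -/
theorem lintegral_exists_hit {Ω Ω' : Type*} [MeasurableSpace Ω] [MeasurableSpace Ω']
    (μ : Measure Ω) (ν : Measure Ω') [IsProbabilityMeasure μ] [IsProbabilityMeasure ν] {m : ℕ}
    (i : Fin (m + 1)) {H : Set ((Ω × Ω') × Ω)} (hH : MeasurableSet H) :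
    ∫⁻ z : Fin (m + 1) → Ω, ν {w | ∃ j, j ≠ i ∧ ((z i, w), z j) ∈ H} ∂(Measure.pi fun _ => μ)
      = ∫⁻ x, 1 - (1 - μ {a | (x, a) ∈ H}) ^ m ∂(μ.prod ν) := by
  have hE : MeasurableSet {y : (Ω × (Fin m → Ω)) × Ω' | ∃ j, ((y.1.1, y.2), y.1.2 j) ∈ H} := by
    have : {y : (Ω × (Fin m → Ω)) × Ω' | ∃ j, ((y.1.1, y.2), y.1.2 j) ∈ H}
        = ⋃ j, (fun y : (Ω × (Fin m → Ω)) × Ω' => ((y.1.1, y.2), y.1.2 j)) ⁻¹' H := by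
      ext y; simp
    rw [this]
    exact MeasurableSet.iUnion fun j => (by fun_prop : Measurable fun y :
      (Ω × (Fin m → Ω)) × Ω' => ((y.1.1, y.2), y.1.2 j)) hH
  have hE' : MeasurableSet {y : (Ω × Ω') × (Fin m → Ω) | ∃ j, (y.1, y.2 j) ∈ H} := by
    have : {y : (Ω × Ω') × (Fin m → Ω) | ∃ j, (y.1, y.2 j) ∈ H}
        = ⋃ j, (fun y : (Ω × Ω') × (Fin m → Ω) => (y.1, y.2 j)) ⁻¹' H := by
      ext y; simp
    rw [this]
    exact MeasurableSet.iUnion fun j => (by fun_prop : Measurable fun y :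
      (Ω × Ω') × (Fin m → Ω) => (y.1, y.2 j)) hH
  have hF : Measurable fun y : Ω × (Fin m → Ω) => ν {w | ∃ j, ((y.1, w), y.2 j) ∈ H} :=
    measurable_measure_prodMk_left hE
  have hF' : Measurable fun x : Ω × Ω' =>
      (Measure.pi fun _ : Fin m => μ) {r | ∃ j, (x, r j) ∈ H} :=
    measurable_measure_prodMk_left hE'
  -- Separate the transmitted coordinate `i` from its `m` competitors.
  have hmp := measurePreserving_piFinSuccAbove (fun _ : Fin (m + 1) => μ) i
  have h1 : ∫⁻ z : Fin (m + 1) → Ω, ν {w | ∃ j, j ≠ i ∧ ((z i, w), z j) ∈ H}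
      ∂(Measure.pi fun _ => μ)
      = ∫⁻ y, ν {w | ∃ j, ((y.1, w), y.2 j) ∈ H} ∂(μ.prod (Measure.pi fun _ : Fin m => μ)) := by
    rw [← hmp.lintegral_comp hF]
    refine lintegral_congr fun z => ?_
    congr 1
    ext w
    simp only [Set.mem_ofPred_eq]
    constructor
    · rintro ⟨j, hj, hw⟩
      obtain ⟨k, rfl⟩ := Fin.exists_succAbove_eq hj
      exact ⟨k, hw⟩
    · rintro ⟨k, hw⟩
      exact ⟨i.succAbove k, Fin.succAbove_ne i k, hw⟩
  -- With the transmitted word fixed, Tonelli's theorem exchanges noise and competitors; the latter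
  -- are then conditionally independent.
  have h2 : ∫⁻ y, ν {w | ∃ j, ((y.1, w), y.2 j) ∈ H} ∂(μ.prod (Measure.pi fun _ : Fin m => μ))
      = ∫⁻ x, (Measure.pi fun _ : Fin m => μ) {r | ∃ j, (x, r j) ∈ H} ∂(μ.prod ν) := by
    rw [lintegral_prod _ hF.aemeasurable, lintegral_prod _ hF'.aemeasurable]
    refine lintegral_congr fun a => ?_
    have hEa : MeasurableSet {y : (Fin m → Ω) × Ω' | ∃ j, ((a, y.2), y.1 j) ∈ H} :=
      (by fun_prop : Measurable fun y : (Fin m → Ω) × Ω' => ((a, y.1), y.2)) hE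
    exact (Measure.prod_apply hEa).symm.trans (Measure.prod_apply_symm hEa)
  rw [h1, h2]
  refine lintegral_congr fun x => ?_
  have hHx : MeasurableSet {a | (x, a) ∈ H} := measurable_prodMk_left hH
  have hc : {r : Fin m → Ω | ∃ j, (x, r j) ∈ H} = (Set.univ.pi fun _ => {a | (x, a) ∈ H}ᶜ)ᶜ := by
    ext r
    simp only [Set.mem_compl_iff, Set.mem_univ_pi, not_forall, not_not]
    rfl
  rw [hc, prob_compl_eq_one_sub (MeasurableSet.univ_pi fun _ => hHx.compl), Measure.pi_pi]
  simp [prob_compl_eq_one_sub hHx]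

/-! ### Reduction of the coding problem to Gaussian vectors and matrices -/

/-- The matrix that turns innovations into codewords. -/
def wordMat {p : ℕ} (P : ℝ) (φ : Fin p → ℝ) (n : ℕ) : Matrix (Fin n) (Fin n) ℝ :=
  Real.sqrt (innovVar P φ) • (arMat φ n)⁻¹

/-- The matrix that turns innovations into filtered codewords. -/
def filtMat {K p : ℕ} (a : Fin (K + 1) → ℝ) (P : ℝ) (φ : Fin p → ℝ) (n : ℕ) :
    Matrix (Fin n) (Fin n) ℝ := tapMat a n * wordMat P φ n

theorem filt_arWord {K p n : ℕ} (a : Fin (K + 1) → ℝ) (P : ℝ) (φ : Fin p → ℝ) (z : Fin n → ℝ) :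
    filt a (arWord P φ z) = filtMat a P φ n *ᵥ z := by
  rw [filt_eq_mulVec, arWord_eq, filtMat, wordMat, Matrix.mulVec_mulVec]

theorem noise_eq_map (n : ℕ) (σ : ℝ) : noise n σ = (stdG (Fin n)).map fun w => σ • w := by
  have h := Measure.pi_map_pi (μ := fun _ : Fin n => gaussianReal 0 1)
    (f := fun (_ : Fin n) (x : ℝ) => σ * x) fun _ => (measurable_const_mul σ).aemeasurable
  rw [noise, stdG]
  have e : (fun w : Fin n → ℝ => σ • w) = fun w i => σ * w i := by ext; simp
  rw [e, h]
  congr 1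
  ext1 i
  rw [gaussianReal_map_const_mul]
  congr 1
  · simp
  · ext; simp [sq_nonneg]

variable {K p : ℕ} (h α : Fin (K + 1) → ℝ) (P : ℝ) {σ : ℝ} (φ : Fin p → ℝ)

theorem logMetric_le_iff (hσ : 0 < σ) {n : ℕ} (y z z' : Fin n → ℝ) :
    logMetric α σ y (arWord P φ z) ≤ logMetric α σ y (arWord P φ z')
      ↔ dist2 (filtMat α P φ n) y z' ≤ dist2 (filtMat α P φ n) y z := by
  have e : ∀ v, ∑ t, (y t - filt α (arWord P φ v) t) ^ 2 = dist2 (filtMat α P φ n) y v := by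
    intro v
    rw [filt_arWord, dist2, dotProduct]
    exact Finset.sum_congr rfl fun t _ => by simp [sq]
  unfold logMetric
  rw [e, e]
  have : 0 < 1 / (2 * σ ^ 2) := by positivity
  constructor
  · intro h
    exact le_of_mul_le_mul_left (by linarith) this
  · intro h
    have := mul_le_mul_of_nonneg_left h this.le
    linarith

theorem output_arWord {n : ℕ} (z w : Fin n → ℝ) :
    output h (arWord P φ z) (σ • w) = chanOut (filtMat h P φ n) σ (z, w) := by
  ext t
  rw [output, filt_arWord]
  rfl

/-- The event that the word `x.2` beats the transmitted word. -/
def hitSet {n : ℕ} (B C : Matrix (Fin n) (Fin n) ℝ) (σ : ℝ) :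
    Set (((Fin n → ℝ) × (Fin n → ℝ)) × (Fin n → ℝ)) :=
  {x | dist2 B (chanOut C σ x.1) x.2 ≤ dist2 B (chanOut C σ x.1) x.1.1}

theorem continuous_chanOut {n : ℕ} (C : Matrix (Fin n) (Fin n) ℝ) (σ : ℝ) :
    Continuous (chanOut C σ) :=
  ((continuous_mulVec C).comp continuous_fst).add (continuous_snd.const_smul σ)

theorem measurableSet_hitSet {n : ℕ} (B C : Matrix (Fin n) (Fin n) ℝ) (σ : ℝ) :
    MeasurableSet (hitSet B C σ) := by
  have hc := (continuous_chanOut C σ).comp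
    (continuous_fst (X := (Fin n → ℝ) × (Fin n → ℝ)) (Y := Fin n → ℝ))
  exact measurableSet_le ((continuous_dist2 B).comp (hc.prodMk continuous_snd)).measurable
    ((continuous_dist2 B).comp (hc.prodMk (continuous_fst.comp continuous_fst))).measurable

theorem noise_errorEvent (hσ : 0 < σ) {n M : ℕ} (z : Fin M → Fin n → ℝ) (i : Fin M) :
    noise n σ (errorEvent h α σ (fun i => arWord P φ (z i)) i)
      = stdG (Fin n) {w | ∃ j, j ≠ i ∧
        ((z i, w), z j) ∈ hitSet (filtMat α P φ n) (filtMat h P φ n) σ} := by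
  -- Scaling by `σ ≠ 0` is a measurable equivalence, so the image measure can be evaluated without
  -- first proving the error event measurable.
  let e : (Fin n → ℝ) ≃ᵐ (Fin n → ℝ) :=
    MeasurableEquiv.smul₀ σ hσ.ne'
  have he : (fun w : Fin n → ℝ => σ • w) = e := rfl
  rw [noise_eq_map, he, e.map_apply]
  congr 1
  ext w
  simp only [errorEvent, Set.mem_preimage, Set.mem_ofPred_eq, hitSet]
  have : e w = σ • w := rfl
  simp only [this, output_arWord, logMetric_le_iff α P φ hσ]

/-- By exchangeability every message has the same mean error, which cancels the average over
messages. The exponent counts the competitors, one fewer than the codewords. -/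
theorem avgErrorProb_eq (hσ : 0 < σ) (R : ℝ) (n : ℕ) :
    avgErrorProb h α P σ φ R n = ∫⁻ x, 1 - (1 - pairErr (filtMat α P φ n) (filtMat h P φ n) σ x)
      ^ (⌈Real.exp (n * R)⌉₊ - 1) ∂(pairLaw n) := by
  unfold avgErrorProb
  obtain ⟨m, hm⟩ : ∃ m, ⌈Real.exp (n * R)⌉₊ = m + 1 :=
    Nat.exists_eq_succ_of_ne_zero (Nat.ceil_pos.2 (Real.exp_pos _)).ne'
  rw [hm, noise_one]
  have hH := measurableSet_hitSet (filtMat α P φ n) (filtMat h P φ n) σ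
  have hmeas : ∀ i : Fin (m + 1), Measurable fun z : Fin (m + 1) → Fin n → ℝ =>
      stdG (Fin n) {w | ∃ j, j ≠ i ∧
        ((z i, w), z j) ∈ hitSet (filtMat α P φ n) (filtMat h P φ n) σ} := by
    intro i
    have hE : MeasurableSet {y : (Fin (m + 1) → Fin n → ℝ) × (Fin n → ℝ) | ∃ j, j ≠ i ∧
        ((y.1 i, y.2), y.1 j) ∈ hitSet (filtMat α P φ n) (filtMat h P φ n) σ} := by
      have : {y : (Fin (m + 1) → Fin n → ℝ) × (Fin n → ℝ) | ∃ j, j ≠ i ∧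
          ((y.1 i, y.2), y.1 j) ∈ hitSet (filtMat α P φ n) (filtMat h P φ n) σ}
          = ⋃ j, ⋃ _ : j ≠ i, (fun y : (Fin (m + 1) → Fin n → ℝ) × (Fin n → ℝ) =>
            ((y.1 i, y.2), y.1 j)) ⁻¹' hitSet (filtMat α P φ n) (filtMat h P φ n) σ := by
        ext y; simp
      rw [this]
      exact MeasurableSet.iUnion fun j => MeasurableSet.iUnion fun _ =>
        (by fun_prop : Measurable fun y : (Fin (m + 1) → Fin n → ℝ) × (Fin n → ℝ) =>
          ((y.1 i, y.2), y.1 j)) hH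
    exact measurable_measure_prodMk_left hE
  simp only [errorProb, noise_errorEvent h α P φ hσ]
  rw [lintegral_const_mul _ (Finset.measurable_sum _ fun i _ => hmeas i),
    lintegral_finsetSum _ fun i _ => hmeas i,
    Finset.sum_congr rfl fun i _ => lintegral_exists_hit (stdG (Fin n)) (stdG (Fin n)) i hH,
    Finset.sum_const, Finset.card_univ, Fintype.card_fin, nsmul_eq_mul, ← mul_assoc,
    ENNReal.inv_mul_cancel (by simp) (by simp), one_mul, Nat.add_sub_cancel]
  rfl

/-! ### Exponential rates of the ensemble error probability -/

theorem one_sub_pow_le_mul {q : ℝ≥0∞} (m : ℕ) : 1 - (1 - q) ^ m ≤ m * q := by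
  rw [tsub_le_iff_left]
  induction m with
  | zero => simp
  | succ m ih =>
    -- Subtraction is truncated: `(1 - q) + q = 1` requires `q ≤ 1`, and the other case is trivial.
    rcases le_total 1 q with hq | hq
    · refine le_add_left (le_trans hq ?_)
      exact le_mul_of_one_le_left zero_le (by simp)
    have h1 : (1 - q) + q = 1 := tsub_add_cancel_of_le hq
    have hp : (1 - q) ^ m ≤ 1 := pow_le_one₀ zero_le tsub_le_self
    calc (1 : ℝ≥0∞) ≤ (1 - q) ^ m + m * q := ih
      _ = (1 - q) ^ m * ((1 - q) + q) + m * q := by rw [h1, mul_one]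
      _ = (1 - q) ^ (m + 1) + ((1 - q) ^ m * q + m * q) := by rw [pow_succ]; ring
      _ ≤ (1 - q) ^ (m + 1) + (1 * q + m * q) := by gcongr
      _ = _ := by push_cast; ring

/-- From `1 - t ≤ exp (-t)`: once the expected number of hits reaches `1`, the probability of a hit
is at least `1 - 1/e`. -/
theorem one_sub_pow_ge {t : ℝ} (ht : 0 ≤ t) {q : ℝ≥0∞} (hq : ENNReal.ofReal t ≤ q) {m : ℕ}
    (hm : 1 ≤ m * t) : ENNReal.ofReal (1 - Real.exp (-1)) ≤ 1 - (1 - q) ^ m := by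
  rw [ENNReal.ofReal_sub _ (Real.exp_pos _).le, ENNReal.ofReal_one]
  refine tsub_le_tsub_left ?_ 1
  calc (1 - q) ^ m ≤ (1 - ENNReal.ofReal t) ^ m := by gcongr
    _ = ENNReal.ofReal (1 - t) ^ m := by rw [ENNReal.ofReal_sub _ ht, ENNReal.ofReal_one]
    _ ≤ ENNReal.ofReal (Real.exp (-t)) ^ m := by
      gcongr
      have := Real.add_one_le_exp (-t)
      linarith
    _ = ENNReal.ofReal (Real.exp (-(m * t))) := by
      rw [← ENNReal.ofReal_pow (Real.exp_pos _).le, ← Real.exp_nat_mul]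
      congr 2
      ring
    _ ≤ _ := by gcongr

variable {B C : ∀ n, Matrix (Fin n) (Fin n) ℝ} {β κ : ℝ → ℂ}

/-- Union bound on the typical set: about `e^{nR}` competitors, each hitting with probability at
most `e^{-n(rateFn - ε)}`. -/
theorem ensembleErr_tendsto (hB : HasSymbol (fun n => cplx (B n)) β)
    (hC : HasSymbol (fun n => cplx (C n)) κ) (σ : ℝ) {ω : ℝ} (hω : 0 ≤ ω) {R : ℝ}
    (hR : R < rateFn β κ σ ω) :
    Tendsto (fun n : ℕ => ∫⁻ x, 1 - (1 - pairErr (B n) (C n) σ x) ^ (⌈Real.exp (n * R)⌉₊ - 1)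
      ∂(pairLaw n)) atTop (𝓝 0) := by
  set ε := (rateFn β κ σ ω - R) / 2 with hε
  have hε0 : 0 < ε := by rw [hε]; linarith
  have h1 := pairErr_upper hB hC σ hω hε0
  have h2 : Tendsto (fun n : ℕ => ENNReal.ofReal (Real.exp (-(n * ε)))) atTop (𝓝 0) := by
    rw [← ENNReal.ofReal_zero]
    refine (ENNReal.continuous_ofReal.tendsto 0).comp (Real.tendsto_exp_neg_atTop_nhds_zero.comp ?_)
    exact tendsto_natCast_atTop_atTop.atTop_mul_const hε0
  have hsum := h1.add h2
  rw [add_zero] at hsum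
  refine tendsto_of_tendsto_of_tendsto_of_le_of_le tendsto_const_nhds hsum
    (fun _ => zero_le) fun n => ?_
  set m := ⌈Real.exp (n * R)⌉₊ - 1 with hm
  set t := ENNReal.ofReal (Real.exp (-(n * (rateFn β κ σ ω - ε)))) with ht
  set V := {x | ¬ pairErr (B n) (C n) σ x ≤ t} with hV
  have hmR : (m : ℝ) ≤ Real.exp (n * R) := by
    have h3 := Nat.ceil_lt_add_one (Real.exp_pos (n * R)).le
    have h4 : 1 ≤ ⌈Real.exp (n * R)⌉₊ := Nat.ceil_pos.2 (Real.exp_pos _)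
    rw [hm, Nat.cast_sub h4, Nat.cast_one]
    linarith
  have hmt : (m : ℝ≥0∞) * t ≤ ENNReal.ofReal (Real.exp (-(n * ε))) := by
    rw [ht, ← ENNReal.ofReal_natCast m, ← ENNReal.ofReal_mul (by positivity)]
    refine ENNReal.ofReal_le_ofReal ?_
    calc (m : ℝ) * Real.exp (-(n * (rateFn β κ σ ω - ε)))
        ≤ Real.exp (n * R) * Real.exp (-(n * (rateFn β κ σ ω - ε))) := by gcongr
      _ = Real.exp (-(n * ε)) := by
        rw [← Real.exp_add]
        congr 1
        rw [hε]; ring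
  calc ∫⁻ x, 1 - (1 - pairErr (B n) (C n) σ x) ^ m ∂(pairLaw n)
      ≤ ∫⁻ x, V.indicator 1 x + ENNReal.ofReal (Real.exp (-(n * ε))) ∂(pairLaw n) := by
        refine lintegral_mono fun x => ?_
        by_cases hx : x ∈ V
        · rw [Set.indicator_of_mem hx]
          exact le_add_right tsub_le_self
        · rw [Set.indicator_of_notMem hx, zero_add]
          have hx' : pairErr (B n) (C n) σ x ≤ t := not_not.1 hx
          refine (one_sub_pow_le_mul m).trans (le_trans ?_ hmt)
          gcongr
    _ ≤ pairLaw n V + ENNReal.ofReal (Real.exp (-(n * ε))) := by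
        rw [lintegral_add_right _ measurable_const, lintegral_const, measure_univ, mul_one]
        gcongr
        exact lintegral_indicator_one_le _

theorem ensembleErr_not_tendsto (hB : HasSymbol (fun n => cplx (B n)) β)
    (hC : HasSymbol (fun n => cplx (C n)) κ) (σ : ℝ) {ω : ℝ} (hω : 0 ≤ ω)
    (hsl : slopeFn β κ σ ω < trueDist β κ σ) {R : ℝ} (hR0 : 0 < R)
    (hR : rateFn β κ σ ω + ω / 2 * (trueDist β κ σ - slopeFn β κ σ ω) < R) :
    ¬ Tendsto (fun n : ℕ => ∫⁻ x, 1 - (1 - pairErr (B n) (C n) σ x) ^ (⌈Real.exp (n * R)⌉₊ - 1)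
      ∂(pairLaw n)) atTop (𝓝 0) := by
  intro hlim
  set s := rateFn β κ σ ω + ω / 2 * (trueDist β κ σ - slopeFn β κ σ ω) with hs
  set ε := (R - s) / 2 with hε
  have hε0 : 0 < ε := by rw [hε]; linarith
  have h1 := pairErr_lower hB hC σ hω hsl hε0
  rw [← hs] at h1
  -- A nonnegative exponent ensures `e^{ns'} ≥ 1`, which absorbs the competitor lost in `⌈e^{nR}⌉ -
  -- 1`. It stays below `R` because `R > 0`.
  set s' := max (s + ε) 0 with hs'
  have hs'R : s' < R := max_lt (by rw [hε]; linarith) hR0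
  have hs'0 : 0 ≤ s' := le_max_right _ _
  set c := ENNReal.ofReal (1 - Real.exp (-1)) with hc
  have hc0 : 0 < c := by
    rw [hc, ENNReal.ofReal_pos, sub_pos, Real.exp_lt_one_iff]
    norm_num
  have hlarge : ∀ᶠ n : ℕ in atTop, Real.log 2 ≤ n * (R - s') := by
    filter_upwards [eventually_ge_atTop ⌈Real.log 2 / (R - s')⌉₊] with n hn
    exact (div_le_iff₀ (by linarith)).1 (Nat.ceil_le.1 hn)
  have hbad : ∀ᶠ n : ℕ in atTop, pairLaw n {x | ¬ ENNReal.ofReal (Real.exp (-(n * (s + ε))))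
      ≤ pairErr (B n) (C n) σ x} < 2⁻¹ := h1.eventually_lt_const (by simp)
  have hsmall : ∀ᶠ n : ℕ in atTop, ∫⁻ x, 1 - (1 - pairErr (B n) (C n) σ x)
      ^ (⌈Real.exp (n * R)⌉₊ - 1) ∂(pairLaw n) < c * 2⁻¹ :=
    hlim.eventually_lt_const (ENNReal.mul_pos hc0.ne' (by simp))
  obtain ⟨n, hn1, hn2, hn3⟩ := (hlarge.and (hbad.and hsmall)).exists
  refine absurd hn3 (not_lt.2 ?_)
  set m := ⌈Real.exp (n * R)⌉₊ - 1 with hm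
  have hmt : 1 ≤ (m : ℝ) * Real.exp (-(n * s')) := by
    have h4 : 1 ≤ ⌈Real.exp (n * R)⌉₊ := Nat.ceil_pos.2 (Real.exp_pos _)
    have h5 : Real.exp (n * R) - 1 ≤ m := by
      rw [hm, Nat.cast_sub h4, Nat.cast_one]
      linarith [Nat.le_ceil (Real.exp (n * R))]
    have h6 : 2 * Real.exp (n * s') ≤ Real.exp (n * R) := by
      have e : Real.exp (n * R) = Real.exp (n * (R - s')) * Real.exp (n * s') := by
        rw [← Real.exp_add]; congr 1; ring
      rw [e]
      gcongr
      rw [← Real.log_le_iff_le_exp two_pos]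
      exact hn1
    have h7 : 1 ≤ Real.exp (n * s') := Real.one_le_exp (by positivity)
    rw [Real.exp_neg, ← div_eq_mul_inv, one_le_div (Real.exp_pos _)]
    linarith
  have hsub : {x | ENNReal.ofReal (Real.exp (-(n * (s + ε)))) ≤ pairErr (B n) (C n) σ x}
      ⊆ {x | c ≤ 1 - (1 - pairErr (B n) (C n) σ x) ^ m} := by
    intro x hx
    refine one_sub_pow_ge (Real.exp_pos _).le (le_trans ?_ hx) hmt
    refine ENNReal.ofReal_le_ofReal (Real.exp_le_exp.2 ?_)
    have : s + ε ≤ s' := le_max_left _ _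
    have : (n : ℝ) * (s + ε) ≤ n * s' := by gcongr
    linarith
  set V := {x | ¬ ENNReal.ofReal (Real.exp (-(n * (s + ε)))) ≤ pairErr (B n) (C n) σ x} with hV
  have hmeasV : MeasurableSet V := by
    have hq : Measurable (pairErr (B n) (C n) σ) :=
      measurable_measure_prodMk_left (measurableSet_hitSet (B n) (C n) σ)
    exact (measurableSet_le measurable_const hq).compl
  have hgood : 2⁻¹ ≤ pairLaw n Vᶜ := by
    rw [prob_compl_eq_one_sub hmeasV]
    refine ENNReal.le_sub_of_add_le_left (measure_ne_top _ _) ?_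
    calc pairLaw n V + 2⁻¹ ≤ 2⁻¹ + 2⁻¹ := by gcongr
      _ = 1 := ENNReal.inv_two_add_inv_two
  calc c * 2⁻¹ ≤ c * pairLaw n Vᶜ := by gcongr
    _ = ∫⁻ x, Vᶜ.indicator (fun _ => c) x ∂(pairLaw n) :=
      (lintegral_indicator_const hmeasV.compl c).symm
    _ ≤ _ := by
      refine lintegral_mono fun x => Set.indicator_apply_le' (fun hx => ?_) fun _ => zero_le
      exact hsub (not_not.1 hx)

/-! ### Averages of continuous functions -/

theorem avg_add {f g : ℝ → ℝ} (hf : Continuous f) (hg : Continuous g) :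
    avg (fun ν => f ν + g ν) = avg f + avg g := by
  unfold avg
  rw [intervalIntegral.integral_add (hf.intervalIntegrable _ _) (hg.intervalIntegrable _ _),
    smul_add]

theorem avg_sub {f g : ℝ → ℝ} (hf : Continuous f) (hg : Continuous g) :
    avg (fun ν => f ν - g ν) = avg f - avg g := by
  unfold avg
  rw [intervalIntegral.integral_sub (hf.intervalIntegrable _ _) (hg.intervalIntegrable _ _),
    smul_sub]

theorem avg_const_mul (c : ℝ) (f : ℝ → ℝ) : avg (fun ν => c * f ν) = c * avg f := by
  unfold avg
  rw [intervalIntegral.integral_const_mul, smul_eq_mul, smul_eq_mul]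
  ring

theorem avg_const (c : ℝ) : avg (fun _ => c) = c := by
  unfold avg
  rw [intervalIntegral.integral_const, sub_zero, smul_smul, one_div,
    inv_mul_cancel₀ (by positivity), one_smul]

theorem avg_sum {ι : Type*} (s : Finset ι) {f : ι → ℝ → ℝ} (hf : ∀ i ∈ s, Continuous (f i)) :
    avg (fun ν => ∑ i ∈ s, f i ν) = ∑ i ∈ s, avg (f i) := by
  unfold avg
  rw [intervalIntegral.integral_finsetSum fun i hi => (hf i hi).intervalIntegrable _ _,
    Finset.smul_sum]

theorem avg_mono {f g : ℝ → ℝ} (hf : Continuous f) (hg : Continuous g) (h : ∀ ν, f ν ≤ g ν) :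
    avg f ≤ avg g := by
  unfold avg
  rw [smul_eq_mul, smul_eq_mul]
  gcongr
  exact intervalIntegral.integral_mono (by positivity) (hf.intervalIntegrable _ _)
    (hg.intervalIntegrable _ _) h

theorem avg_pos {f : ℝ → ℝ} (hf : Continuous f) (h : ∀ ν, 0 < f ν) : 0 < avg f := by
  unfold avg
  rw [smul_eq_mul]
  exact mul_pos (by positivity) (intervalIntegral.intervalIntegral_pos_of_pos
    (hf.intervalIntegrable _ _) h (by positivity))

theorem avg_re {f : ℝ → ℂ} (hf : Continuous f) : avg (fun ν => (f ν).re) = (avg f).re := by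
  unfold avg
  rw [Complex.smul_re]
  congr 1
  exact Complex.reCLM.intervalIntegral_comp_comm (hf.intervalIntegrable _ _)

/-! ### Spectra of autoregressions -/

theorem continuous_fourierTaps {K : ℕ} (a : Fin (K + 1) → ℝ) : Continuous (fourierTaps a) :=
  (hasSymbol_tapMat a).cont

theorem continuous_fourierAR {p : ℕ} (φ : Fin p → ℝ) : Continuous (fourierAR φ) := by
  unfold fourierAR
  fun_prop

section
variable {p : ℕ} {φ : Fin p → ℝ} {P : ℝ}

theorem norm_one_sub_pos (hφ : φ ∈ stable p) (ν : ℝ) : 0 < ‖1 - fourierAR φ ν‖ ^ 2 :=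
  pow_pos (norm_pos_iff.2 (one_sub_fourierAR_ne_zero hφ ν)) 2

theorem continuous_norm_one_sub (φ : Fin p → ℝ) :
    Continuous fun ν => ‖1 - fourierAR φ ν‖ ^ 2 :=
  ((continuous_const.sub (continuous_fourierAR φ)).norm).pow 2

theorem continuous_inv_norm (hφ : φ ∈ stable p) :
    Continuous fun ν => 1 / ‖1 - fourierAR φ ν‖ ^ 2 :=
  continuous_const.div (continuous_norm_one_sub φ) fun ν => (norm_one_sub_pos hφ ν).ne'

theorem innovVar_eq (P : ℝ) (φ : Fin p → ℝ) :
    innovVar P φ = P * (avg fun ν => 1 / ‖1 - fourierAR φ ν‖ ^ 2)⁻¹ := rfl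

theorem avg_inv_norm_pos (hφ : φ ∈ stable p) :
    0 < avg fun ν => 1 / ‖1 - fourierAR φ ν‖ ^ 2 :=
  avg_pos (continuous_inv_norm hφ) fun ν => one_div_pos.2 (norm_one_sub_pos hφ ν)

theorem innovVar_pos (hφ : φ ∈ stable p) (hP : 0 < P) : 0 < innovVar P φ := by
  rw [innovVar_eq]
  exact mul_pos hP (inv_pos.2 (avg_inv_norm_pos hφ))

theorem continuous_SX (hφ : φ ∈ stable p) : Continuous (SX P φ) :=
  continuous_const.div (continuous_norm_one_sub φ) fun ν => (norm_one_sub_pos hφ ν).ne'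

theorem SX_pos (hφ : φ ∈ stable p) (hP : 0 < P) (ν : ℝ) : 0 < SX P φ ν :=
  div_pos (innovVar_pos hφ hP) (norm_one_sub_pos hφ ν)

theorem avg_SX (hφ : φ ∈ stable p) : avg (SX P φ) = P := by
  have e : SX P φ = fun ν => innovVar P φ * (1 / ‖1 - fourierAR φ ν‖ ^ 2) := by
    ext ν; unfold SX; ring
  rw [e, avg_const_mul, innovVar_eq, mul_assoc, inv_mul_cancel₀ (avg_inv_norm_pos hφ).ne', mul_one]

/-- The symbol of the codeword process. -/
def wordSym (P : ℝ) (φ : Fin p → ℝ) (ν : ℝ) : ℂ :=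
  (Real.sqrt (innovVar P φ) : ℂ) * (1 - fourierAR φ ν)⁻¹

theorem norm_wordSym_sq (hφ : φ ∈ stable p) (hP : 0 < P) (ν : ℝ) :
    ‖wordSym P φ ν‖ ^ 2 = SX P φ ν := by
  rw [wordSym, norm_mul, mul_pow, norm_inv, inv_pow, Complex.norm_real, Real.norm_eq_abs, sq_abs,
    Real.sq_sqrt (innovVar_pos hφ hP).le, SX, div_eq_mul_inv]

theorem hasSymbol_wordMat (hφ : φ ∈ stable p) (P : ℝ) :
    HasSymbol (fun n => cplx (wordMat P φ n)) (wordSym P φ) :=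
  (hasSymbol_arMat_inv hφ).smul_real _

/-- The symbol of a filtered codeword. -/
def filtSym {K : ℕ} (a : Fin (K + 1) → ℝ) (P : ℝ) (φ : Fin p → ℝ) (ν : ℝ) : ℂ :=
  fourierTaps a ν * wordSym P φ ν

theorem hasSymbol_filtMat {K : ℕ} (a : Fin (K + 1) → ℝ) (hφ : φ ∈ stable p) (P : ℝ) :
    HasSymbol (fun n => cplx (filtMat a P φ n)) (filtSym a P φ) :=
  (hasSymbol_tapMat a).mul_real (hasSymbol_wordMat hφ P)

theorem continuous_filtSym {K : ℕ} (a : Fin (K + 1) → ℝ) (hφ : φ ∈ stable p) (P : ℝ) :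
    Continuous (filtSym a P φ) := (hasSymbol_filtMat a hφ P).cont

/-- A case of Jensen's formula, obtained from the determinant asymptotics: the whitening matrices
all have determinant `1`, so their log-determinants vanish identically. -/
theorem avg_log_norm_one_sub (hφ : φ ∈ stable p) :
    avg (fun ν => Real.log (‖1 - fourierAR φ ν‖ ^ 2)) = 0 := by
  have hu : ∀ n, IsUnit (arMat φ n).det := fun n => by simp [det_arMat]
  have hs : HasSymbol (fun n => cplx ((arMat φ n)ᵀ * arMat φ n))
      (fun ν => ((‖1 - fourierAR φ ν‖ ^ 2 : ℝ) : ℂ)) :=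
    ((hasSymbol_arMat φ).transpose_real.mul_real (hasSymbol_arMat φ)).congr_symbol fun ν => by
      rw [Complex.conj_mul']; push_cast; rfl
  obtain ⟨D, hD⟩ := norm_arMat_inv_le hφ
  have h := hs.log_det_tendsto (norm_one_sub_pos hφ) (fun n => by
    rw [map_mul, cplx_transpose]
    refine Matrix.PosDef.conjTranspose_mul_self _ ?_
    refine Matrix.mulVec_injective_iff_isUnit.2 ((Matrix.isUnit_iff_isUnit_det _).2 ?_)
    rw [cplx_det, det_arMat]
    simp) ⟨D * D, fun n => by
      have hdet : IsUnit ((arMat φ n)ᵀ * arMat φ n).det := by simp [det_arMat]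
      rw [← cplx_inv _ hdet, Matrix.mul_inv_rev, map_mul, ← Matrix.transpose_nonsing_inv,
        cplx_transpose]
      refine (norm_mul_le _ _).trans ?_
      rw [Matrix.l2_opNorm_conjTranspose]
      exact mul_le_mul (hD n) (hD n) (norm_nonneg _) ((norm_nonneg _).trans (hD n))⟩
  have h0 : ∀ n : ℕ, (1 / (n : ℝ)) * Real.log (cplx ((arMat φ n)ᵀ * arMat φ n)).det.re = 0 := by
    intro n
    simp [cplx_det, det_arMat]
  simp only [h0] at h
  exact (tendsto_nhds_unique h tendsto_const_nhds)

/-! ### The Yule–Walker equations -/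

/-- The autocovariances as Fourier coefficients of the spectrum. -/
def specCov (P : ℝ) (φ : Fin p → ℝ) (m : ℤ) : ℝ := avg fun ν => SX P φ ν * Real.cos (m * ν)

/-- Mean value property: `z ^ m / arPoly` is holomorphic on the closed disc, and `arPoly` equals `1`
at the origin. -/
theorem avg_pow_div_arPoly (hφ : φ ∈ stable p) (m : ℕ) :
    avg (fun ν => Complex.exp (ν * Complex.I) ^ m / (arPoly φ).eval (Complex.exp (ν * Complex.I)))
      = if m = 0 then 1 else 0 := by
  have hd : DiffContOnCl ℂ (fun z => z ^ m / (arPoly φ).eval z) (Metric.ball 0 |1|) := by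
    rw [abs_one]
    refine DifferentiableOn.diffContOnCl ?_
    rw [closure_ball _ one_ne_zero]
    intro z hz
    refine DifferentiableAt.differentiableWithinAt (DifferentiableAt.div (by fun_prop)
      (Polynomial.differentiable _ _) (arPoly_eval_ne_zero hφ ?_))
    simpa using hz
  have h := hd.circleAverage
  rw [Real.circleAverage_def] at h
  have e : avg (fun ν => Complex.exp (ν * Complex.I) ^ m
      / (arPoly φ).eval (Complex.exp (ν * Complex.I)))
      = (2 * Real.pi)⁻¹ • ∫ θ in (0 : ℝ)..2 * Real.pi,
        (fun z => z ^ m / (arPoly φ).eval z) (circleMap 0 1 θ) := by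
    unfold avg
    rw [one_div]
    simp [circleMap]
  rw [e, h, arPoly_eval]
  split_ifs with hm
  · subst hm; simp
  · simp [hm]

theorem re_exp_mul_I_zpow (m : ℤ) (ν : ℝ) :
    (Complex.exp (ν * Complex.I) ^ m).re = Real.cos (m * ν) := by
  rw [← Complex.exp_int_mul, ← mul_assoc]
  have : ((m : ℂ) * (ν : ℂ)) = ((m * ν : ℝ) : ℂ) := by push_cast; rfl
  rw [this, Complex.exp_ofReal_mul_I_re]

theorem continuous_specCov_integrand (hφ : φ ∈ stable p) (m : ℤ) :
    Continuous fun ν => SX P φ ν * Real.cos (m * ν) :=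
  (continuous_SX hφ).mul (by fun_prop)

theorem specCov_neg (m : ℤ) : specCov P φ (-m) = specCov P φ m := by
  unfold specCov
  congr 1
  ext ν
  rw [Int.cast_neg, neg_mul, Real.cos_neg]

/-- On the unit circle `SX (1 - Φ)` is `η²` divided by the conjugate of `1 - Φ`, that is, by
`arPoly` at `e^{iν}`. Multiplying by `e^{ikν}` and averaging leaves the Kronecker delta for `k ≥ 0`.
-/
theorem isYuleWalker_specCov (hφ : φ ∈ stable p) :
    IsYuleWalker P φ (specCov P φ) := by
  refine ⟨specCov_neg, fun m hm => ?_⟩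
  obtain ⟨k, rfl⟩ := Int.eq_ofNat_of_zero_le hm
  have hc : Continuous fun ν : ℝ => Complex.exp (ν * Complex.I) ^ k
      / (arPoly φ).eval (Complex.exp (ν * Complex.I)) := by
    refine Continuous.div (by fun_prop) ((Polynomial.continuous _).comp (by fun_prop)) fun ν => ?_
    refine arPoly_eval_ne_zero hφ (le_of_eq ?_)
    exact Complex.norm_exp_ofReal_mul_I ν
  have hpt : ∀ ν, SX P φ ν * Real.cos ((k : ℤ) * ν)
      = (∑ j : Fin p, φ j * (SX P φ ν * Real.cos (((k : ℤ) - ((j : ℤ) + 1) : ℤ) * ν)))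
        + innovVar P φ * (Complex.exp (ν * Complex.I) ^ k
          / (arPoly φ).eval (Complex.exp (ν * Complex.I))).re := by
    intro ν
    set e := Complex.exp (ν * Complex.I) with he
    have he0 : e ≠ 0 := Complex.exp_ne_zero _
    have heinv : Complex.exp (-Complex.I * ν) = e⁻¹ := by
      rw [he, ← Complex.exp_neg]; congr 1; ring
    have hq1 : 1 - fourierAR φ ν = (arPoly φ).eval e⁻¹ := by rw [← arPoly_eval_exp, heinv]
    have hconj : conj (1 - fourierAR φ ν) = (arPoly φ).eval e := by
      have hce : conj e⁻¹ = e := by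
        rw [← heinv, ← Complex.exp_conj, he]
        congr 1
        simp [Complex.conj_ofReal]
        ring
      rw [hq1, arPoly_eval, arPoly_eval]
      simp only [map_sub, map_one, map_sum, map_mul, map_pow, hce, Complex.conj_ofReal]
    have hne : 1 - fourierAR φ ν ≠ 0 := one_sub_fourierAR_ne_zero hφ ν
    have hSX : (SX P φ ν : ℂ) * (1 - fourierAR φ ν)
        = (innovVar P φ : ℂ) / (arPoly φ).eval e := by
      have hc0 : conj (1 - fourierAR φ ν) ≠ 0 :=
        (map_ne_zero (starRingEnd ℂ)).2 hne
      rw [SX, ← hconj, Complex.ofReal_div, Complex.ofReal_pow, ← Complex.mul_conj']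
      field_simp
    have hmul := congrArg (fun w => (e ^ k * w).re) hSX
    have hr : (e ^ k * ((innovVar P φ : ℂ) / (arPoly φ).eval e)).re
        = innovVar P φ * (e ^ k / (arPoly φ).eval e).re := by
      rw [← Complex.re_ofReal_mul]; congr 1; ring
    have hl : (e ^ k * ((SX P φ ν : ℂ) * (1 - fourierAR φ ν))).re
        = SX P φ ν * Real.cos ((k : ℤ) * ν)
          - ∑ j : Fin p, φ j * (SX P φ ν * Real.cos (((k : ℤ) - ((j : ℤ) + 1) : ℤ) * ν)) := by
      have e1 : e ^ k * ((SX P φ ν : ℂ) * (1 - fourierAR φ ν))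
          = (SX P φ ν : ℂ) * e ^ (k : ℤ) - ∑ j : Fin p, ((φ j : ℝ) : ℂ) * ((SX P φ ν : ℂ)
            * e ^ ((k : ℤ) - ((j : ℤ) + 1))) := by
        rw [hq1, arPoly_eval, mul_sub, mul_sub, mul_one, Finset.mul_sum, Finset.mul_sum]
        congr 1
        · rw [zpow_natCast]; ring
        · refine Finset.sum_congr rfl fun j _ => ?_
          have : e ^ ((k : ℤ) - ((j : ℤ) + 1)) = e ^ k * e⁻¹ ^ ((j : ℕ) + 1) := by
            rw [zpow_sub₀ he0, zpow_natCast, inv_pow, div_eq_mul_inv]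
            congr 2
          rw [this]
          ring
      rw [e1, Complex.sub_re, Complex.re_ofReal_mul, re_exp_mul_I_zpow, Complex.re_sum]
      simp only [Complex.re_ofReal_mul, re_exp_mul_I_zpow, he]
    rw [hr, hl] at hmul
    linarith
  have hcs : ∀ m : ℤ, Continuous fun ν => SX P φ ν * Real.cos (m * ν) :=
    continuous_specCov_integrand hφ
  have hcs2 : ∀ j : Fin p, Continuous fun ν => φ j * (SX P φ ν *
      Real.cos (((k : ℤ) - ((j : ℤ) + 1) : ℤ) * ν)) := fun j => continuous_const.mul (hcs _)
  have hcre : Continuous fun ν : ℝ => innovVar P φ * (Complex.exp (ν * Complex.I) ^ k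
      / (arPoly φ).eval (Complex.exp (ν * Complex.I))).re :=
    continuous_const.mul (Complex.continuous_re.comp hc)
  have h1 : specCov P φ (k : ℤ) = ∑ j : Fin p, φ j * specCov P φ ((k : ℤ) - ((j : ℤ) + 1))
      + innovVar P φ * (if k = 0 then 1 else 0) := by
    unfold specCov
    rw [(funext hpt : (fun ν => SX P φ ν * Real.cos ((k : ℤ) * ν)) = _),
      avg_add (continuous_finsetSum _ fun j _ => hcs2 j) hcre,
      avg_sum _ fun j _ => hcs2 j, avg_const_mul, avg_re hc, avg_pow_div_arPoly hφ]
    congr 1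
    · exact Finset.sum_congr rfl fun j _ => avg_const_mul _ _
    · split_ifs <;> simp
  rw [h1]
  congr 1
  simp only [mul_ite, mul_one, mul_zero]
  exact if_congr (by simp) rfl rfl

theorem sum_sq_le_of_arMat (hφ : φ ∈ stable p) :
    ∃ D, 0 ≤ D ∧ ∀ (n : ℕ) (v : Fin n → ℝ), ∑ t, v t ^ 2 ≤ D * ∑ t, (arMat φ n *ᵥ v) t ^ 2 := by
  obtain ⟨C, hC⟩ := norm_arMat_inv_le hφ
  refine ⟨C ^ 2, sq_nonneg _, fun n v => ?_⟩
  have h := sum_norm_sq_mulVec_le (cplx (arMat φ n)⁻¹) (fun t => ((arMat φ n *ᵥ v) t : ℂ))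
  have e : cplx (arMat φ n)⁻¹ *ᵥ (fun t => ((arMat φ n *ᵥ v) t : ℂ)) = fun t => (v t : ℂ) := by
    have h1 : ∀ (M : Matrix (Fin n) (Fin n) ℝ) (x : Fin n → ℝ),
        cplx M *ᵥ (fun t => (x t : ℂ)) = fun t => ((M *ᵥ x) t : ℂ) := by
      intro M x
      ext t
      simp [Matrix.mulVec, dotProduct, cplx_apply]
    rw [h1, Matrix.mulVec_mulVec, arMat_inv_mul, Matrix.one_mulVec]
  rw [e] at h
  simp only [Complex.norm_real, Real.norm_eq_abs, sq_abs] at h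
  refine h.trans ?_
  have h0 : 0 ≤ ∑ t, (arMat φ n *ᵥ v) t ^ 2 := Finset.sum_nonneg fun _ _ => sq_nonneg _
  have := hC n
  gcongr

/-- A two-sided solution of a stable homogeneous recursion that is even vanishes. -/
theorem eq_zero_of_even_recursion (hφ : φ ∈ stable p) {δ : ℤ → ℝ} (heven : ∀ m, δ (-m) = δ m)
    (hrec : ∀ m, δ m = ∑ k : Fin p, φ k * δ (m - ((k : ℤ) + 1))) (m : ℤ) : δ m = 0 := by
  obtain ⟨D, hD0, hD⟩ := sum_sq_le_of_arMat hφ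
  set c := ∑ k : Fin p, |φ k| with hc
  set w : ℤ → ℝ := fun a => ∑ j : Fin p, |δ (a - ((j : ℤ) + 1))| with hw
  have hc0 : 0 ≤ c := Finset.sum_nonneg fun _ _ => abs_nonneg _
  have hw0 : ∀ a, 0 ≤ w a := fun a => Finset.sum_nonneg fun _ _ => abs_nonneg _
  -- Energy estimate uniform in the window length: whitening the window `[a, a + n)` leaves a
  -- residual only at the first `p` times, and this residual involves only the `p` values before
  -- `a`.
  have key : ∀ (a : ℤ) (n : ℕ), ∑ t : Fin n, δ (a + t) ^ 2 ≤ D * (p * (c * w a) ^ 2) := by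
    intro a n
    refine (hD n fun t => δ (a + t)).trans ?_
    gcongr
    have hterm : ∀ t : Fin n, (arMat φ n *ᵥ fun t => δ (a + t)) t ^ 2
        ≤ if (t : ℕ) < p then (c * w a) ^ 2 else 0 := by
      intro t
      have e : (arMat φ n *ᵥ fun t => δ (a + t)) t
          = ∑ k : Fin p, if (t : ℤ) < (k : ℤ) + 1 then φ k * δ (a + t - ((k : ℤ) + 1)) else 0 := by
        rw [arMat_mulVec, hrec (a + t), ← Finset.sum_sub_distrib]
        refine Finset.sum_congr rfl fun k _ => ?_
        unfold zeroExt
        have := t.2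
        split_ifs with h1 h2 h2
        · omega
        · have : a + (((t : ℤ) - ((k : ℤ) + 1)).toNat : ℤ) = a + t - ((k : ℤ) + 1) := by omega
          simp only [this, sub_self]
        · simp
        · omega
      rw [e]
      split_ifs with ht
      · rw [← sq_abs]
        gcongr
        refine (Finset.abs_sum_le_sum_abs _ _).trans ?_
        rw [hc, Finset.sum_mul]
        refine Finset.sum_le_sum fun k _ => ?_
        split_ifs with hk
        · rw [abs_mul]
          gcongr
          have hk2 := k.2
          have := Finset.single_le_sum (f := fun j : Fin p => |δ (a - ((j : ℤ) + 1))|)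
            (fun _ _ => abs_nonneg _)
            (Finset.mem_univ (⟨(k : ℕ) - t, by omega⟩ : Fin p))
          refine le_trans (le_of_eq ?_) this
          congr 2
          have : (((k : ℕ) - (t : ℕ) : ℕ) : ℤ) = (k : ℤ) - t := by omega
          simp only [this]
          ring
        · rw [abs_zero]
          exact mul_nonneg (abs_nonneg _) (hw0 a)
      · rw [Finset.sum_eq_zero]
        · simp
        · intro k _
          have := k.2
          rw [if_neg (by omega)]
    refine (Finset.sum_le_sum fun t _ => hterm t).trans ?_
    rw [Fin.sum_univ_eq_sum_range (fun t => if t < p then (c * w a) ^ 2 else 0), ← Finset.sum_filter,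
      Finset.sum_const, nsmul_eq_mul]
    gcongr
    have : (Finset.range n).filter (fun t => t < p) ⊆ Finset.range p := by
      intro t ht
      simp only [Finset.mem_filter] at ht
      exact Finset.mem_range.2 ht.2
    simpa using Finset.card_le_card this
  -- With `a = 0` the estimate makes the forward half square summable; evenness carries the decay to
  -- `-∞`.
  have hsumm : Summable fun t : ℕ => δ (t : ℤ) ^ 2 := by
    refine summable_of_sum_range_le (fun _ => sq_nonneg _) (c := D * (p * (c * w 0) ^ 2)) fun n => ?_
    rw [← Fin.sum_univ_eq_sum_range (fun t => δ (t : ℤ) ^ 2)]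
    simpa using key 0 n
  have hlim : Tendsto (fun t : ℕ => |δ (t : ℤ)|) atTop (𝓝 0) := by
    have := (Real.continuous_sqrt.tendsto 0).comp hsumm.tendsto_atTop_zero
    rw [Real.sqrt_zero] at this
    refine this.congr fun t => ?_
    simp [Real.sqrt_sq_eq_abs]
  have hwlim : Tendsto (fun t : ℕ => w (-(t : ℤ))) atTop (𝓝 0) := by
    have : Tendsto (fun t : ℕ => ∑ j : Fin p, |δ ((t + ((j : ℕ) + 1) : ℕ) : ℤ)|) atTop
        (𝓝 (∑ _j : Fin p, 0)) :=
      tendsto_finsetSum _ fun j _ => hlim.comp (tendsto_add_atTop_nat ((j : ℕ) + 1))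
    rw [Finset.sum_const_zero] at this
    refine this.congr fun t => ?_
    simp only [hw]
    refine Finset.sum_congr rfl fun j _ => ?_
    rw [← heven]
    congr 2
    push_cast
    ring
  -- Start the window at `-t`: the fixed value at `m` is controlled by data that vanish as `t → ∞`.
  have hbound : ∀ᶠ t : ℕ in atTop, δ m ^ 2 ≤ D * (p * (c * w (-(t : ℤ))) ^ 2) := by
    filter_upwards [eventually_ge_atTop m.natAbs] with t ht
    have hmt : 0 ≤ m + t := by omega
    refine le_trans ?_ (key (-(t : ℤ)) ((m + t).toNat + 1))
    have := Finset.single_le_sum (f := fun s : Fin ((m + t).toNat + 1) =>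
      δ (-(t : ℤ) + s) ^ 2) (fun _ _ => sq_nonneg _) (Finset.mem_univ (Fin.last _))
    refine le_trans (le_of_eq ?_) this
    simp only [Fin.val_last]
    congr 2
    omega
  have hz : Tendsto (fun t : ℕ => D * (p * (c * w (-(t : ℤ))) ^ 2)) atTop (𝓝 0) := by
    have := (((hwlim.const_mul c).pow 2).const_mul (p : ℝ)).const_mul D
    simpa using this
  have := ge_of_tendsto hz hbound
  exact pow_eq_zero_iff two_ne_zero |>.1 (le_antisymm this (sq_nonneg _))

/-- The difference `δ` of two solutions satisfies the homogeneous recursion only for `m ≥ 0`.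
Evenness extends it to all of `ℤ`, and `eq_zero_of_even_recursion` then applies. -/
theorem yuleWalker_unique (hφ : φ ∈ stable p) {γ γ' : ℤ → ℝ} (h : IsYuleWalker P φ γ)
    (h' : IsYuleWalker P φ γ') : γ = γ' := by
  set δ : ℤ → ℝ := fun m => γ m - γ' m with hδ
  have heven : ∀ m, δ (-m) = δ m := fun m => by simp only [hδ, h.1, h'.1]
  set e : ℤ → ℝ := fun m => δ m - ∑ k : Fin p, φ k * δ (m - ((k : ℤ) + 1)) with he
  have he0 : ∀ m, 0 ≤ m → e m = 0 := by
    intro m hm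
    simp only [he, hδ, mul_sub, Finset.sum_sub_distrib]
    rw [h.2 m hm, h'.2 m hm]
    ring
  -- Applying the time-reversed filter to the defect `e` composes the filter with its adjoint, which
  -- preserves evenness. Hence `u`, zero on `m ≥ 0`, is zero everywhere.
  set u : ℤ → ℝ := fun m => e m - ∑ j : Fin p, φ j * e (m + ((j : ℤ) + 1)) with hu
  have hu0 : ∀ m, 0 ≤ m → u m = 0 := by
    intro m hm
    simp only [hu]
    rw [he0 m hm, Finset.sum_eq_zero, sub_zero]
    intro j _
    rw [he0 _ (by omega), mul_zero]
  have hueven : ∀ m, u (-m) = u m := by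
    intro m
    simp only [hu, he, mul_sub, Finset.sum_sub_distrib, Finset.mul_sum]
    rw [Finset.sum_comm (f := fun j k : Fin p => φ j * (φ k * δ (m + ((j : ℤ) + 1) - ((k : ℤ) + 1))))]
    have e1 : ∀ k : Fin p, δ (-m - ((k : ℤ) + 1)) = δ (m + ((k : ℤ) + 1)) := fun k => by
      rw [← heven]; congr 1; ring
    have e2 : ∀ k : Fin p, δ (-m + ((k : ℤ) + 1)) = δ (m - ((k : ℤ) + 1)) := fun k => by
      rw [← heven]; congr 1; ring
    have e3 : ∀ j k : Fin p, φ j * (φ k * δ (-m + ((j : ℤ) + 1) - ((k : ℤ) + 1)))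
        = φ k * (φ j * δ (m + ((k : ℤ) + 1) - ((j : ℤ) + 1))) := fun j k => by
      rw [← heven, mul_left_comm]; congr 3; ring
    simp only [e1, e2, e3, heven]
    ring
  have hu1 : ∀ m, u m = 0 := by
    intro m
    rcases le_total 0 m with hm | hm
    · exact hu0 m hm
    · rw [← hueven]; exact hu0 _ (by omega)
  -- Since `u = 0`, each defect is a combination of later defects, so the zeros on `m ≥ 0` propagate
  -- backwards.
  have heall : ∀ n : ℕ, e (-(n : ℤ)) = 0 := by
    intro n
    induction n using Nat.strong_induction_on with
    | _ n ih =>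
      have h1 := hu1 (-(n : ℤ))
      simp only [hu] at h1
      rw [sub_eq_zero.1 h1]
      refine Finset.sum_eq_zero fun j _ => ?_
      by_cases hj : (j : ℕ) + 1 ≤ n
      · have := ih (n - ((j : ℕ) + 1)) (by omega)
        have e1 : -((n - ((j : ℕ) + 1) : ℕ) : ℤ) = -(n : ℤ) + ((j : ℤ) + 1) := by omega
        rw [← e1, this, mul_zero]
      · rw [he0 _ (by omega), mul_zero]
  have hrec : ∀ m, δ m = ∑ k : Fin p, φ k * δ (m - ((k : ℤ) + 1)) := by
    intro m
    have : e m = 0 := by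
      rcases le_total 0 m with hm | hm
      · exact he0 m hm
      · have := heall m.natAbs
        rwa [show -(m.natAbs : ℤ) = m by omega] at this
    exact sub_eq_zero.1 this
  ext m
  exact sub_eq_zero.1 (eq_zero_of_even_recursion hφ heven hrec m)

theorem autocov_eq (hφ : φ ∈ stable p) : autocov P φ = specCov P φ :=
  yuleWalker_unique hφ (Classical.epsilon_spec ⟨_, isYuleWalker_specCov hφ⟩)
    (isYuleWalker_specCov hφ)

end

/-! ### The rate as a concave function of the tilting parameter -/

section
variable {β κ : ℝ → ℂ} {σ : ℝ}

theorem continuous_avg_param {X : Type*} [TopologicalSpace X] {f : X → ℝ → ℝ}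
    (hf : Continuous (Function.uncurry f)) : Continuous fun x => avg (f x) := by
  unfold avg
  exact (intervalIntegral.continuous_parametric_intervalIntegral_of_continuous' (μ := volume)
    hf _ _).const_smul (1 / (2 * Real.pi))

theorem continuous_log_one_add (hβ : Continuous β) {ω : ℝ} (hω : 0 ≤ ω) :
    Continuous fun ν => Real.log (1 + ω * ‖β ν‖ ^ 2) :=
  Continuous.log (by fun_prop) fun ν => (one_add_pos hω _).ne'

theorem continuous_div_one_add (hβ : Continuous β) (hκ : Continuous κ) {ω : ℝ} (hω : 0 ≤ ω) :
    Continuous fun ν => (‖κ ν‖ ^ 2 + σ ^ 2) / (1 + ω * ‖β ν‖ ^ 2) :=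
  Continuous.div (by fun_prop) (by fun_prop) fun ν => (one_add_pos hω _).ne'

theorem continuous_slope_integrand (hβ : Continuous β) (hκ : Continuous κ) {ω : ℝ} (hω : 0 ≤ ω) :
    Continuous fun ν => (‖κ ν‖ ^ 2 + σ ^ 2) / (1 + ω * ‖β ν‖ ^ 2) ^ 2
      + ‖β ν‖ ^ 2 / (1 + ω * ‖β ν‖ ^ 2) :=
  (Continuous.div (by fun_prop) (by fun_prop) fun ν => (pow_pos (one_add_pos hω _) 2).ne').add
    (Continuous.div (by fun_prop) (by fun_prop) fun ν => (one_add_pos hω _).ne')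

/-- Tangent lines of two concave functions of the parameter, `log (1 + y b)` and `y / (1 + y b)`. -/
theorem tangent_bound {b s x y : ℝ} (hb : 0 ≤ b) (hs : 0 ≤ s) (hx : 0 ≤ x) (hy : 0 ≤ y) :
    1 / 2 * Real.log (1 + y * b) + y / 2 * (s / (1 + y * b))
      ≤ 1 / 2 * Real.log (1 + x * b) + x / 2 * (s / (1 + x * b))
        + (y - x) / 2 * (s / (1 + x * b) ^ 2 + b / (1 + x * b)) := by
  have hu : 0 < 1 + x * b := by positivity
  have hv : 0 < 1 + y * b := by positivity
  have h1 : Real.log (1 + y * b) - Real.log (1 + x * b) ≤ (y - x) * (b / (1 + x * b)) := by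
    rw [← Real.log_div hv.ne' hu.ne']
    refine (Real.log_le_sub_one_of_pos (div_pos hv hu)).trans (le_of_eq ?_)
    field_simp
    ring
  have h2 : y / (1 + y * b) - x / (1 + x * b) ≤ (y - x) / (1 + x * b) ^ 2 := by
    have e : (y - x) / (1 + x * b) ^ 2 - (y / (1 + y * b) - x / (1 + x * b))
        = (y - x) ^ 2 * b / ((1 + x * b) ^ 2 * (1 + y * b)) := by
      field_simp
      ring
    have : 0 ≤ (y - x) ^ 2 * b / ((1 + x * b) ^ 2 * (1 + y * b)) := by positivity
    linarith
  have h3 := mul_le_mul_of_nonneg_left h2 hs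
  have e1 : y / 2 * (s / (1 + y * b)) = 1 / 2 * (s * (y / (1 + y * b))) := by ring
  have e2 : x / 2 * (s / (1 + x * b)) = 1 / 2 * (s * (x / (1 + x * b))) := by ring
  have e3 : (y - x) / 2 * (s / (1 + x * b) ^ 2 + b / (1 + x * b))
      = 1 / 2 * (s * ((y - x) / (1 + x * b) ^ 2)) + 1 / 2 * ((y - x) * (b / (1 + x * b))) := by ring
  rw [e1, e2, e3]
  linarith

theorem rateFn_eq_avg (hβ : Continuous β) (hκ : Continuous κ) {ω : ℝ} (hω : 0 ≤ ω) :
    rateFn β κ σ ω = avg (fun ν => 1 / 2 * Real.log (1 + ω * ‖β ν‖ ^ 2)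
      + ω / 2 * ((‖κ ν‖ ^ 2 + σ ^ 2) / (1 + ω * ‖β ν‖ ^ 2))) - ω / 2 * trueDist β κ σ := by
  rw [avg_add ((continuous_log_one_add hβ hω).const_mul _)
    ((continuous_div_one_add hβ hκ hω).const_mul _), avg_const_mul, avg_const_mul]
  rfl

/-- The slope at `x` is a supergradient of the rate. -/
theorem rateFn_le_tangent (hβ : Continuous β) (hκ : Continuous κ) {x y : ℝ} (hx : 0 ≤ x)
    (hy : 0 ≤ y) :
    rateFn β κ σ y
      ≤ rateFn β κ σ x + 1 / 2 * (slopeFn β κ σ x - trueDist β κ σ) * (y - x) := by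
  have hc : ∀ {ω : ℝ}, 0 ≤ ω → Continuous fun ν => 1 / 2 * Real.log (1 + ω * ‖β ν‖ ^ 2)
      + ω / 2 * ((‖κ ν‖ ^ 2 + σ ^ 2) / (1 + ω * ‖β ν‖ ^ 2)) := fun hω =>
    ((continuous_log_one_add hβ hω).const_mul _).add ((continuous_div_one_add hβ hκ hω).const_mul _)
  have h := avg_mono (hc hy)
    ((hc hx).add ((continuous_slope_integrand (σ := σ) hβ hκ hx).const_mul ((y - x) / 2)))
    fun ν => tangent_bound (sq_nonneg ‖β ν‖) (by positivity) hx hy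
  have e0 := avg_add (hc hx)
    ((continuous_slope_integrand (σ := σ) hβ hκ hx).const_mul ((y - x) / 2))
  rw [avg_const_mul] at e0
  replace h := h.trans_eq e0
  rw [rateFn_eq_avg hβ hκ hx, rateFn_eq_avg hβ hκ hy]
  have e : slopeFn β κ σ x = avg fun ν => (‖κ ν‖ ^ 2 + σ ^ 2) / (1 + x * ‖β ν‖ ^ 2) ^ 2
      + ‖β ν‖ ^ 2 / (1 + x * ‖β ν‖ ^ 2) := rfl
  rw [← e] at h
  linarith

theorem rateFn_zero (β κ : ℝ → ℂ) (σ : ℝ) : rateFn β κ σ 0 = 0 := by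
  simp [rateFn, avg_const]

theorem concaveOn_rateFn (hβ : Continuous β) (hκ : Continuous κ) :
    ConcaveOn ℝ (Ici 0) (rateFn β κ σ) := by
  refine ⟨convex_Ici 0, fun x hx y hy a b ha hb hab => ?_⟩
  simp only [smul_eq_mul]
  have hz : 0 ≤ a * x + b * y := add_nonneg (mul_nonneg ha hx) (mul_nonneg hb hy)
  have h1 := mul_le_mul_of_nonneg_left (rateFn_le_tangent (σ := σ) hβ hκ hz hx) ha
  have h2 := mul_le_mul_of_nonneg_left (rateFn_le_tangent (σ := σ) hβ hκ hz hy) hb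
  set z := a * x + b * y with hzdef
  have hb' : b = 1 - a := by linarith
  have e : a * (x - z) + b * (y - z) = 0 := by rw [hzdef, hb']; ring
  have e2 : a * (1 / 2 * (slopeFn β κ σ z - trueDist β κ σ) * (x - z))
      + b * (1 / 2 * (slopeFn β κ σ z - trueDist β κ σ) * (y - z)) = 0 := by
    linear_combination (1 / 2 * (slopeFn β κ σ z - trueDist β κ σ)) * e
  have e3 : a * rateFn β κ σ z + b * rateFn β κ σ z = rateFn β κ σ z := by
    rw [← add_mul, hab, one_mul]
  linarith

theorem continuousOn_slopeFn (hβ : Continuous β) (hκ : Continuous κ) :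
    ContinuousOn (slopeFn β κ σ) (Ici 0) := by
  -- Clamping `ω` at `0` keeps the denominators positive on the whole line, as the parametric
  -- integral requires.
  have h : Continuous fun ω : ℝ => slopeFn β κ σ (max ω 0) := by
    refine continuous_avg_param ?_
    have hpos : ∀ q : ℝ × ℝ, 0 < 1 + max q.1 0 * ‖β q.2‖ ^ 2 :=
      fun q => one_add_pos (le_max_right _ _) _
    exact (Continuous.div (by fun_prop) (by fun_prop) fun q => (pow_pos (hpos q) 2).ne').add
      (Continuous.div (by fun_prop) (by fun_prop) fun q => (hpos q).ne')
  exact h.continuousOn.congr fun ω hω => by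
    change _ = slopeFn β κ σ (max ω 0)
    rw [max_eq_left hω]

/-- A tangent with nonpositive slope is largest on `[0, ∞)` at `0`. -/
theorem bddAbove_rateFn (hβ : Continuous β) (hκ : Continuous κ) {x : ℝ} (hx : 0 ≤ x)
    (hsl : slopeFn β κ σ x ≤ trueDist β κ σ) {y : ℝ} (hy : 0 ≤ y) :
    rateFn β κ σ y ≤ rateFn β κ σ x + x / 2 * (trueDist β κ σ - slopeFn β κ σ x) := by
  have := rateFn_le_tangent (σ := σ) hβ hκ hx hy
  nlinarith [mul_nonneg (sub_nonneg.2 hsl) hy]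

/-- Near the smallest tilting parameter whose slope is below the true distance, the correction
term in the converse is small. -/
theorem exists_tilt (hβ : Continuous β) (hκ : Continuous κ)
    (hne : ∃ x, 0 ≤ x ∧ slopeFn β κ σ x < trueDist β κ σ) {ε : ℝ} (hε : 0 < ε) :
    ∃ x, 0 ≤ x ∧ slopeFn β κ σ x < trueDist β κ σ ∧
      x / 2 * (trueDist β κ σ - slopeFn β κ σ x) < ε := by
  set S := {x | 0 ≤ x ∧ slopeFn β κ σ x < trueDist β κ σ} with hS
  have hbdd : BddBelow S := ⟨0, fun x hx => hx.1⟩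
  have hmem : sInf S ∈ closure S := csInf_mem_closure hne hbdd
  have h0 : 0 ≤ sInf S := le_csInf hne fun x hx => hx.1
  have hcont : ContinuousOn (fun x => x / 2 * (trueDist β κ σ - slopeFn β κ σ x)) (Ici 0) :=
    (continuousOn_id.div_const 2).mul (continuousOn_const.sub (continuousOn_slopeFn hβ hκ))
  -- At the infimum either the factor `x / 2` vanishes, or every smaller parameter has slope at
  -- least `trueDist` and continuity passes this to the infimum. Nearby points of `S` then inherit a
  -- small product.
  have hle : sInf S / 2 * (trueDist β κ σ - slopeFn β κ σ (sInf S)) ≤ 0 := by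
    rcases h0.eq_or_lt with h | h
    · rw [← h]; simp
    · refine mul_nonpos_of_nonneg_of_nonpos (by positivity) (sub_nonpos.2 ?_)
      have hcl : sInf S ∈ closure (Ico 0 (sInf S)) := by
        rw [closure_Ico h.ne]; exact ⟨h0, le_rfl⟩
      have hm : MapsTo (slopeFn β κ σ) (Ico 0 (sInf S)) (Ici (trueDist β κ σ)) := by
        intro x hx
        by_contra hlt
        exact absurd (csInf_le hbdd ⟨hx.1, not_le.1 hlt⟩) (not_le.2 hx.2)
      have := ((continuousOn_slopeFn (σ := σ) hβ hκ) _ h0).mono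
        (fun x (hx : x ∈ Ico 0 (sInf S)) => hx.1) |>.mem_closure hcl hm
      rwa [isClosed_Ici.closure_eq] at this
  have hev : ∀ᶠ x in 𝓝[S] (sInf S), x / 2 * (trueDist β κ σ - slopeFn β κ σ x) < ε :=
    ((hcont _ h0).mono fun x hx => hx.1).eventually_lt_const (hle.trans_lt hε)
  have : (𝓝[S] (sInf S)).NeBot := mem_closure_iff_nhdsWithin_neBot.1 hmem
  obtain ⟨x, hx1, hx2⟩ := (hev.and self_mem_nhdsWithin).exists
  exact ⟨x, hx2.1, hx2.2, hx1⟩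

/-- As `ω → ∞` the slope tends to the average of `|κ|² + σ²` over the zero set of `β`. The integrand
of `trueDist` agrees with this on the zero set and is at least `σ² > 0` off it, so the latter part
must be null. -/
theorem ae_eq_zero_of_trueDist_le_slope (hβ : Continuous β) (hκ : Continuous κ) (hσ : 0 < σ)
    (h : ∀ x, 0 ≤ x → trueDist β κ σ ≤ slopeFn β κ σ x) :
    ∀ᵐ ν ∂volume.restrict (Ioc 0 (2 * Real.pi)), β ν = 0 := by
  classical
  set G : ℝ → ℝ := fun ν => if β ν = 0 then ‖κ ν‖ ^ 2 + σ ^ 2 else 0 with hG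
  have hlim : Tendsto (fun x => slopeFn β κ σ x) atTop (𝓝 (avg G)) := by
    unfold slopeFn avg
    refine Tendsto.const_smul ?_ _
    refine intervalIntegral.tendsto_integral_filter_of_dominated_convergence
      (fun ν => ‖κ ν‖ ^ 2 + σ ^ 2 + ‖β ν‖ ^ 2) ?_ ?_ ?_ ?_
    · filter_upwards [eventually_ge_atTop 0] with x hx
      exact (continuous_slope_integrand hβ hκ hx).aestronglyMeasurable
    · filter_upwards [eventually_ge_atTop 0] with x hx
      refine Eventually.of_forall fun ν _ => ?_
      have h1 : 1 ≤ 1 + x * ‖β ν‖ ^ 2 := le_add_of_nonneg_right (by positivity)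
      rw [Real.norm_of_nonneg (by positivity)]
      exact add_le_add (div_le_self (by positivity) (one_le_pow₀ h1))
        (div_le_self (by positivity) h1)
    · exact Continuous.intervalIntegrable (by fun_prop) _ _
    · refine Eventually.of_forall fun ν _ => ?_
      by_cases hb : β ν = 0
      · simp [hG, hb]
      · have hb2 : 0 < ‖β ν‖ ^ 2 := by positivity
        have ht : Tendsto (fun x : ℝ => 1 + x * ‖β ν‖ ^ 2) atTop atTop :=
          tendsto_atTop_add_const_left _ _ (tendsto_id.atTop_mul_const hb2)
        have := ((tendsto_const_nhds (x := ‖κ ν‖ ^ 2 + σ ^ 2)).div_atTop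
          ((tendsto_pow_atTop two_ne_zero).comp ht)).add
          ((tendsto_const_nhds (x := ‖β ν‖ ^ 2)).div_atTop ht)
        simpa [hG, hb] using this
  have hle : trueDist β κ σ ≤ avg G :=
    ge_of_tendsto hlim ((eventually_ge_atTop 0).mono fun x hx => h x hx)
  have hpi : (0 : ℝ) ≤ 2 * Real.pi := by positivity
  have hGm : Measurable G :=
    Measurable.ite (measurableSet_eq_fun hβ.measurable measurable_const)
      (by fun_prop) measurable_const
  have hGi : IntervalIntegrable G volume 0 (2 * Real.pi) := by
    refine IntervalIntegrable.mono_fun (g := G)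
      (Continuous.intervalIntegrable (u := fun ν => ‖κ ν‖ ^ 2 + σ ^ 2) (by fun_prop) _ _)
      hGm.aestronglyMeasurable (Eventually.of_forall fun ν => ?_)
    simp only [hG]
    split_ifs
    · exact le_rfl
    · simp
  have hdc : Continuous fun ν => ‖κ ν - β ν‖ ^ 2 + σ ^ 2 := by fun_prop
  have hdi := hdc.intervalIntegrable (μ := volume) 0 (2 * Real.pi)
  have hnn : ∀ ν, 0 ≤ ‖κ ν - β ν‖ ^ 2 + σ ^ 2 - G ν := by
    intro ν
    simp only [hG]
    split_ifs with hb
    · simp [hb]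
    · rw [sub_zero]; positivity
  have hint : ∫ ν in Ioc 0 (2 * Real.pi), (‖κ ν - β ν‖ ^ 2 + σ ^ 2 - G ν) = 0 := by
    refine le_antisymm ?_ (integral_nonneg hnn)
    rw [← intervalIntegral.integral_of_le hpi, intervalIntegral.integral_sub hdi hGi, sub_nonpos]
    unfold trueDist avg at hle
    rw [smul_eq_mul, smul_eq_mul] at hle
    exact le_of_mul_le_mul_left hle (by positivity)
  have hae := (integral_eq_zero_iff_of_nonneg hnn ((hdi.sub hGi).1)).1 hint
  filter_upwards [hae] with ν hν
  by_contra hb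
  simp only [hG, if_neg hb, sub_zero, Pi.zero_apply] at hν
  have : 0 < ‖κ ν - β ν‖ ^ 2 + σ ^ 2 := by positivity
  exact this.ne' hν

end

/-! ### Identification of the rate expression -/

theorem re_fourierTaps_mul_conj {K : ℕ} (a b : Fin (K + 1) → ℝ) (ν : ℝ) :
    (fourierTaps a ν * conj (fourierTaps b ν)).re
      = ∑ l : Fin (K + 1), ∑ i : Fin (K + 1), a l * b i * Real.cos (((l : ℤ) - (i : ℤ) : ℤ) * ν) := by
  unfold fourierTaps
  rw [map_sum, Finset.sum_mul_sum, Complex.re_sum]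
  refine Finset.sum_congr rfl fun l _ => ?_
  rw [Complex.re_sum]
  refine Finset.sum_congr rfl fun i _ => ?_
  rw [map_mul, Complex.conj_ofReal, ← Complex.exp_conj, mul_mul_mul_comm, ← Complex.exp_add,
    ← Complex.ofReal_mul, Complex.re_ofReal_mul]
  have e : -Complex.I * ((l : ℕ) : ℂ) * ν + conj (-Complex.I * ((i : ℕ) : ℂ) * ν)
      = ((-(((l : ℤ) - (i : ℤ) : ℤ) * ν) : ℝ) : ℂ) * Complex.I := by
    simp
    ring
  rw [e, Complex.exp_ofReal_mul_I_re, Real.cos_neg]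

theorem sum_specCov {K p : ℕ} {φ : Fin p → ℝ} (hφ : φ ∈ stable p) (P : ℝ)
    (a b : Fin (K + 1) → ℝ) :
    ∑ l : Fin (K + 1), ∑ i : Fin (K + 1), a l * b i * specCov P φ ((l : ℤ) - (i : ℤ))
      = avg fun ν => SX P φ ν * (fourierTaps a ν * conj (fourierTaps b ν)).re := by
  have hc : ∀ l i : Fin (K + 1), Continuous fun ν : ℝ =>
      a l * b i * (SX P φ ν * Real.cos (((l : ℤ) - (i : ℤ) : ℤ) * ν)) :=
    fun l i => (continuous_specCov_integrand hφ _).const_mul _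
  have e : (fun ν => SX P φ ν * (fourierTaps a ν * conj (fourierTaps b ν)).re)
      = fun ν => ∑ l : Fin (K + 1), ∑ i : Fin (K + 1),
        a l * b i * (SX P φ ν * Real.cos (((l : ℤ) - (i : ℤ) : ℤ) * ν)) := by
    ext ν
    rw [re_fourierTaps_mul_conj, Finset.mul_sum]
    refine Finset.sum_congr rfl fun l _ => ?_
    rw [Finset.mul_sum]
    exact Finset.sum_congr rfl fun i _ => by ring
  rw [e, avg_sum _ fun l _ => continuous_finsetSum _ fun i _ => hc l i]
  refine Finset.sum_congr rfl fun l _ => ?_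
  rw [avg_sum _ fun i _ => hc l i]
  exact Finset.sum_congr rfl fun i _ => by rw [avg_const_mul]; rfl

theorem avg_norm_fourierTaps_sq {K : ℕ} (a : Fin (K + 1) → ℝ) :
    avg (fun ν => ‖fourierTaps a ν‖ ^ 2) = ∑ l, a l ^ 2 := by
  have e : (fun ν => ‖fourierTaps a ν‖ ^ 2) = fun ν => ∑ l : Fin (K + 1), ∑ i : Fin (K + 1),
      a l * a i * Real.cos (((l : ℤ) - (i : ℤ) : ℤ) * ν) := by
    ext ν
    rw [← re_fourierTaps_mul_conj, Complex.mul_conj, Complex.ofReal_re, Complex.normSq_eq_norm_sq]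
  have hcos : ∀ m : ℤ, avg (fun ν => Real.cos (m * ν)) = if m = 0 then 1 else 0 := by
    intro m
    split_ifs with hm
    · simp [hm, avg_const]
    · unfold avg
      have hm' : (m : ℝ) ≠ 0 := by exact_mod_cast hm
      rw [intervalIntegral.integral_comp_mul_left (fun x => Real.cos x) hm', integral_cos, mul_zero,
        Real.sin_zero, show (m : ℝ) * (2 * Real.pi) = ((2 * m : ℤ) : ℝ) * Real.pi by push_cast; ring,
        Real.sin_int_mul_pi]
      simp
  rw [e, avg_sum _ fun l _ => by fun_prop]
  refine Finset.sum_congr rfl fun l _ => ?_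
  rw [avg_sum _ fun i _ => by fun_prop, Finset.sum_eq_single l]
  · rw [avg_const_mul, hcos]; simp; ring
  · intro i _ hi
    rw [avg_const_mul, hcos, if_neg, mul_zero]
    intro h
    exact hi (Fin.ext (by omega))
  · simp

theorem sum_symm_eq (N : ℕ) (g : ℕ → ℕ → ℝ) (hg : ∀ i j, g i j = g j i) :
    ∑ i ∈ Finset.range N, ∑ j ∈ Finset.range N, g i j
      = ∑ i ∈ Finset.range N, g i i + 2 * ∑ j ∈ Finset.range N, ∑ k ∈ Finset.range j, g k j := by
  induction N with
  | zero => simp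
  | succ N ih =>
    simp only [Finset.sum_range_succ, Finset.sum_add_distrib]
    rw [ih, Finset.sum_congr rfl fun j _ => hg N j]
    ring

theorem sum_lag_eq (K : ℕ) (F : ℕ → ℕ → ℝ) :
    ∑ l ∈ Finset.Icc 1 K, ∑ k ∈ Finset.range (K - l + 1), F k (k + l)
      = ∑ j ∈ Finset.range (K + 1), ∑ k ∈ Finset.range j, F k j := by
  rw [Finset.sum_sigma', Finset.sum_sigma']
  refine Finset.sum_bij' (fun x _ => ⟨x.2 + x.1, x.2⟩) (fun x _ => ⟨x.1 - x.2, x.2⟩) ?_ ?_ ?_ ?_ ?_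
  · rintro ⟨l, k⟩ h
    simp only [Finset.mem_sigma, Finset.mem_Icc, Finset.mem_range] at h ⊢
    omega
  · rintro ⟨j, k⟩ h
    simp only [Finset.mem_sigma, Finset.mem_Icc, Finset.mem_range] at h ⊢
    omega
  · rintro ⟨l, k⟩ h
    simp
  · rintro ⟨j, k⟩ h
    simp only [Finset.mem_sigma, Finset.mem_range] at h
    simp only [Sigma.mk.injEq, heq_eq_eq, and_true]
    omega
  · rintro ⟨l, k⟩ h
    rfl

theorem zeroExt_val {n : ℕ} (x : Fin n → ℝ) (k : Fin n) : zeroExt x ((k : ℕ) : ℤ) = x k := by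
  unfold zeroExt
  rw [dif_pos ⟨by omega, by exact_mod_cast k.2⟩]
  rfl

/-- The double sum is its diagonal plus twice its upper triangle, and the triangle is then grouped
by lag. -/
theorem quadratic_lag_sum {K : ℕ} (α : Fin (K + 1) → ℝ) (γ : ℤ → ℝ) (hγ : ∀ m, γ (-m) = γ m) :
    1 / 2 * (∑ l : Fin (K + 1), α l ^ 2) * γ 0
      + ∑ l ∈ Finset.Icc 1 K, ∑ k ∈ Finset.range (K - l + 1),
          zeroExt α (k : ℤ) * zeroExt α ((k : ℤ) + (l : ℤ)) * γ (l : ℤ)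
      = 1 / 2 * ∑ l : Fin (K + 1), ∑ i : Fin (K + 1), α l * α i * γ ((l : ℤ) - (i : ℤ)) := by
  set u : ℕ → ℝ := fun k => zeroExt α (k : ℤ) with hu
  set g : ℕ → ℕ → ℝ := fun i j => u i * u j * γ ((j : ℤ) - i) with hg
  have h1 : ∑ l : Fin (K + 1), ∑ i : Fin (K + 1), α l * α i * γ ((l : ℤ) - (i : ℤ))
      = ∑ i ∈ Finset.range (K + 1), ∑ j ∈ Finset.range (K + 1), g i j := by
    rw [← Fin.sum_univ_eq_sum_range (fun i => ∑ j ∈ Finset.range (K + 1), g i j)]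
    refine Finset.sum_congr rfl fun l _ => ?_
    rw [← Fin.sum_univ_eq_sum_range (fun j => g l j)]
    refine Finset.sum_congr rfl fun i _ => ?_
    simp only [hg, hu, zeroExt_val]
    rw [← hγ, neg_sub]
  have h2 : ∑ l ∈ Finset.Icc 1 K, ∑ k ∈ Finset.range (K - l + 1),
      zeroExt α (k : ℤ) * zeroExt α ((k : ℤ) + (l : ℤ)) * γ (l : ℤ)
      = ∑ j ∈ Finset.range (K + 1), ∑ k ∈ Finset.range j, g k j := by
    rw [← sum_lag_eq]
    refine Finset.sum_congr rfl fun l _ => Finset.sum_congr rfl fun k _ => ?_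
    simp only [hg, hu]
    push_cast
    rw [add_sub_cancel_left]
  have h3 : (∑ l : Fin (K + 1), α l ^ 2) * γ 0 = ∑ i ∈ Finset.range (K + 1), g i i := by
    rw [← Fin.sum_univ_eq_sum_range (fun i => g i i), Finset.sum_mul]
    refine Finset.sum_congr rfl fun i _ => ?_
    simp only [hg, hu, zeroExt_val, sub_self]
    ring
  rw [h1, h2, mul_assoc, h3, sum_symm_eq]
  · ring
  · intro i j
    simp only [hg]
    rw [← hγ, neg_sub]
    ring

section
variable {K p : ℕ} {φ : Fin p → ℝ} {P : ℝ} (h α : Fin (K + 1) → ℝ) (σ : ℝ)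

theorem norm_filtSym_sq (hφ : φ ∈ stable p) (hP : 0 < P) (a : Fin (K + 1) → ℝ) (ν : ℝ) :
    ‖filtSym a P φ ν‖ ^ 2 = ‖fourierTaps a ν‖ ^ 2 * SX P φ ν := by
  rw [filtSym, norm_mul, mul_pow, norm_wordSym_sq hφ hP]

theorem continuous_SY (hφ : φ ∈ stable p) : Continuous (SY h P σ φ) :=
  (((continuous_fourierTaps h).norm.pow 2).mul (continuous_SX hφ)).add continuous_const

/-- In the frequency domain the term is the average of `SX (Re (A H̄) - ½ |A|²)`; polarisation
rewrites it through `SX |H - A|²`. The two contributions of `σ²` cancel. -/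
theorem corrTerm_eq (hφ : φ ∈ stable p) (hP : 0 < P) :
    corrTerm h α P φ = 1 / 2 * avg (SY h P σ φ)
      - 1 / 2 * trueDist (filtSym α P φ) (filtSym h P φ) σ := by
  have hA := continuous_fourierTaps α
  have hH := continuous_fourierTaps h
  have hS := continuous_SX (P := P) hφ
  have hc : ∀ a b : Fin (K + 1) → ℝ, Continuous fun ν =>
      SX P φ ν * (fourierTaps a ν * conj (fourierTaps b ν)).re := fun a b =>
    hS.mul (Complex.continuous_re.comp ((continuous_fourierTaps a).mul
      (Complex.continuous_conj.comp (continuous_fourierTaps b))))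
  have hD : Continuous fun ν => ‖filtSym h P φ ν - filtSym α P φ ν‖ ^ 2 + σ ^ 2 :=
    (((continuous_filtSym h hφ P).sub (continuous_filtSym α hφ P)).norm.pow 2).add continuous_const
  unfold corrTerm
  rw [autocov_eq hφ, quadratic_lag_sum α _ specCov_neg, sum_specCov hφ, sum_specCov hφ, trueDist,
    ← avg_const_mul, ← avg_const_mul, ← avg_const_mul, ← avg_sub (hc _ _) ((hc _ _).const_mul _),
    ← avg_sub ((continuous_SY h σ hφ).const_mul _) (hD.const_mul _)]
  congr 1
  ext ν
  have e1 : ‖filtSym h P φ ν - filtSym α P φ ν‖ ^ 2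
      = ‖fourierTaps h ν - fourierTaps α ν‖ ^ 2 * SX P φ ν := by
    rw [filtSym, filtSym, ← sub_mul, norm_mul, mul_pow, norm_wordSym_sq hφ hP]
  rw [e1, SY]
  simp only [← Complex.normSq_eq_norm_sq, Complex.normSq_apply, Complex.mul_re, Complex.conj_re,
    Complex.conj_im, Complex.sub_re, Complex.sub_im]
  ring

theorem fOmega_eq (hφ : φ ∈ stable p) (hP : 0 < P) (ω ν : ℝ) :
    fOmega α P φ ω ν = (1 + ω * ‖filtSym α P φ ν‖ ^ 2) / (2 * SX P φ ν) := by
  have h1 : 1 + ‖fourierAR φ ν‖ ^ 2 - 2 * (fourierAR φ ν).re = ‖1 - fourierAR φ ν‖ ^ 2 := by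
    simp only [← Complex.normSq_eq_norm_sq, Complex.normSq_apply, Complex.sub_re, Complex.sub_im,
      Complex.one_re, Complex.one_im]
    ring
  rw [fOmega, h1, norm_filtSym_sq hφ hP, SX]
  have := innovVar_pos hφ hP
  have : ‖1 - fourierAR φ ν‖ ≠ 0 := norm_ne_zero_iff.2 (one_sub_fourierAR_ne_zero hφ ν)
  field_simp
  ring

/-- Since `fOmega` is `(1 + ω |β|²) / (2 SX)`, the logarithm splits and its autoregressive part
averages to zero. The quadratic integral simplifies through `ω |β|² / (1 + ω |β|²) = 1 - 1 / (1 + ω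
|β|²)`. -/
theorem objective_eq (hφ : φ ∈ stable p) (hP : 0 < P) {ω : ℝ} (hω : 0 ≤ ω) :
    objective h α P σ φ ω = 1 / 2 * Real.log (2 * innovVar P φ)
      - rateFn (filtSym α P φ) (filtSym h P φ) σ ω := by
  set β := filtSym α P φ with hβdef
  set κ := filtSym h P φ with hκdef
  have hβ : Continuous β := continuous_filtSym α hφ P
  have hκ : Continuous κ := continuous_filtSym h hφ P
  have hη := innovVar_pos hφ hP
  have hSY : ∀ ν, ‖κ ν‖ ^ 2 + σ ^ 2 = SY h P σ φ ν := fun ν => by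
    rw [SY, hκdef, norm_filtSym_sq hφ hP]
  have hlog : avg (fun ν => Real.log (fOmega α P φ ω ν))
      = avg (fun ν => Real.log (1 + ω * ‖β ν‖ ^ 2)) - Real.log (2 * innovVar P φ) := by
    have e : (fun ν => Real.log (fOmega α P φ ω ν)) = fun ν => Real.log (1 + ω * ‖β ν‖ ^ 2)
        + (Real.log (‖1 - fourierAR φ ν‖ ^ 2) - Real.log (2 * innovVar P φ)) := by
      ext ν
      have h1 := norm_one_sub_pos hφ ν
      rw [fOmega_eq α hφ hP, Real.log_div (one_add_pos hω _).ne'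
        (mul_pos two_pos (SX_pos hφ hP ν)).ne', SX, ← mul_div_assoc,
        Real.log_div (by positivity) h1.ne']
      ring
    have hc1 : Continuous fun ν => Real.log (‖1 - fourierAR φ ν‖ ^ 2) :=
      (continuous_norm_one_sub φ).log fun ν => (norm_one_sub_pos hφ ν).ne'
    have hc2 : Continuous fun ν => Real.log (‖1 - fourierAR φ ν‖ ^ 2)
        - Real.log (2 * innovVar P φ) := hc1.sub continuous_const
    rw [e, avg_add (continuous_log_one_add hβ hω) hc2,
      avg_sub hc1 continuous_const, avg_const, avg_log_norm_one_sub hφ]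
    ring
  have hdiv : ω * avg (fun ν => SY h P σ φ ν * ‖fourierTaps α ν‖ ^ 2 / fOmega α P φ ω ν)
      = 2 * avg (SY h P σ φ) - 2 * avg (fun ν => (‖κ ν‖ ^ 2 + σ ^ 2) / (1 + ω * ‖β ν‖ ^ 2)) := by
    rw [← avg_const_mul, ← avg_const_mul, ← avg_const_mul,
      ← avg_sub ((continuous_SY h σ hφ).const_mul _) ((continuous_div_one_add hβ hκ hω).const_mul _)]
    congr 1
    ext ν
    have h1 := SX_pos hφ hP ν
    have h2 := one_add_pos hω (β ν)
    rw [hSY, fOmega_eq α hφ hP]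
    change 0 < 1 + ω * ‖filtSym α P φ ν‖ ^ 2 at h2
    rw [hβdef]
    rw [norm_filtSym_sq hφ hP] at h2 ⊢
    field_simp
    ring
  have e1 : -(1 / (4 * Real.pi)) * (∫ ν in (0 : ℝ)..2 * Real.pi, Real.log (fOmega α P φ ω ν))
      = -(1 / 2) * avg (fun ν => Real.log (fOmega α P φ ω ν)) := by
    unfold avg; rw [smul_eq_mul]; field_simp; ring
  have e2 : ω ^ 2 / (8 * Real.pi) * (∫ ν in (0 : ℝ)..2 * Real.pi,
        SY h P σ φ ν * ‖fourierTaps α ν‖ ^ 2 / fOmega α P φ ω ν)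
      = ω / 4 * (ω * avg (fun ν => SY h P σ φ ν * ‖fourierTaps α ν‖ ^ 2 / fOmega α P φ ω ν)) := by
    unfold avg; rw [smul_eq_mul]; field_simp; ring
  rw [objective, e1, e2, hlog, hdiv, corrTerm_eq h α σ hφ hP, rateFn, ← hβdef, ← hκdef, trueDist]
  ring

/-- Otherwise `β` vanishes almost everywhere; as `SX > 0`, so does the transform of `α`, and
Parseval's identity forces `α = 0`. -/
theorem exists_slope_lt (hφ : φ ∈ stable p) (hP : 0 < P) {σ : ℝ} (hσ : 0 < σ) (hα : α ≠ 0) :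
    ∃ x, 0 ≤ x ∧ slopeFn (filtSym α P φ) (filtSym h P φ) σ x
      < trueDist (filtSym α P φ) (filtSym h P φ) σ := by
  by_contra hcon
  push Not at hcon
  have hae := ae_eq_zero_of_trueDist_le_slope (continuous_filtSym α hφ P)
    (continuous_filtSym h hφ P) hσ hcon
  refine hα ?_
  have h0 : avg (fun ν => ‖fourierTaps α ν‖ ^ 2) = 0 := by
    unfold avg
    rw [intervalIntegral.integral_of_le (by positivity), integral_eq_zero_of_ae, smul_zero]
    filter_upwards [hae] with ν hν
    have h1 := norm_filtSym_sq hφ hP α ν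
    rw [hν, norm_zero, zero_pow two_ne_zero, zero_eq_mul] at h1
    exact h1.resolve_right (SX_pos hφ hP ν).ne'
  rw [avg_norm_fourierTaps_sq, Finset.sum_eq_zero_iff_of_nonneg fun _ _ => sq_nonneg _] at h0
  ext l
  exact pow_eq_zero_iff two_ne_zero |>.1 (h0 l (Finset.mem_univ _))

theorem filtSym_zero (P : ℝ) (φ : Fin p → ℝ) :
    filtSym (0 : Fin (K + 1) → ℝ) P φ = 0 := by
  ext ν
  simp [filtSym, fourierTaps]

theorem rateFn_of_left_zero (κ : ℝ → ℂ) (σ ω : ℝ) : rateFn 0 κ σ ω = 0 := by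
  simp [rateFn, avg_const]

theorem exists_rateFn_le (hφ : φ ∈ stable p) (hP : 0 < P) {σ : ℝ} (hσ : 0 < σ) :
    ∃ c, ∀ ω, 0 ≤ ω → rateFn (filtSym α P φ) (filtSym h P φ) σ ω ≤ c := by
  by_cases hα : α = 0
  · exact ⟨0, fun ω _ => by rw [hα, filtSym_zero, rateFn_of_left_zero]⟩
  · obtain ⟨x, hx, hlt⟩ := exists_slope_lt h α hφ hP hσ hα
    exact ⟨_, fun ω hω => bddAbove_rateFn (continuous_filtSym α hφ P)
      (continuous_filtSym h hφ P) hx hlt.le hω⟩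

theorem bddBelow_objective (hφ : φ ∈ stable p) (hP : 0 < P) {σ : ℝ} (hσ : 0 < σ) :
    BddBelow (objective h α P σ φ '' Ioi 0) := by
  obtain ⟨c, hc⟩ := exists_rateFn_le h α hφ hP hσ
  refine ⟨1 / 2 * Real.log (2 * innovVar P φ) - c, ?_⟩
  rintro _ ⟨ω, hω, rfl⟩
  rw [objective_eq h α σ hφ hP (le_of_lt hω)]
  linarith [hc ω (le_of_lt hω)]

theorem convexOn_objective (hφ : φ ∈ stable p) (hP : 0 < P) :
    ConvexOn ℝ (Ioi 0) (objective h α P σ φ) := by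
  have h1 : ConvexOn ℝ (Ioi 0) fun ω => 1 / 2 * Real.log (2 * innovVar P φ)
      - rateFn (filtSym α P φ) (filtSym h P φ) σ ω :=
    (convexOn_const _ (convex_Ioi 0)).sub (((concaveOn_rateFn (continuous_filtSym α hφ P)
      (continuous_filtSym h hφ P)).subset Ioi_subset_Ici_self (convex_Ioi 0)))
  exact h1.congr fun ω hω => (objective_eq h α σ hφ hP (le_of_lt hω)).symm

theorem rateFn_le_rate (hφ : φ ∈ stable p) (hP : 0 < P) {σ : ℝ} (hσ : 0 < σ) {ω : ℝ} (hω : 0 < ω) :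
    rateFn (filtSym α P φ) (filtSym h P φ) σ ω ≤ rate h α P σ φ := by
  have := csInf_le (bddBelow_objective h α hφ hP hσ) (mem_image_of_mem _ (mem_Ioi.2 hω))
  rw [objective_eq h α σ hφ hP hω.le] at this
  unfold rate
  linarith

theorem exists_lt_rateFn (hφ : φ ∈ stable p) (hP : 0 < P) {R : ℝ} (hR : R < rate h α P σ φ) :
    ∃ ω, 0 < ω ∧ R < rateFn (filtSym α P φ) (filtSym h P φ) σ ω := by
  unfold rate at hR
  obtain ⟨_, ⟨ω, hω, rfl⟩, hlt⟩ := exists_lt_of_csInf_lt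
    (⟨_, mem_image_of_mem (objective h α P σ φ) (mem_Ioi.2 one_pos)⟩)
    (show sInf (objective h α P σ φ '' Ioi 0) < 1 / 2 * Real.log (2 * innovVar P φ) - R by linarith)
  rw [objective_eq h α σ hφ hP (le_of_lt hω)] at hlt
  exact ⟨ω, hω, by linarith⟩

/-- The first two terms of `rateFn` are nonnegative and the third vanishes as `ω → 0`. The converse
uses this to know that the rates it treats are positive. -/
theorem rate_nonneg (hφ : φ ∈ stable p) (hP : 0 < P) {σ : ℝ} (hσ : 0 < σ) :
    0 ≤ rate h α P σ φ := by
  have hβ := continuous_filtSym α hφ P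
  have hκ := continuous_filtSym h hφ P
  set D := trueDist (filtSym α P φ) (filtSym h P φ) σ with hD
  have hlow : ∀ ω : ℝ, 0 < ω → -(ω / 2 * D) ≤ rate h α P σ φ := by
    intro ω hω
    refine le_trans ?_ (rateFn_le_rate h α hφ hP hσ hω)
    rw [rateFn_eq_avg hβ hκ hω.le]
    have hc := ((continuous_log_one_add hβ hω.le).const_mul (1 / 2)).add
      ((continuous_div_one_add (σ := σ) hβ hκ hω.le).const_mul (ω / 2))
    have := avg_mono (continuous_const (y := (0 : ℝ))) hc fun ν => by
      have h1 : 0 ≤ Real.log (1 + ω * ‖filtSym α P φ ν‖ ^ 2) :=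
        Real.log_nonneg (le_add_of_nonneg_right (by positivity))
      exact add_nonneg (by positivity) (by positivity)
    rw [avg_const] at this
    rw [← hD, neg_eq_zero_sub]
    exact sub_le_sub_right this _
  have ht : Tendsto (fun ω : ℝ => -(ω / 2 * D)) (𝓝[>] 0) (𝓝 0) := by
    have : Continuous fun ω : ℝ => -(ω / 2 * D) := by fun_prop
    simpa using (this.tendsto 0).mono_left nhdsWithin_le_nhds
  exact le_of_tendsto ht (eventually_nhdsWithin_of_forall fun ω hω => hlow ω hω)

end

/-! ### Power of the autoregressive ensemble -/

section
variable {p : ℕ} {φ : Fin p → ℝ} {P : ℝ}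

theorem lintegral_sq_linear {ι : Type*} [Fintype ι] (a : ι → ℝ) :
    ∫⁻ z, ENNReal.ofReal ((∑ i, a i * z i) ^ 2) ∂(stdG ι) = ENNReal.ofReal (∑ i, a i ^ 2) := by
  have hid : MemLp (fun x : ℝ => x) 2 (gaussianReal 0 1) :=
    memLp_id_gaussianReal' (μ := 0) (v := 1) 2 (by norm_num)
  have hmem : ∀ i, MemLp (fun x : ℝ => a i * x) 2 (gaussianReal 0 1) :=
    fun i => hid.const_mul (a i)
  have hmemv : ∀ i, MemLp (fun v : ι → ℝ => a i * v i) 2 (stdG ι) := fun i =>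
    (hmem i).comp_measurePreserving (measurePreserving_eval (fun _ : ι => gaussianReal 0 1) i)
  have hsum : MemLp (fun v : ι → ℝ => ∑ i, a i * v i) 2 (stdG ι) :=
    memLp_finsetSum _ fun i _ => hmemv i
  have hmean : ∫ v, ∑ i, a i * v i ∂(stdG ι) = 0 := by
    rw [integral_finsetSum _ fun i _ => (hmemv i).integrable one_le_two]
    refine Finset.sum_eq_zero fun i _ => ?_
    have hp := measurePreserving_eval (fun _ : ι => gaussianReal 0 1) i
    have h := integral_map (μ := stdG ι) (f := fun x : ℝ => a i * x)
      hp.measurable.aemeasurable (by fun_prop)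
    have hmap : Measure.map (Function.eval i) (stdG ι) = gaussianReal 0 1 := hp.map_eq
    rw [hmap, integral_const_mul, integral_id_gaussianReal, mul_zero] at h
    exact h.symm
  have hvar : Var[fun v : ι → ℝ => ∑ i, a i * v i; stdG ι] = ∑ i, a i ^ 2 := by
    have h := variance_sum_pi (μ := fun _ : ι => gaussianReal 0 1) hmem
    have e : (∑ i, fun v : ι → ℝ => a i * v i) = fun v : ι → ℝ => ∑ i, a i * v i := by
      ext v; simp
    rw [e] at h
    rw [stdG, h]
    refine Finset.sum_congr rfl fun i _ => ?_
    rw [variance_const_mul, variance_fun_id_gaussianReal]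
    simp
  rw [variance_of_integral_eq_zero hsum.aestronglyMeasurable.aemeasurable hmean] at hvar
  rw [← hvar, ofReal_integral_eq_lintegral_ofReal hsum.integrable_sq
    (ae_of_all _ fun _ => sq_nonneg _)]

/-- The unit impulse at time `s`. -/
def impulse (s : ℕ) (t : ℕ) : ℝ := if t = s then 1 else 0

/-- Time invariance of the recursion started from rest. Consequently each codeword variance is a
partial sum of squares of a single impulse response, hence monotone in time. -/
theorem arSeq_impulse_succ (φ : Fin p → ℝ) (η : ℝ) (s t : ℕ) :
    arSeq φ η (impulse (s + 1)) (t + 1) = arSeq φ η (impulse s) t := by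
  induction t using Nat.strong_induction_on with
  | _ t ih =>
    rw [arSeq, arSeq.eq_def φ η (impulse s) t]
    congr 1
    · refine Finset.sum_congr rfl fun i _ => ?_
      by_cases hi : (i : ℕ) + 1 ≤ t
      · rw [if_pos (by omega), if_pos hi, ← ih (t - ((i : ℕ) + 1)) (by omega)]
        congr 2
        omega
      · rw [if_neg hi]
        split_ifs with h2
        · have : t + 1 - ((i : ℕ) + 1) = 0 := by omega
          rw [this, arSeq]
          simp [impulse]
        · rfl
    · simp [impulse]

theorem arSeq_impulse_of_lt (φ : Fin p → ℝ) (η : ℝ) {s t : ℕ} (hst : t < s) :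
    arSeq φ η (impulse s) t = 0 := by
  induction t using Nat.strong_induction_on with
  | _ t ih =>
    rw [arSeq, Finset.sum_eq_zero]
    · simp [impulse, hst.ne]
    · intro i _
      split_ifs with hi
      · rw [ih _ (by omega) (by omega), mul_zero]
      · rfl

theorem arSeq_impulse (φ : Fin p → ℝ) (η : ℝ) (s t : ℕ) :
    arSeq φ η (impulse s) (t + s) = arSeq φ η (impulse 0) t := by
  induction s with
  | zero => rfl
  | succ s ih => rw [← add_assoc, arSeq_impulse_succ, ih]

theorem wordMat_apply (P : ℝ) (φ : Fin p → ℝ) {n : ℕ} (t s : Fin n) :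
    wordMat P φ n t s = arSeq φ (Real.sqrt (innovVar P φ)) (impulse s) t := by
  have h := congrFun (arWord_eq P φ (Pi.single s 1 : Fin n → ℝ)) t
  rw [Matrix.mulVec_single_one] at h
  refine Eq.trans h.symm ?_
  unfold arWord
  congr 1
  ext r
  unfold zeroExt impulse
  by_cases hr : r = s
  · have := s.2
    rw [dif_pos (by omega), if_pos hr, Pi.single_apply, if_pos]
    exact Fin.ext (by simp [hr])
  · rw [if_neg hr]
    split_ifs with h2
    · rw [Pi.single_apply, if_neg]
      intro h3
      exact hr (by simpa using congrArg Fin.val h3)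
    · rfl

/-- The variance of the codeword process at a given time. -/
def wordVar (P : ℝ) (φ : Fin p → ℝ) (t : ℕ) : ℝ :=
  ∑ j ∈ Finset.range (t + 1), arSeq φ (Real.sqrt (innovVar P φ)) (impulse 0) j ^ 2

theorem sum_wordMat_sq (P : ℝ) (φ : Fin p → ℝ) {n : ℕ} (t : Fin n) :
    ∑ s, wordMat P φ n t s ^ 2 = wordVar P φ t := by
  simp only [wordMat_apply]
  rw [Fin.sum_univ_eq_sum_range
    (fun s => arSeq φ (Real.sqrt (innovVar P φ)) (impulse s) t ^ 2), wordVar]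
  have ht := t.2
  rw [← Finset.sum_subset (Finset.range_subset_range.2 ht) (s₁ := Finset.range (t + 1))]
  · rw [← Finset.sum_range_reflect]
    refine Finset.sum_congr rfl fun j hj => ?_
    rw [Finset.mem_range] at hj
    rw [← arSeq_impulse φ _ (t + 1 - 1 - j) j]
    congr 2
    omega
  · intro s _ hs
    rw [Finset.mem_range, not_lt] at hs
    rw [arSeq_impulse_of_lt _ _ (by omega), zero_pow two_ne_zero]

theorem monotone_wordVar (P : ℝ) (φ : Fin p → ℝ) : Monotone (wordVar P φ) := fun _ _ hst =>
  Finset.sum_le_sum_of_subset_of_nonneg (Finset.range_subset_range.2 (by omega))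
    fun _ _ _ => sq_nonneg _

/-- The variances increase in time while their Cesàro means tend to `avg (SX P φ) = P`, so none
exceeds `P`. -/
theorem wordVar_le (hφ : φ ∈ stable p) (hP : 0 < P) (t : ℕ) : wordVar P φ t ≤ P := by
  have hlim := (hasSymbol_mul_transpose (hasSymbol_wordMat hφ P)).real_trace_tendsto
  rw [show (fun ν => ‖wordSym P φ ν‖ ^ 2) = SX P φ from funext (norm_wordSym_sq hφ hP),
    avg_SX hφ] at hlim
  -- The times from `t` to `n - 1` alone contribute at least `(n - t) / n` times the variance at `t`
  -- to the mean.
  have hlow : Tendsto (fun n : ℕ => wordVar P φ t - t * wordVar P φ t / n) atTop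
      (𝓝 (wordVar P φ t - 0)) :=
    tendsto_const_nhds.sub (tendsto_const_nhds.div_atTop tendsto_natCast_atTop_atTop)
  rw [sub_zero] at hlow
  refine le_of_tendsto_of_tendsto hlow hlim ?_
  filter_upwards [eventually_gt_atTop t] with n hn
  have hn0 : (0 : ℝ) < n := by exact_mod_cast (Nat.zero_le t).trans_lt hn
  have htr : (wordMat P φ n * (wordMat P φ n)ᵀ).trace = ∑ r ∈ Finset.range n, wordVar P φ r := by
    rw [← Fin.sum_univ_eq_sum_range (wordVar P φ), Matrix.trace]
    refine Finset.sum_congr rfl fun r _ => ?_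
    rw [← sum_wordMat_sq]
    simp [Matrix.mul_apply, sq]
  rw [htr, le_div_iff₀ hn0, sub_mul, div_mul_cancel₀ _ hn0.ne']
  have h1 : ∑ r ∈ Finset.Ico t n, wordVar P φ t ≤ ∑ r ∈ Finset.range n, wordVar P φ r := by
    refine (Finset.sum_le_sum fun r hr => monotone_wordVar P φ (Finset.mem_Ico.1 hr).1).trans ?_
    rw [Finset.range_eq_Ico]
    exact Finset.sum_le_sum_of_subset_of_nonneg (Finset.Ico_subset_Ico_left (Nat.zero_le _))
      fun _ _ _ => Finset.sum_nonneg fun _ _ => sq_nonneg _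
  rw [Finset.sum_const, Nat.card_Ico, nsmul_eq_mul, Nat.cast_sub hn.le] at h1
  linarith

theorem lintegral_arWord_sq (P : ℝ) (φ : Fin p → ℝ) {n : ℕ} (t : Fin n) :
    ∫⁻ z, ENNReal.ofReal (arWord P φ z t ^ 2) ∂(noise n 1) = ENNReal.ofReal (wordVar P φ t) := by
  rw [noise_one, ← sum_wordMat_sq, ← lintegral_sq_linear]
  simp only [arWord_eq]
  rfl

theorem sum_lintegral_arWord_sq_le (hφ : φ ∈ stable p) (hP : 0 < P) (n : ℕ) :
    ∑ t : Fin n, ∫⁻ z, ENNReal.ofReal (arWord P φ z t ^ 2) ∂(noise n 1)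
      ≤ ENNReal.ofReal (n * P) := by
  calc ∑ t : Fin n, ∫⁻ z, ENNReal.ofReal (arWord P φ z t ^ 2) ∂(noise n 1)
      ≤ ∑ _t : Fin n, ENNReal.ofReal P := by
        refine Finset.sum_le_sum fun t _ => ?_
        rw [lintegral_arWord_sq]
        exact ENNReal.ofReal_le_ofReal (wordVar_le hφ hP t)
    _ = ENNReal.ofReal (n * P) := by
        rw [Finset.sum_const, Finset.card_univ, Fintype.card_fin, nsmul_eq_mul,
          ENNReal.ofReal_mul (Nat.cast_nonneg n), ENNReal.ofReal_natCast]

end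

/-! ### The threshold of the ensemble -/

section
variable {K p : ℕ} {φ : Fin p → ℝ} {P σ : ℝ} (h α : Fin (K + 1) → ℝ)

theorem avgErrorProb_tendsto (hφ : φ ∈ stable p) (hP : 0 < P) (hσ : 0 < σ) {R : ℝ}
    (hR : R < rate h α P σ φ) : Tendsto (avgErrorProb h α P σ φ R) atTop (𝓝 0) := by
  obtain ⟨ω, hω, hlt⟩ := exists_lt_rateFn h α σ hφ hP hR
  rw [funext (avgErrorProb_eq h α P φ hσ R)]
  exact ensembleErr_tendsto (hasSymbol_filtMat α hφ P) (hasSymbol_filtMat h hφ P) σ hω.le hlt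

theorem pairErr_zero {n : ℕ} (C : Matrix (Fin n) (Fin n) ℝ) (σ : ℝ)
    (x : (Fin n → ℝ) × (Fin n → ℝ)) : pairErr 0 C σ x = 1 := by
  unfold pairErr closeProb dist2
  simp

theorem filtMat_zero (P : ℝ) (φ : Fin p → ℝ) (n : ℕ) :
    filtMat (0 : Fin (K + 1) → ℝ) P φ n = 0 := by
  simp [filtMat, tapMat]

theorem not_tendsto_avgErrorProb (hφ : φ ∈ stable p) (hP : 0 < P) (hσ : 0 < σ) {R : ℝ}
    (hR : rate h α P σ φ < R) : ¬ Tendsto (avgErrorProb h α P σ φ R) atTop (𝓝 0) := by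
  have hrate := rate_nonneg h α hφ hP hσ
  have hR0 : 0 < R := hrate.trans_lt hR
  rw [funext (avgErrorProb_eq h α P φ hσ R)]
  by_cases hα : α = 0
  · subst hα
    simp only [filtMat_zero, pairErr_zero, tsub_self]
    intro hlim
    -- For `α = 0` all codewords tie, and with `R > 0` and `n ≥ 1` there is at least one competitor,
    -- so the error probability is `1`.
    have hev : ∀ᶠ n : ℕ in atTop, (1 : ℝ≥0∞) ≤ ∫⁻ _x, 1 - 0 ^ (⌈Real.exp (n * R)⌉₊ - 1) ∂(pairLaw n) := by
      filter_upwards [eventually_ge_atTop 1] with n hn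
      have h1 : 1 < ⌈Real.exp (n * R)⌉₊ := by
        refine Nat.lt_ceil.2 ?_
        rw [Nat.cast_one]
        have : (0 : ℝ) < n := by exact_mod_cast hn
        exact Real.one_lt_exp_iff.2 (by positivity)
      rw [zero_pow (by omega), tsub_zero, lintegral_one, measure_univ]
    exact absurd (ge_of_tendsto hlim hev) (by simp)
  · have hβ := continuous_filtSym α hφ P
    have hκ := continuous_filtSym h hφ P
    obtain ⟨x, hx, hsl, hsmall⟩ := exists_tilt hβ hκ (exists_slope_lt h α hφ hP hσ hα)
      (sub_pos.2 hR)
    have hle : rateFn (filtSym α P φ) (filtSym h P φ) σ x ≤ rate h α P σ φ := by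
      -- The infimum defining the rate omits `ω = 0`; there the exponent is `0`, which nonnegativity
      -- of the rate covers.
      rcases hx.eq_or_lt with h0 | h0
      · rw [← h0, rateFn_zero]; exact hrate
      · exact rateFn_le_rate h α hφ hP hσ h0
    exact ensembleErr_not_tendsto (hasSymbol_filtMat α hφ P) (hasSymbol_filtMat h hφ P) σ hx hsl hR0
      (by linarith)

/-! ### Achievability under the power constraint -/

/-- Keeping `ω` fixed while the power varies gives the continuity needed to lower `P` slightly,
without any continuity of the infimum over `ω`. -/
theorem continuous_rateFn_power (hφ : φ ∈ stable p) {ω : ℝ} (hω : 0 ≤ ω) :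
    Continuous fun Q => rateFn (filtSym α Q φ) (filtSym h Q φ) σ ω := by
  have hcs : ∀ a : Fin (K + 1) → ℝ, Continuous fun q : ℝ × ℝ => filtSym a q.1 φ q.2 := by
    intro a
    unfold filtSym wordSym innovVar
    have h1 := continuous_fourierTaps a
    have h2 := continuous_fourierAR φ
    refine (h1.comp continuous_snd).mul (Continuous.mul (by fun_prop) ?_)
    exact Continuous.inv₀ (by fun_prop) fun q => one_sub_fourierAR_ne_zero hφ q.2
  have hα := hcs α
  have hh := hcs h
  unfold rateFn
  have hpos : ∀ q : ℝ × ℝ, 1 + ω * ‖filtSym α q.1 φ q.2‖ ^ 2 ≠ 0 := fun q => (one_add_pos hω _).ne'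
  refine ((Continuous.mul continuous_const (continuous_avg_param ?_)).add
    (Continuous.mul continuous_const (continuous_avg_param ?_))).sub
    (Continuous.mul continuous_const (continuous_avg_param ?_))
  · exact Continuous.log (by fun_prop) hpos
  · exact Continuous.div (by fun_prop) (by fun_prop) hpos
  · change Continuous fun q : ℝ × ℝ => ‖filtSym h q.1 φ q.2 - filtSym α q.1 φ q.2‖ ^ 2 + σ ^ 2
    fun_prop

theorem measurable_arWord_apply {n : ℕ} (P : ℝ) (φ : Fin p → ℝ) (t : Fin n) :
    Measurable fun z : Fin n → ℝ => arWord P φ z t := by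
  simp only [arWord_eq]
  exact (measurable_pi_apply t).comp (measurable_mulVec _)

theorem lintegral_codebook_power_le (hφ : φ ∈ stable p) (hP : 0 < P) (n M : ℕ) :
    ∫⁻ z : Fin M → Fin n → ℝ, ENNReal.ofReal
        (∑ t : Fin n, (1 / (M : ℝ)) * ∑ i : Fin M, arWord P φ (z i) t ^ 2)
        ∂(Measure.pi fun _ => noise n 1)
      ≤ ENNReal.ofReal (n * P) := by
  have : IsProbabilityMeasure (noise n 1) := by rw [noise_one]; infer_instance
  rcases Nat.eq_zero_or_pos M with rfl | hM
  · simp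
  have hm : ∀ (t : Fin n), Measurable fun z : Fin n → ℝ => ENNReal.ofReal (arWord P φ z t ^ 2) :=
    fun t => ((measurable_arWord_apply P φ t).pow_const 2).ennreal_ofReal
  have hm2 : ∀ (t : Fin n) (i : Fin M), Measurable fun z : Fin M → Fin n → ℝ =>
      ENNReal.ofReal (arWord P φ (z i) t ^ 2) := fun t i => (hm t).comp (measurable_pi_apply i)
  have e : ∀ z : Fin M → Fin n → ℝ, ENNReal.ofReal
      (∑ t : Fin n, (1 / (M : ℝ)) * ∑ i : Fin M, arWord P φ (z i) t ^ 2)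
      = ∑ t : Fin n, (M : ℝ≥0∞)⁻¹ * ∑ i : Fin M, ENNReal.ofReal (arWord P φ (z i) t ^ 2) := by
    intro z
    rw [ENNReal.ofReal_sum_of_nonneg fun t _ => by positivity]
    refine Finset.sum_congr rfl fun t _ => ?_
    rw [ENNReal.ofReal_mul (by positivity), ENNReal.ofReal_sum_of_nonneg fun i _ => sq_nonneg _,
      one_div, ENNReal.ofReal_inv_of_pos (by exact_mod_cast hM), ENNReal.ofReal_natCast]
  simp only [e]
  rw [lintegral_finsetSum _ fun t _ => (Finset.measurable_sum _ fun i _ => hm2 t i).const_mul _]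
  refine le_trans (le_of_eq (Finset.sum_congr rfl fun t _ => ?_))
    (sum_lintegral_arWord_sq_le hφ hP n)
  rw [lintegral_const_mul _ (Finset.measurable_sum _ fun i _ => hm2 t i),
    lintegral_finsetSum _ fun i _ => hm2 t i]
  have hi : ∀ i : Fin M, ∫⁻ z : Fin M → Fin n → ℝ, ENNReal.ofReal (arWord P φ (z i) t ^ 2)
      ∂(Measure.pi fun _ => noise n 1)
      = ∫⁻ z, ENNReal.ofReal (arWord P φ z t ^ 2) ∂(noise n 1) := fun i =>
    (measurePreserving_eval (fun _ : Fin M => noise n 1) i).lintegral_comp (hm t)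
  rw [Finset.sum_congr rfl fun i _ => hi i, Finset.sum_const, Finset.card_univ, Fintype.card_fin,
    nsmul_eq_mul, ← mul_assoc, ENNReal.inv_mul_cancel (by simpa using hM.ne') (by simp), one_mul]

/-- Expurgation: some codebook of the ensemble with power `Q < P` meets the power constraint `P`
and has an error probability comparable to the ensemble average. -/
theorem exists_code (hφ : φ ∈ stable p) {Q : ℝ} (hQ : 0 < Q) (hQP : Q < P) (R : ℝ) {n : ℕ}
    (hn : 1 ≤ n) :
    ∃ x : Fin ⌈Real.exp (n * R)⌉₊ → Fin n → ℝ, PowerConstraint P x ∧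
      errorProb h α σ x
        ≤ avgErrorProb h α Q σ φ R n / ENNReal.ofReal ((1 - Q / P) / 2) + (n : ℝ≥0∞)⁻¹ := by
  have hP : 0 < P := hQ.trans hQP
  have hn0 : (0 : ℝ) < n := by exact_mod_cast hn
  have hprob : IsProbabilityMeasure (noise n 1) := by rw [noise_one]; infer_instance
  set c := (1 - Q / P) / 2 with hc
  have hqp : Q / P < 1 := (div_lt_one hP).2 hQP
  have hc0 : 0 < c := by rw [hc]; linarith
  have hcE : ENNReal.ofReal c ≠ 0 := (ENNReal.ofReal_pos.2 hc0).ne'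
  set a := avgErrorProb h α Q σ φ R n with ha
  -- The target error level. The term `1 / n` keeps it positive even if the mean error vanishes, and
  -- tends to zero.
  set θ := a / ENNReal.ofReal c + (n : ℝ≥0∞)⁻¹ with hθ
  have hθ0 : θ ≠ 0 := by
    rw [hθ]
    simp
  set pw : (Fin ⌈Real.exp (n * R)⌉₊ → Fin n → ℝ) → ℝ := fun z =>
    ∑ t : Fin n, (1 / (⌈Real.exp (n * R)⌉₊ : ℝ)) * ∑ i, arWord Q φ (z i) t ^ 2 with hpw
  have hpwm : Measurable fun z => ENNReal.ofReal (pw z) / ENNReal.ofReal (n * P) := by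
    refine Measurable.div_const (Measurable.ennreal_ofReal ?_) _
    refine Finset.measurable_sum _ fun t _ => Measurable.const_mul ?_ _
    exact Finset.measurable_sum _ fun i _ =>
      ((measurable_arWord_apply Q φ t).comp (measurable_pi_apply i)).pow_const 2
  have hnP : ENNReal.ofReal (n * P) ≠ 0 := (ENNReal.ofReal_pos.2 (by positivity)).ne'
  -- Relative power has mean at most `Q / P` and relative error at most `c`; their sum is `(1 + Q /
  -- P) / 2 < 1`. Some codebook therefore has both at most `1`.
  have hint : ∫⁻ z, (ENNReal.ofReal (pw z) / ENNReal.ofReal (n * P)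
      + errorProb h α σ (fun i => arWord Q φ (z i)) / θ) ∂(Measure.pi fun _ => noise n 1) < 1 := by
    rw [lintegral_add_left hpwm]
    simp only [div_eq_mul_inv]
    rw [lintegral_mul_const' _ _ (ENNReal.inv_ne_top.2 hnP),
      lintegral_mul_const' _ _ (ENNReal.inv_ne_top.2 hθ0)]
    have h1 := lintegral_codebook_power_le hφ hQ n ⌈Real.exp (n * R)⌉₊
    have h2 : a * θ⁻¹ ≤ ENNReal.ofReal c := by
      rw [← div_eq_mul_inv]
      refine ENNReal.div_le_of_le_mul ?_
      rw [hθ, mul_add, ENNReal.mul_div_cancel hcE ENNReal.ofReal_ne_top]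
      exact le_self_add
    calc _ ≤ ENNReal.ofReal (n * Q) * (ENNReal.ofReal (n * P))⁻¹ + ENNReal.ofReal c := by
          gcongr
          exact h2
      _ = ENNReal.ofReal (Q / P + c) := by
          rw [← div_eq_mul_inv, ← ENNReal.ofReal_div_of_pos (by positivity),
            mul_div_mul_left _ _ hn0.ne', ENNReal.ofReal_add (by positivity) hc0.le]
      _ < 1 := by
          rw [ENNReal.ofReal_lt_one, hc]
          linarith
  obtain ⟨z, hz⟩ : ∃ z, ENNReal.ofReal (pw z) / ENNReal.ofReal (n * P)
      + errorProb h α σ (fun i => arWord Q φ (z i)) / θ ≤ 1 := by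
    by_contra hcon
    push Not at hcon
    refine absurd hint (not_lt.2 ?_)
    calc (1 : ℝ≥0∞) = ∫⁻ _z, 1 ∂(Measure.pi fun _ : Fin ⌈Real.exp (n * R)⌉₊ => noise n 1) := by
          rw [lintegral_one, measure_univ]
      _ ≤ _ := lintegral_mono fun z => (hcon z).le
  refine ⟨fun i => arWord Q φ (z i), ?_, ?_⟩
  · have h1 := le_self_add.trans hz
    rw [ENNReal.div_le_iff hnP ENNReal.ofReal_ne_top, one_mul,
      ENNReal.ofReal_le_ofReal_iff (by positivity)] at h1
    exact h1
  · by_cases ht : θ = ⊤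
    · rw [ht]; exact le_top
    · have h1 := le_add_self.trans hz
      rwa [ENNReal.div_le_iff hθ0 ht, one_mul] at h1

theorem achievable_rate (hφ : φ ∈ stable p) (hP : 0 < P) (hσ : 0 < σ) :
    Achievable h α P σ (rate h α P σ φ) := by
  intro δ hδ
  obtain ⟨ω, hω, hlt⟩ := exists_lt_rateFn h α σ hφ hP (sub_lt_self (rate h α P σ φ) hδ)
  set R := rate h α P σ φ - δ with hR
  -- Lower the power while the Chernoff exponent at this `ω` still exceeds `R`; the gap below `P`
  -- leaves room for the expurgation.
  obtain ⟨Q, ⟨hQlt, hQ⟩, hQP⟩ : ∃ Q, (R < rateFn (filtSym α Q φ) (filtSym h Q φ) σ ω ∧ 0 < Q)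
      ∧ Q < P := by
    have h1 : ∀ᶠ Q in 𝓝[<] P, R < rateFn (filtSym α Q φ) (filtSym h Q φ) σ ω :=
      nhdsWithin_le_nhds ((continuous_rateFn_power h α hφ hω.le).continuousAt.eventually_const_lt hlt)
    have h2 : ∀ᶠ Q in 𝓝[<] P, 0 < Q := nhdsWithin_le_nhds (lt_mem_nhds hP)
    exact ((h1.and h2).and self_mem_nhdsWithin).exists
  have herr := avgErrorProb_tendsto h α hφ hQ hσ
    (hQlt.trans_le (rateFn_le_rate h α hφ hQ hσ hω))
  have hcode : ∀ n : ℕ, ∃ x : Fin ⌈Real.exp (n * R)⌉₊ → Fin n → ℝ, 1 ≤ n → PowerConstraint P x ∧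
      errorProb h α σ x
        ≤ avgErrorProb h α Q σ φ R n / ENNReal.ofReal ((1 - Q / P) / 2) + (n : ℝ≥0∞)⁻¹ := by
    intro n
    by_cases hn : 1 ≤ n
    · obtain ⟨x, hx⟩ := exists_code (σ := σ) h α hφ hQ hQP R hn
      exact ⟨x, fun _ => hx⟩
    -- The code at length zero is irrelevant: the constraints are imposed only for `n ≥ 1`.
    · exact ⟨0, fun h => absurd h hn⟩
  choose code hcode using hcode
  refine ⟨fun n => ⌈Real.exp (n * R)⌉₊, code, fun n hn => ⟨Nat.le_ceil _, (hcode n hn).1⟩, ?_⟩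
  have hc : ENNReal.ofReal ((1 - Q / P) / 2) ≠ 0 :=
    (ENNReal.ofReal_pos.2 (half_pos (sub_pos.2 ((div_lt_one hP).2 hQP)))).ne'
  have hlim : Tendsto (fun n : ℕ => avgErrorProb h α Q σ φ R n
      / ENNReal.ofReal ((1 - Q / P) / 2) + (n : ℝ≥0∞)⁻¹) atTop (𝓝 0) := by
    have := (ENNReal.Tendsto.div_const herr (Or.inr hc)).add ENNReal.tendsto_inv_nat_nhds_zero
    simpa using this
  exact tendsto_of_tendsto_of_tendsto_of_le_of_le' tendsto_const_nhds hlim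
    (Eventually.of_forall fun _ => zero_le)
    ((eventually_ge_atTop 1).mono fun n hn => (hcode n hn).2)

end

end ISI

end

theorem theorem1 (K p : ℕ) (h α : Fin (K + 1) → ℝ) (P σ : ℝ) (hP : 0 < P) (hσ : 0 < σ) :
    (⨆ φ ∈ ISI.stable p, ((ISI.rate h α P σ φ : ℝ) : EReal)) ≤ ISI.mismatchCapacity h α P σ ∧
    ∀ φ ∈ ISI.stable p,
      -- the rate expression is well defined, through a convex minimisation over `ω > 0`
      (∃! γ : ℤ → ℝ, ISI.IsYuleWalker P φ γ) ∧
      ConvexOn ℝ (Set.Ioi 0) (ISI.objective h α P σ φ) ∧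
      BddBelow (ISI.objective h α P σ φ '' Set.Ioi 0) ∧
      -- the autoregressive ensemble meets the power constraint and achieves the rate
      (∀ n : ℕ, ∑ t : Fin n, ∫⁻ z, ENNReal.ofReal (ISI.arWord P φ z t ^ 2) ∂(ISI.noise n 1)
        ≤ ENNReal.ofReal (n * P)) ∧
      (∀ R : ℝ, R < ISI.rate h α P σ φ →
        Tendsto (ISI.avgErrorProb h α P σ φ R) atTop (𝓝 0)) ∧
      -- ensemble tightness
      (∀ R : ℝ, ISI.rate h α P σ φ < R →
        ¬ Tendsto (ISI.avgErrorProb h α P σ φ R) atTop (𝓝 0)) := by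
  refine ⟨iSup₂_le fun φ hφ => le_sSup ⟨_, ISI.achievable_rate h α hφ hP hσ, rfl⟩,
    fun φ hφ => ⟨⟨ISI.specCov P φ, ISI.isYuleWalker_specCov hφ,
      fun γ hγ => ISI.yuleWalker_unique hφ hγ (ISI.isYuleWalker_specCov hφ)⟩,
      ISI.convexOn_objective h α σ hφ hP, ISI.bddBelow_objective h α hφ hP hσ,
      ISI.sum_lintegral_arWord_sq_le hφ hP,
      fun R hR => ISI.avgErrorProb_tendsto h α hφ hP hσ hR,
      fun R hR => ISI.not_tendsto_avgErrorProb h α hφ hP hσ hR⟩⟩
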